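/- Call a $k$-CNF formula a conjunction of clauses each of which has at most $k$ literals, and for such a formula $F$ on $n$ variables let $\Omega_F\subseteq\{0,1\}^n$ be its set of satisfying assignments. For a multiset $S$ of points of $\{0,1\}^n$ put $\mathrm{sumPD}(S)=\frac12\sum_{x\in S}\sum_{y\in S}d_H(x,y)$ (with multiplicities, $d_H$ the Hamming distance), and let $\mathrm{Opt\text{-}sum}(F,s)$ be the maximum of $\mathrm{sumPD}(S)$ over all multisets $S$ of $s$ elements of $\Omega_F$. **Theorem.** There are an absolute constant $c$ and a function $\varepsilon(n)$ with $\varepsilon(n)\to0$ as $n\to\infty$ such that for every integer $k\ge2$ there are a constant $K$ and a randomized algorithm (a program for a random access machine with logarithmic cost and fair coin flips) with the following properties. The algorithm takes as input a $k$-CNF formula $F$ on $n$ variables and an integer $s\ge1$, and for all outcomes of its coin flips it halts within time $$K\cdot|F|^{c}\cdot s^4\cdot 2^{\,n-n/k},$$ that is, in time $O^*(s^4\,2^{n-n/k})$, where $|F|$ is one plus the number of variables, of clauses and of occurrences of literals of $F$. If $F$ is satisfiable, then with probability at least $1-\varepsilon(n)$ the output is a multiset $S^*$ of $s$ elements of $\Omega_F$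 such that 1. $\displaystyle \mathrm{sumPD}(S^*)\ \ge\ \frac12\Bigl(1-\frac{2}{k+1}\Bigr)\cdot\mathrm{Opt\text{-}sum}(F,s)$ if $s\le 3+\bigl\lfloor\tfrac{4}{k-1}\bigr\rfloor$; 2. $\displaystyle \mathrm{sumPD}(S^*)\ \ge\ \frac{k-1}{k+3}\cdot\frac{1-\frac1s}{1+\frac{k-1}{k+3}\cdot\frac1s}\cdot\mathrm{Opt\text{-}sum}(F,s)$ if $s\ge 3+\bigl\lceil\tfrac{4}{k-1}\bigr\rceil$. -/

import Mathlib

open Filter Topology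

/-! ### CNF formulas and their solutions -/

/-- A CNF formula on the variables `0, …, n - 1`: a list of clauses, each clause a list of literals.
The literal `(i, true)` is the variable `i`, the literal `(i, false)` is its negation. -/
abbrev CNFFormula (n : ℕ) : Type := List (List (Fin n × Bool))

/-- The formula is a `k`-CNF: every clause has at most `k` literals. -/
def IsKCNF (k : ℕ) {n : ℕ} (F : CNFFormula n) : Prop :=
  ∀ C ∈ F, C.length ≤ k

/-- The assignment `z` satisfies the formula `F`. -/
def Satisfies {n : ℕ} (F : CNFFormula n) (z : Fin n → Bool) : Prop :=
  ∀ C ∈ F, ∃ l ∈ C, z l.1 = l.2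

/-! ### Sum dispersion -/

/-- The sum of pairwise Hamming distances of a multiset of assignments,
`(1/2) * ∑_{x ∈ S} ∑_{y ∈ S} d_H(x, y)`, counted with multiplicities. -/
noncomputable def sumPD {n : ℕ} (S : Multiset (Fin n → Bool)) : ℝ :=
  1 / 2 * (S.map fun x => (S.map fun y => (hammingDist x y : ℝ)).sum).sum

/-- The values of `sumPD` on the multisets of `s` satisfying assignments of `F`. -/
def sumPDValues {n : ℕ} (F : CNFFormula n) (s : ℕ) : Set ℝ :=
  {v | ∃ S : Multiset (Fin n → Bool), S.card = s ∧ (∀ z ∈ S, Satisfies F z) ∧ sumPD S = v}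

/-- The maximum of `sumPD` over the multisets of `s` satisfying assignments of `F`. -/
noncomputable def optSum {n : ℕ} (F : CNFFormula n) (s : ℕ) : ℝ :=
  sSup (sumPDValues F s)

/-- For a satisfiable formula the supremum in `optSum` is a maximum. -/
theorem optSum_isGreatest {n : ℕ} (F : CNFFormula n) (s : ℕ) (hF : ∃ z, Satisfies F z) :
    IsGreatest (sumPDValues F s) (optSum F s) := by
  have hfin : (sumPDValues F s).Finite := by
    refine (Set.finite_range fun S : Sym (Fin n → Bool) s => sumPD (S : Multiset (Fin n → Bool))).subset ?_
    rintro v ⟨S, hc, -, rfl⟩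
    exact ⟨⟨S, hc⟩, rfl⟩
  have hne : (sumPDValues F s).Nonempty := by
    obtain ⟨z, hz⟩ := hF
    refine ⟨_, Multiset.replicate s z, Multiset.card_replicate s z, ?_, rfl⟩
    intro w hw
    rwa [Multiset.eq_of_mem_replicate hw]
  exact ⟨hne.csSup_mem hfin, fun v hv => le_csSup hfin.bddAbove hv⟩

/-! ### Randomized random access machines with logarithmic cost

A program works on natural numbers held in registers and in arrays. Its operations are addition,
truncated subtraction, indirect reading and writing of array cells, and the flip of a fair coin,
under sequencing, branching and while loops. An operation on numbers is charged according to
their bit lengths. -/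

/-- A memory content together with the time that has been spent. -/
structure RamState where
  /-- the registers -/
  reg : ℕ → ℕ
  /-- `arr a i` is cell `i` of array `a` -/
  arr : ℕ → ℕ → ℕ
  /-- the time spent so far -/
  time : ℕ

namespace RamState

/-- Spend `t` units of time. -/
def tick (σ : RamState) (t : ℕ) : RamState :=
  { σ with time := σ.time + t }

/-- Write `v` into register `r`. -/
def setReg (σ : RamState) (r v : ℕ) : RamState :=
  { σ with reg := Function.update σ.reg r v }

/-- Write `v` into cell `i` of array `a`. -/
def setArr (σ : RamState) (a i v : ℕ) : RamState :=
  { σ with arr := Function.update σ.arr a (Function.update (σ.arr a) i v) }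

end RamState

/-- Arithmetic expressions; `read a e` is the cell of array `a` whose index is the value of `e`. -/
inductive RamExpr where
  | const (c : ℕ)
  | reg (r : ℕ)
  | read (a : ℕ) (e : RamExpr)
  | add (e₁ e₂ : RamExpr)
  | sub (e₁ e₂ : RamExpr)

namespace RamExpr

/-- The value of an expression; subtraction is truncated at `0`. -/
def eval (σ : RamState) : RamExpr → ℕ
  | const c => c
  | reg r => σ.reg r
  | read a e => σ.arr a (e.eval σ)
  | add e₁ e₂ => e₁.eval σ + e₂.eval σ
  | sub e₁ e₂ => e₁.eval σ - e₂.eval σ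

/-- The time for evaluating an expression: every subexpression is charged
`1` plus the bit length of its value. -/
def cost (σ : RamState) : RamExpr → ℕ
  | const c => 1 + c.size
  | reg r => 1 + (σ.reg r).size
  | read a e => e.cost σ + (1 + (σ.arr a (e.eval σ)).size)
  | add e₁ e₂ => e₁.cost σ + e₂.cost σ + (1 + (e₁.eval σ + e₂.eval σ).size)
  | sub e₁ e₂ => e₁.cost σ + e₂.cost σ + (1 + (e₁.eval σ - e₂.eval σ).size)

end RamExpr

/-- Randomized programs; `loop e p` is the while loop with test `e` and body `p`.
A test succeeds if the value of its expression is nonzero. -/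
inductive RamProg where
  | skip
  | assign (r : ℕ) (e : RamExpr)
  | store (a : ℕ) (i e : RamExpr)
  | flip (r : ℕ)
  | seq (p q : RamProg)
  | ite (e : RamExpr) (p q : RamProg)
  | loop (e : RamExpr) (p : RamProg)

namespace RamProg

/-- The loop with test `e` and the given body, abandoned with the outcome `none`
if the test has been made `fuel` times and has always succeeded. -/
noncomputable def execLoop (e : RamExpr) (body : RamState → PMF (Option RamState)) :
    ℕ → RamState → PMF (Option RamState)
  | 0, _ => PMF.pure none
  | fuel + 1, σ =>
    if e.eval σ ≠ 0 then
      (body (σ.tick (e.cost σ + 1))).bind fun o =>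
        o.elim (PMF.pure none) (execLoop e body fuel)
    else PMF.pure (some (σ.tick (e.cost σ + 1)))

/-- The distribution of the final state of a program started in a given state, where the outcome
`none` means that some loop of the program has used up `fuel` tests without ending.
All coins are fair and independent. -/
noncomputable def exec (fuel : ℕ) : RamProg → RamState → PMF (Option RamState)
  | skip, σ => PMF.pure (some (σ.tick 1))
  | assign r e, σ => PMF.pure (some ((σ.tick (e.cost σ + 1)).setReg r (e.eval σ)))
  | store a i e, σ =>
    PMF.pure (some ((σ.tick (i.cost σ + e.cost σ + 1)).setArr a (i.eval σ) (e.eval σ)))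
  | flip r, σ =>
    (PMF.uniformOfFintype Bool).map fun b => some ((σ.tick 1).setReg r (if b then 1 else 0))
  | seq p q, σ => (exec fuel p σ).bind fun o => o.elim (PMF.pure none) (exec fuel q)
  | ite e p q, σ =>
    if e.eval σ ≠ 0 then exec fuel p (σ.tick (e.cost σ + 1))
    else exec fuel q (σ.tick (e.cost σ + 1))
  | loop e p, σ => execLoop e (exec fuel p) fuel σ

/-- Started in `σ`, the program halts for all outcomes of the coins (after a bounded number of
loop iterations), and `μ` is the distribution of its final state. -/
def HaltsWith (p : RamProg) (σ : RamState) (μ : PMF RamState) : Prop :=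
  ∃ fuel, p.exec fuel σ = μ.map some

end RamProg

/-! ### Input and output -/

/-- The formula as a list of pairs: a literal on variable `i` is written as `i + 1` together with
its sign, and every clause is followed by the pair `(0, 0)`. -/
def formulaCode {n : ℕ} (F : CNFFormula n) : List (ℕ × ℕ) :=
  F.flatMap fun C => (C.map fun l => ((l.1 : ℕ) + 1, if l.2 then 1 else 0)) ++ [(0, 0)]

/-- The size of a formula: the number of variables plus the number of clauses plus the number of
occurrences of literals, plus one. -/
def formulaSize {n : ℕ} (F : CNFFormula n) : ℕ :=
  n + (formulaCode F).length + 1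

/-- The initial state on input `(F, s)`: registers `0`, `1`, `2` hold `n`, the length of the code
of `F`, and `s`; arrays `0` and `1` hold the code of `F`; all the rest is `0`. -/
def inputState {n : ℕ} (F : CNFFormula n) (s : ℕ) : RamState where
  reg r := if r = 0 then n else if r = 1 then (formulaCode F).length else if r = 2 then s else 0
  arr a i :=
    if a = 0 then ((formulaCode F).getD i (0, 0)).1
    else if a = 1 then ((formulaCode F).getD i (0, 0)).2
    else 0
  time := 0

/-- The output: `s` assignments of `n` bits each, stored one after the other in array `2`. -/
def outputMultiset (n s : ℕ) (σ : RamState) : Multiset (Fin n → Bool) :=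
  (Finset.univ : Finset (Fin s)).val.map fun j i => decide (σ.arr 2 ((j : ℕ) * n + (i : ℕ)) ≠ 0)

/-! The algorithm is a random search for solutions followed by a local search for dispersion. A
round of the random search gives every variable a random tag of `b` bits, where `2 ^ b > n`, and
sets the variables in the order of their tags: a value that falsifies a clause is avoided, and
otherwise a coin decides (the procedure of Paturi, Pudlák and Zane). The solutions found in
`trialCount k n` rounds form a list `W`. Starting from equal centers, the local search replaces
centers by elements of `W` while this increases the dispersion; the output runs cyclically through
the centers.

Hitting probability. Let Ω be the set of solutions, M = 2 ^ b, and deg z the number of cube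
neighbours of z in Ω. If flipping bit i of z leaves Ω, some clause has its only true literals at i,
and i has the strictly largest tag in this clause with probability at least 1/k - 1/M
(`card_forced`); its coin is then irrelevant. By Jensen, z is hit with probability at least 2^(-n +
(n - deg z)/k - 1) (`card_hitSet_ge`), and distinct solutions are hit by disjoint events
(`hit_unique`). Hence a set A ⊆ Ω of weight ∑ 2^(-deg z / k) ≥ 1/2 is hit with probability at least
2^(-n + n/k - 2).

Existence of heavy sets. If the weight of A is below 1/2, Jensen and the edge-isoperimetric
inequality (`sum_edgesTo_self_le`) force more than (k-1)(log₂|A| + 1)|A| edges from A to Ω \ A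
(`cross_lt`). If all sets of solutions close to a given solution y were light, they would double at
every enlargement until a contradiction arises. So there is a heavy set of solutions that differ
from y in at most |P|/k places of a prescribed set P (`exists_nearSet`), and, for any ranking of the
variables, a heavy set of solutions for which k-2 times the number of differences from y in an
initial segment is at most its length (`exists_sparseSet`). A union bound over y, P and the rankings
shows that `W` meets all these sets with probability at least 1 - 2^(-n) (`card_not_rich_le`).

Quality. Fix all centers but one, and compare a solution y of an optimal multiset with the elements
w of `W` by their total distance to the fixed centers. By the sparseness, summed over level sets,
some w loses against y at most a fraction 1/(k-2) of the excess of y over the minimum for arbitrary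
assignments. If at most two centers are fixed, all nonzero losses per variable are equal, and the
fraction 1/k is available (`Rich.exists_far`). Local optimality turns this into a bound for the
distances from y to the centers, and `cross_ge` relates these distances to the two dispersions
(`LocalOpt.dispersion_le`). The fraction 1/(k-2) suffices for k ≥ 4. For k ≤ 3 it gives nothing, and
three centers with the fraction 1/k are used instead.

Running time. A Hoare logic `Tr` counts the operations of programs without coin flips. All coins are
flipped in advance onto a tape, so that the rest of the algorithm is deterministic. -/

/-! ### Deterministic runs of programs -/

namespace RamState

/-- The same memory content with the clock set to `t`. -/
def atTime (σ : RamState) (t : ℕ) : RamState :=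
  { σ with time := t }

@[simp] theorem atTime_reg (σ : RamState) (t : ℕ) : (σ.atTime t).reg = σ.reg := rfl
@[simp] theorem atTime_arr (σ : RamState) (t : ℕ) : (σ.atTime t).arr = σ.arr := rfl
@[simp] theorem setReg_reg (σ : RamState) (r v : ℕ) :
    (σ.setReg r v).reg = Function.update σ.reg r v := rfl
@[simp] theorem setReg_arr (σ : RamState) (r v : ℕ) : (σ.setReg r v).arr = σ.arr := rfl
@[simp] theorem setArr_reg (σ : RamState) (a i v : ℕ) : (σ.setArr a i v).reg = σ.reg := rfl
@[simp] theorem setArr_arr (σ : RamState) (a i v : ℕ) :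
    (σ.setArr a i v).arr = Function.update σ.arr a (Function.update (σ.arr a) i v) := rfl

end RamState

theorem RamExpr.eval_atTime (σ : RamState) (t : ℕ) (e : RamExpr) :
    e.eval (σ.atTime t) = e.eval σ := by
  induction e <;> simp_all [RamExpr.eval]

theorem RamExpr.cost_atTime (σ : RamState) (t : ℕ) (e : RamExpr) :
    e.cost (σ.atTime t) = e.cost σ := by
  induction e <;> simp_all [RamExpr.cost, RamExpr.eval_atTime]

/-- Without flipping coins, the program leads from `σ` to `σ'`. -/
def Runs (p : RamProg) (σ σ' : RamState) : Prop :=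
  ∃ f₀, ∀ f ≥ f₀, p.exec f σ = PMF.pure (some σ')

/-- Without flipping coins, the loop leads from `σ` to `σ'`; the fuel of the loop and of its body
are independent. -/
def LoopRuns (e : RamExpr) (p : RamProg) (σ σ' : RamState) : Prop :=
  ∃ a, ∀ f ≥ a, ∀ g ≥ a, RamProg.execLoop e (p.exec f) g σ = PMF.pure (some σ')

theorem LoopRuns.runs {e : RamExpr} {p : RamProg} {σ σ' : RamState} (h : LoopRuns e p σ σ') :
    Runs (.loop e p) σ σ' := by
  obtain ⟨a, h⟩ := h
  exact ⟨a, fun f hf => by rw [RamProg.exec]; exact h f hf f hf⟩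

theorem LoopRuns.of_eval_eq_zero {e : RamExpr} {p : RamProg} {σ : RamState} (h : e.eval σ = 0) :
    LoopRuns e p σ (σ.tick (e.cost σ + 1)) := by
  refine ⟨1, fun f _ g hg => ?_⟩
  obtain ⟨g, rfl⟩ : ∃ g', g = g' + 1 := ⟨g - 1, by omega⟩
  simp [RamProg.execLoop, h]

/-- The budget of tests drops by one per iteration while the body is always run with the full fuel;
this is why `LoopRuns` decouples the two. -/
theorem LoopRuns.step {e : RamExpr} {p : RamProg} {σ σ₁ σ₂ : RamState} (h : e.eval σ ≠ 0)
    (h₁ : Runs p (σ.tick (e.cost σ + 1)) σ₁) (h₂ : LoopRuns e p σ₁ σ₂) : LoopRuns e p σ σ₂ := by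
  obtain ⟨a, h₁⟩ := h₁
  obtain ⟨b, h₂⟩ := h₂
  refine ⟨max a b + 1, fun f hf g hg => ?_⟩
  obtain ⟨g, rfl⟩ : ∃ g', g = g' + 1 := ⟨g - 1, by omega⟩
  rw [RamProg.execLoop, if_pos h, h₁ f (by omega), PMF.pure_bind]
  exact h₂ f (by omega) g (by omega)

theorem Runs.seq {p q : RamProg} {σ σ₁ σ₂ : RamState} (h₁ : Runs p σ σ₁) (h₂ : Runs q σ₁ σ₂) :
    Runs (.seq p q) σ σ₂ := by
  obtain ⟨a, h₁⟩ := h₁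
  obtain ⟨b, h₂⟩ := h₂
  refine ⟨max a b, fun f hf => ?_⟩
  rw [RamProg.exec, h₁ f (by omega), PMF.pure_bind]
  exact h₂ f (by omega)

theorem Runs.ite_true {e : RamExpr} {p q : RamProg} {σ σ' : RamState} (h : e.eval σ ≠ 0)
    (h₁ : Runs p (σ.tick (e.cost σ + 1)) σ') : Runs (.ite e p q) σ σ' := by
  obtain ⟨a, h₁⟩ := h₁
  exact ⟨a, fun f hf => by rw [RamProg.exec, if_pos h]; exact h₁ f hf⟩

theorem Runs.ite_false {e : RamExpr} {p q : RamProg} {σ σ' : RamState} (h : e.eval σ = 0)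
    (h₁ : Runs q (σ.tick (e.cost σ + 1)) σ') : Runs (.ite e p q) σ σ' := by
  obtain ⟨a, h₁⟩ := h₁
  exact ⟨a, fun f hf => by rw [RamProg.exec, if_neg (by simpa using h)]; exact h₁ f hf⟩

/-! ### Cost of expressions -/

/-- The number of nodes of an expression. -/
def RamExpr.nodes : RamExpr → ℕ
  | const _ => 1
  | reg _ => 1
  | read _ e => e.nodes + 1
  | add e₁ e₂ => e₁.nodes + e₂.nodes + 1
  | sub e₁ e₂ => e₁.nodes + e₂.nodes + 1

/-- All constants of the expression are below `2 ^ E`. -/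
def RamExpr.ConstsLt (E : ℕ) : RamExpr → Prop
  | const c => c < 2 ^ E
  | reg _ => True
  | read _ e => e.ConstsLt E
  | add e₁ e₂ => e₁.ConstsLt E ∧ e₂.ConstsLt E
  | sub e₁ e₂ => e₁.ConstsLt E ∧ e₂.ConstsLt E

/-- All numbers in the memory are below `2 ^ E`. -/
def Bdd (E : ℕ) (σ : RamState) : Prop :=
  (∀ r, σ.reg r < 2 ^ E) ∧ ∀ a i, σ.arr a i < 2 ^ E

/-- Only an addition can lengthen a number, and by one bit at most, so each node accounts for at
most one bit beyond `E`. -/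
theorem Bdd.eval_lt {E : ℕ} {σ : RamState} (h : Bdd E σ) (e : RamExpr) (he : e.ConstsLt E) :
    e.eval σ < 2 ^ (E + e.nodes) := by
  have mono : ∀ {a b : ℕ}, a ≤ b → (2 : ℕ) ^ a ≤ 2 ^ b := fun h => Nat.pow_le_pow_right (by simp) h
  induction e with
  | const c => exact lt_of_lt_of_le he (mono (by omega))
  | reg r => exact lt_of_lt_of_le (h.1 r) (mono (by omega))
  | read a e _ => exact lt_of_lt_of_le (h.2 _ _) (mono (by omega))
  | add a b iha ihb =>
    have h1 := lt_of_lt_of_le (iha he.1)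
      (mono (show _ ≤ E + (a.nodes + b.nodes) by omega))
    have h2 := lt_of_lt_of_le (ihb he.2)
      (mono (show _ ≤ E + (a.nodes + b.nodes) by omega))
    simp only [RamExpr.eval, RamExpr.nodes]
    rw [← add_assoc, pow_succ]
    omega
  | sub a b iha ihb =>
    have h1 := lt_of_lt_of_le (iha he.1)
      (mono (show _ ≤ E + (a.nodes + b.nodes + 1) by omega))
    simp only [RamExpr.eval, RamExpr.nodes]
    omega

/-- The parameter `m` stays fixed in the induction and dominates the node counts of all
subexpressions, so that every node is charged the same amount. -/
theorem Bdd.cost_le {E : ℕ} {σ : RamState} (h : Bdd E σ) (e : RamExpr) (he : e.ConstsLt E) (m : ℕ)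
    (hm : e.nodes ≤ m) : e.cost σ ≤ e.nodes * (1 + E + m) := by
  induction e with
  | const c =>
    have := Nat.size_le.2 (h.eval_lt _ he)
    simp only [RamExpr.eval, RamExpr.nodes, RamExpr.cost] at *
    omega
  | reg r =>
    have := Nat.size_le.2 (h.eval_lt _ he)
    simp only [RamExpr.eval, RamExpr.nodes, RamExpr.cost] at *
    omega
  | read a e ih =>
    have := Nat.size_le.2 (h.eval_lt _ he)
    simp only [RamExpr.eval, RamExpr.nodes, RamExpr.cost] at *
    have := ih he (by omega)
    rw [add_one_mul]
    omega
  | add a b iha ihb =>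
    have := Nat.size_le.2 (h.eval_lt _ he)
    simp only [RamExpr.eval, RamExpr.nodes, RamExpr.cost] at *
    have := iha he.1 (by omega)
    have := ihb he.2 (by omega)
    rw [add_one_mul, add_mul]
    omega
  | sub a b iha ihb =>
    have := Nat.size_le.2 (h.eval_lt _ he)
    simp only [RamExpr.eval, RamExpr.nodes, RamExpr.cost] at *
    have := iha he.1 (by omega)
    have := ihb he.2 (by omega)
    rw [add_one_mul, add_mul]
    omega

/-- A bound for the time of one operation on numbers below `2 ^ E`. -/
def opCost (E : ℕ) : ℕ := 40 * (E + 20)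

/-- The side condition on expressions: they are short and have small constants. -/
def RamExpr.Small (E : ℕ) (e : RamExpr) : Prop := e.nodes ≤ 12 ∧ e.ConstsLt E

/-- The largest constant of an expression. -/
def RamExpr.maxConst : RamExpr → ℕ
  | const c => c
  | reg _ => 0
  | read _ e => e.maxConst
  | add e₁ e₂ => max e₁.maxConst e₂.maxConst
  | sub e₁ e₂ => max e₁.maxConst e₂.maxConst

theorem RamExpr.constsLt_of_maxConst {E : ℕ} {e : RamExpr} (h : e.maxConst < 2 ^ E) :
    e.ConstsLt E := by
  induction e with
  | const c => exact h
  | reg r => trivial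
  | read a e ih => exact ih h
  | add a b iha ihb =>
    exact ⟨iha (lt_of_le_of_lt (le_max_left _ _) h), ihb (lt_of_le_of_lt (le_max_right _ _) h)⟩
  | sub a b iha ihb =>
    exact ⟨iha (lt_of_le_of_lt (le_max_left _ _) h), ihb (lt_of_le_of_lt (le_max_right _ _) h)⟩

theorem RamExpr.small {E : ℕ} {e : RamExpr} (hE : 2 ≤ E) (h : e.nodes ≤ 12 ∧ e.maxConst < 4) :
    e.Small E :=
  ⟨h.1, constsLt_of_maxConst (lt_of_lt_of_le h.2 (Nat.pow_le_pow_right (n := 2) (by simp) hE))⟩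

/-- `opCost E` exceeds twice this bound, which leaves room for a store with its two expressions. -/
theorem Bdd.cost_le' {E : ℕ} {σ : RamState} (h : Bdd E σ) {e : RamExpr} (he : e.Small E) :
    e.cost σ ≤ 12 * (E + 13) := by
  refine (h.cost_le e he.2 12 he.1).trans ?_
  have := Nat.mul_le_mul_right (1 + E + 12) he.1
  omega

/-! ### A Hoare logic with operation counts -/

/-- Started in the memory content `σ`, the program reaches, within time `opCost E * N` and never
storing a number of more than `E` bits, a memory content satisfying `Q`. -/
def Tr (E : ℕ) (p : RamProg) (N : ℕ) (σ : RamState) (Q : RamState → Prop) : Prop :=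
  Bdd E σ → ∃ σ' c, Bdd E σ' ∧ Q σ' ∧ c ≤ opCost E * N ∧
    ∀ t, Runs p (σ.atTime t) (σ'.atTime (t + c))

theorem Tr.mono {E N N' : ℕ} {p : RamProg} {σ : RamState} {Q Q' : RamState → Prop}
    (h : Tr E p N σ Q) (hN : N ≤ N') (hQ : ∀ σ', Q σ' → Q' σ') : Tr E p N' σ Q' := by
  intro hb
  obtain ⟨σ', c, h1, h2, h3, h4⟩ := h hb
  exact ⟨σ', c, h1, hQ _ h2, h3.trans (Nat.mul_le_mul_left _ hN), h4⟩

theorem Tr.bdd {E N : ℕ} {p : RamProg} {σ : RamState} {Q : RamState → Prop}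
    (h : Bdd E σ → Tr E p N σ Q) : Tr E p N σ Q := fun hb => h hb hb

theorem tr_skip {E : ℕ} {σ : RamState} {Q : RamState → Prop} (h : Q σ) :
    Tr E .skip 1 σ Q := by
  intro hb
  refine ⟨σ, 1, hb, h, by unfold opCost; omega, fun t => ⟨0, fun f _ => ?_⟩⟩
  simp [RamProg.exec, RamState.tick, RamState.atTime]

theorem Bdd.setReg {E : ℕ} {σ : RamState} (h : Bdd E σ) (r : ℕ) {v : ℕ} (hv : v < 2 ^ E) :
    Bdd E (σ.setReg r v) := by
  refine ⟨fun r' => ?_, h.2⟩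
  by_cases hr : r' = r
  · subst hr; simpa using hv
  · simpa [hr] using h.1 r'

theorem Bdd.setArr {E : ℕ} {σ : RamState} (h : Bdd E σ) (a i : ℕ) {v : ℕ} (hv : v < 2 ^ E) :
    Bdd E (σ.setArr a i v) := by
  refine ⟨h.1, fun a' i' => ?_⟩
  by_cases ha : a' = a
  · subst ha
    by_cases hi : i' = i
    · subst hi; simpa using hv
    · simpa [hi] using h.2 a' i'
  · simpa [ha] using h.2 a' i'

theorem tr_assign {E r : ℕ} {e : RamExpr} {σ : RamState} {Q : RamState → Prop} (he : e.Small E)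
    (hv : e.eval σ < 2 ^ E) (h : Q (σ.setReg r (e.eval σ))) : Tr E (.assign r e) 1 σ Q := by
  intro hb
  refine ⟨_, e.cost σ + 1, hb.setReg r hv, h, ?_, fun t => ⟨0, fun f _ => ?_⟩⟩
  · have := hb.cost_le' he
    unfold opCost; omega
  · rw [RamProg.exec, RamExpr.cost_atTime, RamExpr.eval_atTime]
    rfl

theorem tr_store {E a : ℕ} {i e : RamExpr} {σ : RamState} {Q : RamState → Prop} (hi : i.Small E)
    (he : e.Small E) (hv : e.eval σ < 2 ^ E) (h : Q (σ.setArr a (i.eval σ) (e.eval σ))) :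
    Tr E (.store a i e) 1 σ Q := by
  intro hb
  refine ⟨_, i.cost σ + e.cost σ + 1, hb.setArr a _ hv, h, ?_, fun t => ⟨0, fun f _ => ?_⟩⟩
  · have := hb.cost_le' he
    have := hb.cost_le' hi
    unfold opCost; omega
  · rw [RamProg.exec, RamExpr.cost_atTime, RamExpr.eval_atTime, RamExpr.cost_atTime,
      RamExpr.eval_atTime]
    rfl

/-- The postcondition of `p` is itself a triple for `q`, so chained programs need no intermediate
assertion and facts about earlier states stay in the context. -/
theorem tr_seq {E N₁ N₂ : ℕ} {p q : RamProg} {σ : RamState} {Q : RamState → Prop}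
    (h : Tr E p N₁ σ fun σ₁ => Tr E q N₂ σ₁ Q) : Tr E (.seq p q) (N₁ + N₂) σ Q := by
  intro hb
  obtain ⟨σ₁, c₁, hb₁, h₁, hc₁, hr₁⟩ := h hb
  obtain ⟨σ₂, c₂, hb₂, h₂, hc₂, hr₂⟩ := h₁ hb₁
  refine ⟨σ₂, c₁ + c₂, hb₂, h₂, by rw [mul_add]; omega, fun t => (hr₁ t).seq ?_⟩
  rw [← add_assoc]
  exact hr₂ _

theorem tr_ite {E N : ℕ} {e : RamExpr} {p q : RamProg} {σ : RamState}
    {Q : RamState → Prop} (he : e.Small E) (h₁ : e.eval σ ≠ 0 → Tr E p N σ Q)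
    (h₂ : e.eval σ = 0 → Tr E q N σ Q) : Tr E (.ite e p q) (N + 1) σ Q := by
  intro hb
  have hc : e.cost σ + 1 ≤ opCost E := by
    have := hb.cost_le' he
    unfold opCost; omega
  by_cases h : e.eval σ = 0
  · obtain ⟨σ₁, c₁, hb₁, hq, hc₁, hr₁⟩ := h₂ h hb
    refine ⟨σ₁, (e.cost σ + 1) + c₁, hb₁, hq, by rw [mul_add]; omega, fun t =>
      Runs.ite_false (by rwa [RamExpr.eval_atTime]) ?_⟩
    rw [← add_assoc, RamExpr.cost_atTime]
    exact hr₁ _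
  · obtain ⟨σ₁, c₁, hb₁, hq, hc₁, hr₁⟩ := h₁ h hb
    refine ⟨σ₁, (e.cost σ + 1) + c₁, hb₁, hq, by rw [mul_add]; omega, fun t =>
      Runs.ite_true (by rwa [RamExpr.eval_atTime]) ?_⟩
    rw [← add_assoc, RamExpr.cost_atTime]
    exact hr₁ _

/-! ### Frame conditions -/

/-- The registers that a program may change. -/
def RamProg.regs : RamProg → List ℕ
  | skip => []
  | assign r _ => [r]
  | store _ _ _ => []
  | flip r => [r]
  | seq p q => p.regs ++ q.regs
  | ite _ p q => p.regs ++ q.regs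
  | loop _ p => p.regs

/-- The arrays that a program may change. -/
def RamProg.arrs : RamProg → List ℕ
  | skip => []
  | assign _ _ => []
  | store a _ _ => [a]
  | flip _ => []
  | seq p q => p.arrs ++ q.arrs
  | ite _ p q => p.arrs ++ q.arrs
  | loop _ p => p.arrs

/-- The two states agree on everything that the program does not change. -/
def Frame (p : RamProg) (σ σ' : RamState) : Prop :=
  (∀ r, r ∉ p.regs → σ'.reg r = σ.reg r) ∧ ∀ a, a ∉ p.arrs → σ'.arr a = σ.arr a

theorem Frame.refl (p : RamProg) (σ : RamState) : Frame p σ σ := ⟨fun _ _ => rfl, fun _ _ => rfl⟩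

theorem Frame.trans {p : RamProg} {σ₁ σ₂ σ₃ : RamState} (h₁ : Frame p σ₁ σ₂)
    (h₂ : Frame p σ₂ σ₃) : Frame p σ₁ σ₃ :=
  ⟨fun r hr => (h₂.1 r hr).trans (h₁.1 r hr), fun a ha => (h₂.2 a ha).trans (h₁.2 a ha)⟩

theorem Frame.of_subset {p q : RamProg} {σ₁ σ₂ : RamState} (h : Frame p σ₁ σ₂)
    (hr : p.regs ⊆ q.regs) (ha : p.arrs ⊆ q.arrs) : Frame q σ₁ σ₂ :=
  ⟨fun r h' => h.1 r fun h'' => h' (hr h''), fun a h' => h.2 a fun h'' => h' (ha h'')⟩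

theorem frame_exec (p : RamProg) (f : ℕ) (σ : RamState) :
    ∀ o ∈ (p.exec f σ).support, ∀ σ', o = some σ' → Frame p σ σ' := by
  induction p generalizing σ with
  | skip => rintro o ho σ' rfl; simp [RamProg.exec] at ho; subst ho; exact Frame.refl _ _
  | assign r e =>
    rintro o ho σ' rfl; simp [RamProg.exec] at ho; subst ho
    refine ⟨fun r' hr' => ?_, fun _ _ => rfl⟩
    simp [RamProg.regs] at hr'
    simp [hr', RamState.tick]
  | store a i e =>
    rintro o ho σ' rfl; simp [RamProg.exec] at ho; subst ho
    refine ⟨fun _ _ => rfl, fun r' hr' => ?_⟩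
    simp [RamProg.arrs] at hr'
    simp [hr', RamState.tick]
  | flip r =>
    rintro o ho σ' rfl
    simp only [RamProg.exec, PMF.mem_support_map_iff] at ho
    obtain ⟨b, -, hb⟩ := ho
    simp only [Option.some.injEq] at hb
    subst hb
    refine ⟨fun r' hr' => ?_, fun _ _ => rfl⟩
    simp [RamProg.regs] at hr'
    simp [hr', RamState.tick]
  | seq p q ihp ihq =>
    rintro o ho σ' rfl
    simp only [RamProg.exec, PMF.mem_support_bind_iff] at ho
    obtain ⟨o₁, ho₁, ho⟩ := ho
    cases o₁ with
    | none => simp at ho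
    | some σ₁ =>
      exact ((ihp σ _ ho₁ σ₁ rfl).of_subset (by simp [RamProg.regs]) (by simp [RamProg.arrs])).trans
        ((ihq σ₁ _ ho σ' rfl).of_subset (by simp [RamProg.regs]) (by simp [RamProg.arrs]))
  | ite e p q ihp ihq =>
    rintro o ho σ' rfl
    rw [RamProg.exec] at ho
    split_ifs at ho
    · exact (ihp _ _ ho σ' rfl).of_subset (by simp [RamProg.regs]) (by simp [RamProg.arrs])
    · exact (ihq _ _ ho σ' rfl).of_subset (by simp [RamProg.regs]) (by simp [RamProg.arrs])
  | loop e p ih =>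
    rintro o ho σ' rfl
    rw [RamProg.exec] at ho
    suffices H : ∀ g σ, some σ' ∈ (RamProg.execLoop e (p.exec f) g σ).support →
      Frame (.loop e p) σ σ' from H f σ ho
    intro g
    induction g with
    | zero => intro σ h; simp [RamProg.execLoop] at h
    | succ g ihg =>
      intro σ h
      rw [RamProg.execLoop] at h
      split_ifs at h
      · simp only [PMF.mem_support_bind_iff] at h
        obtain ⟨o₁, ho₁, ho⟩ := h
        cases o₁ with
        | none => simp at ho
        | some σ₁ => exact Frame.trans (ih _ _ ho₁ σ₁ rfl) (ihg _ ho)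
      · simp at h; subst h; exact Frame.refl _ _

/-- By `frame_exec` every possible outcome respects the frame, and the distribution of a run without
coins is concentrated on its final state. -/
theorem Tr.frame {E N : ℕ} {p : RamProg} {σ : RamState} {Q : RamState → Prop}
    (h : Tr E p N σ Q) : Tr E p N σ fun σ' => Frame p σ σ' ∧ Q σ' := by
  intro hb
  obtain ⟨σ', c, h1, h2, h3, h4⟩ := h hb
  refine ⟨σ', c, h1, ⟨?_, h2⟩, h3, h4⟩
  obtain ⟨f₀, hf⟩ := h4 0
  have := frame_exec p f₀ (σ.atTime 0) (some (σ'.atTime (0 + c))) (by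
    rw [hf f₀ le_rfl]; simp) _ rfl
  exact ⟨this.1, this.2⟩

/-! ### Counting loops -/

/-- `for i < e do p`; the body must not change the loop variable or the value of `e`. -/
def forLoop (i : ℕ) (e : RamExpr) (p : RamProg) : RamProg :=
  .seq (.assign i (.const 0))
    (.loop (.sub e (.reg i)) (.seq p (.assign i (.add (.reg i) (.const 1)))))

/-- An iteration pays for a test, the body and the increment, whence `B + 2`; the initialization and
the last, failing test give the final `2`. The induction is on the number `d` of remaining
iterations. -/
theorem tr_for {E B N : ℕ} {i : ℕ} {e : RamExpr} {p : RamProg} {σ : RamState}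
    {Q : RamState → Prop} (I : ℕ → RamState → Prop) (he : e.nodes ≤ 10) (he' : e.ConstsLt E)
    (hN : N < 2 ^ E)
    (hi : i ∉ p.regs)
    (hev : ∀ σ', Frame (forLoop i e p) σ σ' → e.eval σ' = N)
    (h0 : I 0 (σ.setReg i 0))
    (hstep : ∀ t σ', t < N → Frame (forLoop i e p) σ σ' → Bdd E σ' → σ'.reg i = t → I t σ' →
      Tr E p B σ' fun σ'' => I (t + 1) (σ''.setReg i (t + 1)))
    (hQ : ∀ σ', Frame (forLoop i e p) σ σ' → Bdd E σ' → I N σ' → Q σ') :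
    Tr E (forLoop i e p) (N * (B + 2) + 2) σ Q := by
  intro hb
  have hE : 0 < 2 ^ E := by positivity
  have hframe0 : Frame (forLoop i e p) σ (σ.setReg i 0) := by
    refine ⟨fun r hr => ?_, fun _ _ => rfl⟩
    have : r ≠ i := by rintro rfl; simp [forLoop, RamProg.regs] at hr
    simp [this]
  have hcond : (RamExpr.sub e (.reg i)).Small E :=
    ⟨by simp only [RamExpr.nodes]; omega, by simpa [RamExpr.ConstsLt] using he'⟩
  have key : ∀ d t σ', t + d = N → Frame (forLoop i e p) σ σ' → Bdd E σ' → σ'.reg i = t →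
      I t σ' → ∃ σ'' c, Bdd E σ'' ∧ Q σ'' ∧ c ≤ opCost E * (d * (B + 2) + 1) ∧
        ∀ s, LoopRuns (.sub e (.reg i)) (.seq p (.assign i (.add (.reg i) (.const 1))))
          (σ'.atTime s) (σ''.atTime (s + c)) := by
    intro d
    induction d with
    | zero =>
      intro t σ' ht hf hb' hr hI
      have htN : t = N := by omega
      subst htN
      refine ⟨σ', (RamExpr.sub e (.reg i)).cost σ' + 1, hb', hQ _ hf hb' hI, ?_, fun s => ?_⟩
      · have := hb'.cost_le' hcond
        unfold opCost; omega
      · have := LoopRuns.of_eval_eq_zero (p := .seq p (.assign i (.add (.reg i) (.const 1))))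
          (e := .sub e (.reg i)) (σ := σ'.atTime s)
          (by rw [RamExpr.eval_atTime]; simp [RamExpr.eval, hev _ hf, hr])
        rw [RamExpr.cost_atTime] at this
        exact this
    | succ d ih =>
      intro t σ' ht hf hb' hr hI
      have hstep' := tr_seq (q := .assign i (.add (.reg i) (.const 1))) (N₂ := 1)
        (Q := fun σ'' => Frame (forLoop i e p) σ σ'' ∧ σ''.reg i = t + 1 ∧ I (t + 1) σ'')
        ((hstep t σ' (by omega) hf hb' hr hI).frame.mono le_rfl (by
          rintro σ₁ ⟨hf₁, hI₁⟩
          have hr₁ : σ₁.reg i = t := (hf₁.1 i hi).trans hr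
          refine tr_assign ⟨by simp [RamExpr.nodes], ?_⟩ ?_ ?_
          · simp only [RamExpr.ConstsLt, true_and]
            omega
          · simp only [RamExpr.eval, hr₁]; omega
          · simp only [RamExpr.eval, hr₁]
            refine ⟨⟨fun r hr' => ?_, fun a ha => ?_⟩, by simp, hI₁⟩
            · have hri : r ≠ i := by rintro rfl; simp [forLoop, RamProg.regs] at hr'
              have hrp : r ∉ p.regs := fun h => hr' (by simp [forLoop, RamProg.regs, h])
              simp [hri, hf₁.1 r hrp, hf.1 r hr']
            · have hap : a ∉ p.arrs := fun h => ha (by simp [forLoop, RamProg.arrs, h])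
              simp [hf₁.2 a hap, hf.2 a ha]))
      obtain ⟨σ₁, c₁, hb₁, ⟨hf₁, hr₁, hI₁⟩, hc₁, hrun₁⟩ := hstep' hb'
      obtain ⟨σ₂, c₂, hb₂, hQ₂, hc₂, hrun₂⟩ := ih (t + 1) σ₁ (by omega) hf₁ hb₁ hr₁ hI₁
      refine ⟨σ₂, (RamExpr.sub e (.reg i)).cost σ' + 1 + c₁ + c₂, hb₂, hQ₂, ?_, fun s => ?_⟩
      · have h1 : (RamExpr.sub e (.reg i)).cost σ' + 1 ≤ opCost E := by
          have := hb'.cost_le' hcond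
          unfold opCost; omega
        calc _ ≤ opCost E + opCost E * (B + 1) + opCost E * (d * (B + 2) + 1) := by omega
          _ = _ := by ring
      · refine LoopRuns.step (σ₁ := σ₁.atTime (s + ((RamExpr.sub e (.reg i)).cost σ' + 1) + c₁)) ?_
          ?_ ?_
        · rw [RamExpr.eval_atTime]; simp only [RamExpr.eval, hev _ hf, hr]; omega
        · rw [RamExpr.cost_atTime]; exact hrun₁ _
        · have := hrun₂ (s + ((RamExpr.sub e (.reg i)).cost σ' + 1) + c₁)
          convert this using 2
          ring
  obtain ⟨σ', c, h1, h2, h3, h4⟩ := key N 0 (σ.setReg i 0) (by simp) hframe0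
    (hb.setReg i hE) (by simp) h0
  refine ⟨σ', (RamExpr.const 0).cost σ + 1 + c, h1, h2, ?_, fun t => ?_⟩
  · have : (RamExpr.const 0).cost σ + 1 ≤ opCost E := by
      simp [RamExpr.cost, opCost]; omega
    calc _ ≤ opCost E + opCost E * (N * (B + 2) + 1) := by omega
      _ = _ := by ring
  · refine Runs.seq (σ₁ := (σ.setReg i 0).atTime (t + ((RamExpr.const 0).cost σ + 1)))
      ⟨0, fun f _ => ?_⟩ ?_
    · rw [RamProg.exec]; rfl
    · have := (h4 (t + ((RamExpr.const 0).cost σ + 1))).runs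
      rwa [add_assoc] at this

/-! ### Arithmetic subroutines -/

/-- Register `d` becomes the product of registers `a` and `b`; register `20` is used up. -/
def mulProg (d a b : ℕ) : RamProg :=
  .seq (.assign d (.const 0)) (forLoop 20 (.reg b) (.assign d (.add (.reg d) (.reg a))))

theorem mulProg_regs (d a b : ℕ) : (mulProg d a b).regs = [d, 20, d, 20] := rfl

/-- Repeated addition costs time linear in the value of the second factor only. In `paramsProg` the
exponentially large numbers are therefore always first factors. -/
theorem tr_mul {E d a b A B : ℕ} {σ : RamState} {Q : RamState → Prop} (hda : a ≠ d) (hdb : b ≠ d)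
    (hd : d ≠ 20) (ha : a ≠ 20) (hb : b ≠ 20) (hA : σ.reg a = A) (hB : σ.reg b = B)
    (hAB : A * B < 2 ^ E) (h : ∀ σ', Frame (mulProg d a b) σ σ' → σ'.reg d = A * B → Q σ') :
    Tr E (mulProg d a b) (B * 3 + 3) σ Q := by
  refine Tr.bdd fun hbd => ?_
  have hBE : B < 2 ^ E := hB ▸ hbd.1 b
  have hE : 0 < 2 ^ E := by positivity
  suffices H : Tr E (mulProg d a b) (1 + (B * (1 + 2) + 2)) σ fun σ' => σ'.reg d = A * B from
    H.frame.mono (by omega) fun σ' h' => h σ' h'.1 h'.2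
  refine tr_seq (tr_assign ⟨by simp [RamExpr.nodes], hE⟩ hE ?_)
  simp only [RamExpr.eval]
  refine tr_for (fun t σ' => σ'.reg d = A * t) (by simp [RamExpr.nodes]) trivial hBE
    (by simp [RamProg.regs, hd.symm]) ?_ ?_ ?_ ?_
  · intro σ' hf
    have := hf.1 b (by simp [forLoop, RamProg.regs, hdb, hb])
    simp [RamExpr.eval, this, hdb, hB]
  · simp [hd]
  · intro t σ' ht hf hbd' hr hI
    have hreg := hf.1 a (by simp [forLoop, RamProg.regs, hda, ha])
    simp only [RamState.setReg_reg, ne_eq, hda, not_false_eq_true, Function.update_of_ne, hA] at hreg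
    refine tr_assign ⟨by simp [RamExpr.nodes], by simp [RamExpr.ConstsLt]⟩ ?_ ?_
    · simp only [RamExpr.eval, hI, hreg]
      have : A * (t + 1) ≤ A * B := Nat.mul_le_mul_left _ ht
      rw [mul_add_one] at this
      omega
    · simp [RamExpr.eval, hI, hreg, hd, mul_add_one]
  · intro σ' _ _ hI; exact hI

/-- Registers `3` and `4` become `2 ^ b` and `b`, where `2 ^ b` is the least power of two above
register `0`. -/
def logProg : RamProg :=
  .seq (.assign 3 (.const 1)) (.seq (.assign 4 (.const 0)) (forLoop 20 (.reg 0)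
    (.ite (.sub (.add (.reg 0) (.const 1)) (.reg 3))
      (.seq (.assign 3 (.add (.reg 3) (.reg 3))) (.assign 4 (.add (.reg 4) (.const 1)))) .skip)))

theorem tr_log {E n : ℕ} {σ : RamState} {Q : RamState → Prop} (hn : σ.reg 0 = n)
    (hE : 2 * n + 2 < 2 ^ E) (h : ∀ σ' b, Frame logProg σ σ' → σ'.reg 3 = 2 ^ b → σ'.reg 4 = b →
      n < 2 ^ b → 2 ^ b ≤ 2 * n + 1 → b ≤ n → Q σ') :
    Tr E logProg (n * 5 + 4) σ Q := by
  suffices H : Tr E logProg (1 + (1 + (n * ((1 + 1) + 1 + 2) + 2))) σ fun σ' => ∃ b,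
      σ'.reg 3 = 2 ^ b ∧ σ'.reg 4 = b ∧ n < 2 ^ b ∧ 2 ^ b ≤ 2 * n + 1 ∧ b ≤ n from
    H.frame.mono (by omega) fun σ' h' => by
      obtain ⟨hf, b, h1, h2, h3, h4, h5⟩ := h'
      exact h σ' b hf h1 h2 h3 h4 h5
  have hE1 : 1 < 2 ^ E := by omega
  refine tr_seq (tr_assign ⟨by simp [RamExpr.nodes], ?_⟩ ?_ ?_)
  · simp only [RamExpr.ConstsLt]; omega
  · simp only [RamExpr.eval]; omega
  refine tr_seq (tr_assign ⟨by simp [RamExpr.nodes], ?_⟩ ?_ ?_)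
  · simp only [RamExpr.ConstsLt]; omega
  · simp only [RamExpr.eval]; omega
  simp only [RamExpr.eval]
  -- The alternative `b = t` means that the doubling has not stopped yet; at `t = n` it still gives
  -- `n < 2 ^ n`.
  refine tr_for (fun t σ' => ∃ b, σ'.reg 3 = 2 ^ b ∧ σ'.reg 4 = b ∧ b ≤ t ∧ 2 ^ b ≤ 2 * n + 1 ∧
    (n < 2 ^ b ∨ b = t)) (by simp [RamExpr.nodes]) trivial (by omega : n < 2 ^ E)
    (by simp [RamProg.regs]) ?_ ?_ ?_ ?_
  · intro σ' hf
    have := hf.1 0 (by simp [forLoop, RamProg.regs])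
    simpa [RamExpr.eval, hn] using this
  · exact ⟨0, by simp⟩
  · rintro t σ' ht hf hbd' hr ⟨b, h3, h4, h5, h6, h7⟩
    have hn' := hf.1 0 (by simp [forLoop, RamProg.regs])
    simp only [RamState.setReg_reg, ne_eq, OfNat.zero_ne_ofNat,
      not_false_eq_true, Function.update_of_ne, hn] at hn'
    refine tr_ite ⟨by simp [RamExpr.nodes], ?_⟩ (fun hc => ?_) (fun hc => ?_)
    · simpa [RamExpr.ConstsLt] using hE1
    · simp only [RamExpr.eval, hn', h3] at hc
      refine tr_seq (tr_assign ⟨by simp [RamExpr.nodes], by simp [RamExpr.ConstsLt]⟩ ?_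
        (tr_assign ⟨by simp [RamExpr.nodes], ?_⟩ ?_ ?_))
      · simp only [RamExpr.eval, h3]; omega
      · simpa [RamExpr.ConstsLt] using hE1
      · have : b < 2 ^ b := Nat.lt_two_pow_self
        simp [RamExpr.eval, h4]; omega
      · refine ⟨b + 1, by simp [RamExpr.eval, h3, pow_succ]; omega, by simp [RamExpr.eval, h4],
          by omega, by rw [pow_succ]; omega, ?_⟩
        rcases h7 with h7 | h7
        · omega
        · right; omega
    · simp only [RamExpr.eval, hn', h3] at hc
      exact (tr_skip (E := E) (σ := σ') (Q := fun σ'' => ∃ b, (σ''.setReg 20 (t + 1)).reg 3 = 2 ^ b ∧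
        (σ''.setReg 20 (t + 1)).reg 4 = b ∧ b ≤ t + 1 ∧ 2 ^ b ≤ 2 * n + 1 ∧
        (n < 2 ^ b ∨ b = t + 1)) ⟨b, by simp [h3], by simp [h4], by omega, h6, by omega⟩).mono
        (by omega) fun _ h => h
  · rintro σ' - - ⟨b, h3, h4, h5, h6, h7⟩
    refine ⟨b, h3, h4, ?_, h6, h5⟩
    rcases h7 with h7 | rfl
    · exact h7
    · exact Nat.lt_two_pow_self

/-- Register `5` becomes `2 ^ (n - n / k)`, where `n` is the content of register `0`. -/
def powProg (k : ℕ) : RamProg :=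
  .seq (.assign 5 (.const 1)) (.seq (.assign 21 (.const 0)) (forLoop 20 (.reg 0)
    (.seq (.assign 21 (.add (.reg 21) (.const 1)))
      (.ite (.sub (.const k) (.reg 21)) (.assign 5 (.add (.reg 5) (.reg 5)))
        (.assign 21 (.const 0))))))

theorem div_mod_succ {k : ℕ} (hk : 0 < k) (t : ℕ) :
    ((t % k + 1 < k → (t + 1) % k = t % k + 1 ∧ (t + 1) / k = t / k) ∧
      (¬ t % k + 1 < k → (t + 1) % k = 0 ∧ (t + 1) / k = t / k + 1)) := by
  have h1 := Nat.div_add_mod t k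
  have h2 := Nat.mod_lt t hk
  refine ⟨fun h => ?_, fun h => ?_⟩
  · have := (Nat.div_mod_unique (a := t + 1) (b := k) (c := t % k + 1) (d := t / k) hk).2
      ⟨by omega, h⟩
    exact ⟨this.2, this.1⟩
  · have := (Nat.div_mod_unique (a := t + 1) (b := k) (c := 0) (d := t / k + 1) hk).2
      ⟨by rw [mul_add_one]; omega, hk⟩
    exact ⟨this.2, this.1⟩

/-- The exponent `t - t / k` grows by one with `t` except when `k` divides the new `t`. Register 21
holds `t % k`, so no division is needed. -/
theorem tr_pow {E n k : ℕ} {σ : RamState} {Q : RamState → Prop} (hk : 0 < k) (hn : σ.reg 0 = n)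
    (hE : 2 ^ n < 2 ^ E) (hkE : k < 2 ^ E)
    (h : ∀ σ', Frame (powProg k) σ σ' → σ'.reg 5 = 2 ^ (n - n / k) → Q σ') :
    Tr E (powProg k) (n * 5 + 4) σ Q := by
  suffices H : Tr E (powProg k) (1 + (1 + (n * (1 + (1 + 1) + 2) + 2))) σ
      fun σ' => σ'.reg 5 = 2 ^ (n - n / k) from
    H.frame.mono (by omega) fun σ' h' => h σ' h'.1 h'.2
  have h1E : 1 < 2 ^ E := lt_of_le_of_lt Nat.one_le_two_pow hE
  have hnE : n < 2 ^ E := lt_trans Nat.lt_two_pow_self hE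
  refine tr_seq (tr_assign ⟨by simp [RamExpr.nodes], h1E⟩ h1E ?_)
  refine tr_seq (tr_assign ⟨by simp [RamExpr.nodes], ?_⟩ ?_ ?_)
  · simp only [RamExpr.ConstsLt]; omega
  · simp only [RamExpr.eval]; omega
  simp only [RamExpr.eval]
  refine tr_for (fun t σ' => σ'.reg 5 = 2 ^ (t - t / k) ∧ σ'.reg 21 = t % k)
    (by simp [RamExpr.nodes]) trivial hnE (by simp [RamProg.regs]) ?_ ?_ ?_ ?_
  · intro σ' hf
    have := hf.1 0 (by simp [forLoop, RamProg.regs])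
    simpa [RamExpr.eval, hn] using this
  · simp
  · rintro t σ' ht hf hbd' hr ⟨h5, h21⟩
    have hd := div_mod_succ hk t
    have hle := Nat.div_le_self t k
    have hm := Nat.mod_lt t hk
    have hpow : 2 ^ (t - t / k + 1) ≤ 2 ^ n := Nat.pow_le_pow_right (by simp)
      ((Nat.succ_le_succ (Nat.sub_le t (t / k))).trans ht)
    refine tr_seq (tr_assign ⟨by simp [RamExpr.nodes], by simpa [RamExpr.ConstsLt] using h1E⟩ ?_ ?_)
    · simp only [RamExpr.eval, h21]; omega
    simp only [RamExpr.eval, h21]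
    refine tr_ite ⟨by simp [RamExpr.nodes], by simpa [RamExpr.ConstsLt] using hkE⟩ (fun hc => ?_)
      (fun hc => ?_)
    · simp only [RamExpr.eval, RamState.setReg_reg, Function.update_self] at hc
      obtain ⟨hd1, hd2⟩ := hd.1 (by omega)
      refine tr_assign ⟨by simp [RamExpr.nodes], by simp [RamExpr.ConstsLt]⟩ ?_ ?_
      · rw [pow_succ] at hpow
        simp [RamExpr.eval, h5]; omega
      · have : t + 1 - t / k = t - t / k + 1 := by omega
        simp [RamExpr.eval, h5, hd1, hd2, this, pow_succ]; omega
    · simp only [RamExpr.eval, RamState.setReg_reg, Function.update_self] at hc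
      obtain ⟨hd1, hd2⟩ := hd.2 (by omega)
      refine tr_assign ⟨by simp [RamExpr.nodes], by simp [RamExpr.ConstsLt]⟩ ?_ ?_
      · simp [RamExpr.eval]
      · simp [RamExpr.eval, h5, hd1, hd2]
  · rintro σ' - - ⟨h5, -⟩; exact h5

/-! ### The parameters of the algorithm -/

/-- The number of rounds of the random search. -/
def trialCount (k n : ℕ) : ℕ := 2 ^ (n - n / k) * (n + 1) * (n + 1) * 2 ^ (k + 3)

/-- The number of centers maintained by the local search. -/
def centers (k s : ℕ) : ℕ := if k ≤ 3 then min s 3 else s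

/-- An expression for the number of centers. -/
def centerExpr (k : ℕ) : RamExpr :=
  if k ≤ 3 then .sub (.const 3) (.sub (.const 3) (.reg 2)) else .reg 2

theorem centerExpr_eval (k : ℕ) (σ : RamState) : (centerExpr k).eval σ = centers k (σ.reg 2) := by
  unfold centerExpr centers
  split_ifs <;> simp [RamExpr.eval]
  omega

theorem centerExpr_small {E : ℕ} (hE : 2 ≤ E) (k : ℕ) : (centerExpr k).Small E := by
  unfold centerExpr
  split_ifs
  · exact RamExpr.small hE (by decide)
  · exact RamExpr.small hE (by decide)

theorem centers_le (k s : ℕ) : centers k s ≤ s := by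
  unfold centers
  split_ifs
  · exact min_le_left _ _
  · exact le_rfl

theorem centers_pos (k : ℕ) {s : ℕ} (hs : 1 ≤ s) : 1 ≤ centers k s := by
  unfold centers
  split_ifs <;> omega

theorem powProg_regs (k : ℕ) : (powProg k).regs = [5, 21, 20, 21, 5, 21, 20] := rfl

/-- The preparatory computations. -/
def paramsProg (k : ℕ) : RamProg :=
  .seq logProg <| .seq (powProg k) <|
  .seq (.assign 22 (.add (.reg 0) (.const 1))) <| .seq (mulProg 23 5 22) <|
  .seq (mulProg 24 23 22) <| .seq (.assign 25 (.const (2 ^ (k + 3)))) <| .seq (mulProg 6 24 25) <|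
  .seq (.assign 26 (.add (.reg 4) (.const 1))) <| .seq (mulProg 27 0 26) <|
  .seq (mulProg 7 6 27) <|
  .seq (.assign 11 (centerExpr k)) <| .seq (mulProg 28 11 11) <| .seq (mulProg 29 28 0) <|
  .assign 12 (.add (.reg 29) (.const 1))

/-- What the preparatory computations achieve. -/
structure ParamsDone (k n s b : ℕ) (σ σ' : RamState) : Prop where
  frame : Frame (paramsProg k) σ σ'
  tags : σ'.reg 3 = 2 ^ b
  bits : σ'.reg 4 = b
  lt_tags : n < 2 ^ b
  tags_le : 2 ^ b ≤ 2 * n + 1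
  bits_le : b ≤ n
  trials : σ'.reg 6 = trialCount k n
  coins : σ'.reg 7 = trialCount k n * (n * (b + 1))
  centers_eq : σ'.reg 11 = centers k s
  rounds : σ'.reg 12 = centers k s * centers k s * n + 1

theorem tr_params {E k n s : ℕ} {σ : RamState} (hk : 0 < k) (hn : σ.reg 0 = n) (hs : σ.reg 2 = s)
    (hE : 2 ≤ E) (hkE : k < 2 ^ E) (hnE : 2 * n + 2 < 2 ^ E)
    (hN : trialCount k n * (n * (n + 1) + 1) < 2 ^ E)
    (hR : centers k s * centers k s * n + 1 < 2 ^ E)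
    (hm : centers k s * centers k s < 2 ^ E) (hs' : s < 2 ^ E) (h2n : 2 ^ n < 2 ^ E) :
    Tr E (paramsProg k) (3 * (n * n) + 25 * n + 3 * s + 3 * 2 ^ (k + 3) + 60) σ fun σ' =>
      ∃ b, ParamsDone k n s b σ σ' := by
  have hT : trialCount k n < 2 ^ E := lt_of_le_of_lt (Nat.le_mul_of_pos_right _ (by omega)) hN
  have hT3 : 2 ^ (n - n / k) * (n + 1) * (n + 1) < 2 ^ E :=
    lt_of_le_of_lt (Nat.le_mul_of_pos_right _ (by positivity)) hT
  have hT2 : 2 ^ (n - n / k) * (n + 1) < 2 ^ E :=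
    lt_of_le_of_lt (Nat.le_mul_of_pos_right _ (by positivity)) hT3
  have hms := centers_le k s
  have hC : 2 ^ (k + 3) < 2 ^ E := lt_of_le_of_lt (Nat.le_mul_of_pos_left _ (by positivity)) hT
  suffices H : ∃ N ≤ 3 * (n * n) + 25 * n + 3 * s + 3 * 2 ^ (k + 3) + 60,
      Tr E (paramsProg k) N σ fun σ' => ∃ b, σ'.reg 3 = 2 ^ b ∧ σ'.reg 4 = b ∧ n < 2 ^ b ∧
        2 ^ b ≤ 2 * n + 1 ∧ b ≤ n ∧ σ'.reg 6 = trialCount k n ∧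
        σ'.reg 7 = trialCount k n * (n * (b + 1)) ∧ σ'.reg 11 = centers k s ∧
        σ'.reg 12 = centers k s * centers k s * n + 1 by
    obtain ⟨N, hNle, H⟩ := H
    refine H.frame.mono hNle ?_
    rintro σ' ⟨hf, b, h1, h2, h3, h4, h5, h6, h7, h8, h9⟩
    exact ⟨b, hf, h1, h2, h3, h4, h5, h6, h7, h8, h9⟩
  refine ⟨_, ?_, tr_seq (tr_log hn hnE fun σ₁ b hf₁ h3 h4 hb1 hb2 hb3 => tr_seq
    (N₁ := n * 5 + 4) (N₂ := 3 * (n * (n + 1)) + 12 * n + 3 * s + 3 * 2 ^ (k + 3) + 45) ?_)⟩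
  · rw [mul_add_one]
    omega
  refine tr_pow hk ((hf₁.1 0 (by decide)).trans hn) h2n hkE fun σ₂ hf₂ h5 => ?_
  have h0 : σ₂.reg 0 = n := (hf₂.1 0 (by rw [powProg_regs]; decide)).trans ((hf₁.1 0 (by decide)).trans hn)
  have h2 : σ₂.reg 2 = s := (hf₂.1 2 (by rw [powProg_regs]; decide)).trans ((hf₁.1 2 (by decide)).trans hs)
  replace h3 := (hf₂.1 3 (by rw [powProg_regs]; decide)).trans h3
  replace h4 := (hf₂.1 4 (by rw [powProg_regs]; decide)).trans h4
  refine Tr.mono (N := 1 + ((n + 1) * 3 + 3 + ((n + 1) * 3 + 3 + (1 + (2 ^ (k + 3) * 3 + 3 + (1 +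
    ((b + 1) * 3 + 3 + (n * (b + 1) * 3 + 3 + (1 + (centers k s * 3 + 3 + (n * 3 + 3 + 1)))))))))))
    (tr_seq (tr_assign (RamExpr.small hE (by decide)) ?_ ?_)) ?_ (fun _ h => h)
  · simp only [RamExpr.eval, h0]; omega
  · simp only [RamExpr.eval, h0]
    generalize hσ : σ₂.setReg 22 (n + 1) = σ₃
    have e0 : σ₃.reg 0 = n := by simp [← hσ, h0]
    have e2 : σ₃.reg 2 = s := by simp [← hσ, h2]
    have e3 : σ₃.reg 3 = 2 ^ b := by simp [← hσ, h3]
    have e4 : σ₃.reg 4 = b := by simp [← hσ, h4]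
    have e5 : σ₃.reg 5 = 2 ^ (n - n / k) := by simp [← hσ, h5]
    have e22 : σ₃.reg 22 = n + 1 := by simp [← hσ]
    refine tr_seq (tr_mul (by decide) (by decide) (by decide) (by decide) (by decide) e5 e22 hT2
      fun σ₄ hf₄ h23 => ?_)
    refine tr_seq (tr_mul (by decide) (by decide) (by decide) (by decide) (by decide) h23
      ((hf₄.1 22 (by decide)).trans e22) hT3 fun σ₅ hf₅ h24 => ?_)
    refine tr_seq (tr_assign ⟨by simp [RamExpr.nodes], hC⟩ hC ?_)
    simp only [RamExpr.eval]
    refine tr_seq (tr_mul (A := 2 ^ (n - n / k) * (n + 1) * (n + 1)) (B := 2 ^ (k + 3))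
      (by decide) (by decide) (by decide) (by decide) (by decide) (by simpa using h24) (by simp) hT
      fun σ₆ hf₆ h6 => ?_)
    replace h6 : σ₆.reg 6 = trialCount k n := h6
    have hback : ∀ r ∉ [22, 20, 23, 24, 25, 6], σ₆.reg r = σ₃.reg r := by
      intro r hr
      simp only [List.mem_cons, List.not_mem_nil, or_false, not_or] at hr
      rw [hf₆.1 r (by simp [mulProg_regs]; omega), RamState.setReg_reg,
        Function.update_of_ne (by omega), hf₅.1 r (by simp [mulProg_regs]; omega),
        hf₄.1 r (by simp [mulProg_regs]; omega)]
    replace e0 := (hback 0 (by decide)).trans e0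
    replace e2 := (hback 2 (by decide)).trans e2
    replace e3 := (hback 3 (by decide)).trans e3
    replace e4 := (hback 4 (by decide)).trans e4
    refine tr_seq (tr_assign (RamExpr.small hE (by decide)) ?_ ?_)
    · simp only [RamExpr.eval, e4]; omega
    simp only [RamExpr.eval, e4]
    have hb : n * (b + 1) ≤ n * (n + 1) := Nat.mul_le_mul_left _ (by omega)
    have hTb : trialCount k n * (n * (b + 1)) ≤ trialCount k n * (n * (n + 1) + 1) :=
      Nat.mul_le_mul_left _ (by omega)
    have hnb : n * (b + 1) ≤ trialCount k n * (n * (n + 1) + 1) :=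
      (Nat.le_mul_of_pos_left _ (by unfold trialCount; positivity)).trans hTb
    refine tr_seq (tr_mul (A := n) (B := b + 1) (by decide) (by decide) (by decide) (by decide)
      (by decide) (by simpa using e0) (by simp) (by omega) fun σ₇ hf₇ h27 => ?_)
    refine tr_seq (tr_mul (A := trialCount k n) (B := n * (b + 1)) (by decide) (by decide)
      (by decide) (by decide) (by decide)
      (by rw [hf₇.1 6 (by decide)]; simpa using h6) h27 (by omega) fun σ₈ hf₈ h7 => ?_)
    have hback : ∀ r ∉ [26, 20, 27, 7], σ₈.reg r = σ₆.reg r := by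
      intro r hr
      simp only [List.mem_cons, List.not_mem_nil, or_false, not_or] at hr
      rw [hf₈.1 r (by simp [mulProg_regs]; omega), hf₇.1 r (by simp [mulProg_regs]; omega),
        RamState.setReg_reg, Function.update_of_ne (by omega)]
    replace e0 := (hback 0 (by decide)).trans e0
    replace e2 := (hback 2 (by decide)).trans e2
    replace e3 := (hback 3 (by decide)).trans e3
    replace e4 := (hback 4 (by decide)).trans e4
    replace h6 := (hback 6 (by decide)).trans h6
    refine tr_seq (tr_assign (centerExpr_small hE k) ?_ ?_)
    · rw [centerExpr_eval, e2]; omega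
    rw [centerExpr_eval, e2]
    refine tr_seq (tr_mul (A := centers k s) (B := centers k s) (by decide) (by decide) (by decide)
      (by decide) (by decide) (by simp) (by simp) hm fun σ₉ hf₉ h28 => ?_)
    refine tr_seq (tr_mul (A := centers k s * centers k s) (B := n) (by decide) (by decide)
      (by decide) (by decide) (by decide) h28
      (by rw [hf₉.1 0 (by decide)]; simpa using e0) (by omega) fun σ₁₀ hf₁₀ h29 => ?_)
    have hback : ∀ r ∉ [11, 28, 20, 29], σ₁₀.reg r = σ₈.reg r := by
      intro r hr
      simp only [List.mem_cons, List.not_mem_nil, or_false, not_or] at hr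
      rw [hf₁₀.1 r (by simp [mulProg_regs]; omega), hf₉.1 r (by simp [mulProg_regs]; omega),
        RamState.setReg_reg, Function.update_of_ne (by omega)]
    replace e3 := (hback 3 (by decide)).trans e3
    replace e4 := (hback 4 (by decide)).trans e4
    replace h6 := (hback 6 (by decide)).trans h6
    replace h7 := (hback 7 (by decide)).trans h7
    have h11 : σ₁₀.reg 11 = centers k s := by
      rw [hf₁₀.1 11 (by decide), hf₉.1 11 (by decide)]; simp
    refine tr_assign (RamExpr.small hE (by decide)) ?_ ?_
    · simp only [RamExpr.eval, h29]; exact hR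
    · exact ⟨b, by simpa using e3, by simpa using e4, hb1, hb2, hb3, by simpa using h6,
        by simpa using h7, by simpa using h11, by simp [RamExpr.eval, h29]⟩
  · have hb : n * (b + 1) ≤ n * (n + 1) := Nat.mul_le_mul_left _ (by omega)
    omega

/-! ### Detecting falsified clauses -/

/-- One step of the scan of a coded formula under the partial assignment `val` (`0` for unset,
`1` for false, `2` for true). The state says whether all literals of the current clause have been
false so far, and whether a falsified clause has been met. -/
def scanStep (val : ℕ → ℕ) (st : Bool × Bool) (q : ℕ × ℕ) : Bool × Bool :=
  if q.1 = 0 then (true, st.2 || st.1) else (st.1 && decide (val (q.1 - 1) + q.2 = 2), st.2)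

/-- Some clause has only false literals under the partial assignment `val`. -/
def Falsified {n : ℕ} (F : CNFFormula n) (val : ℕ → ℕ) : Prop :=
  ∃ C ∈ F, ∀ l ∈ C, val l.1 + (if l.2 then 1 else 0) = 2

/-- The codes are chosen so that a literal is false exactly when value plus sign is `2`: a positive
literal (sign `1`) with value `1`, or a negative one (sign `0`) with value `2`. An unset variable
contributes `0`, and the sum stays below `2`. -/
theorem scan_clause {n : ℕ} (val : ℕ → ℕ) (C : List (Fin n × Bool)) (st : Bool × Bool) :
    (C.map fun l => ((l.1 : ℕ) + 1, if l.2 then 1 else 0)).foldl (scanStep val) st =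
      (st.1 && decide (∀ l ∈ C, val l.1 + (if l.2 then 1 else 0) = 2), st.2) := by
  induction C generalizing st with
  | nil => simp
  | cons l C ih =>
    rw [List.map_cons, List.foldl_cons, ih]
    simp [scanStep, Bool.and_assoc]

theorem scan_formula {n : ℕ} (val : ℕ → ℕ) (F : CNFFormula n) (fl : Bool) :
    ((formulaCode F).foldl (scanStep val) (true, fl)).2 = true ↔ fl = true ∨ Falsified F val := by
  induction F generalizing fl with
  | nil => simp [formulaCode, Falsified]
  | cons C F ih =>
    have : formulaCode (C :: F) = ((C.map fun l => ((l.1 : ℕ) + 1, if l.2 then 1 else 0)) ++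
      [(0, 0)]) ++ formulaCode F := by simp [formulaCode]
    rw [this, List.foldl_append, List.foldl_append, scan_clause]
    simp only [Bool.true_and, List.foldl_cons, scanStep, if_true, List.foldl_nil]
    rw [ih]
    simp only [Falsified, List.mem_cons, exists_eq_or_imp, Bool.or_eq_true, decide_eq_true_eq]
    tauto

/-- Register `32` becomes `1` or `0` depending on whether some clause is falsified by the partial
assignment in array `3`. -/
def checkProg : RamProg :=
  .seq (.assign 32 (.const 0)) <| .seq (.assign 33 (.const 1)) <| forLoop 25 (.reg 1) <|
    .ite (.read 0 (.reg 25))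
      (.seq (.assign 34 (.add (.read 3 (.sub (.read 0 (.reg 25)) (.const 1))) (.read 1 (.reg 25))))
        -- With truncated subtraction, the sum of both differences is nonzero exactly when the two
        -- numbers differ.
        (.ite (.add (.sub (.reg 34) (.const 2)) (.sub (.const 2) (.reg 34)))
          (.assign 33 (.const 0)) .skip))
      (.seq (.ite (.reg 33) (.assign 32 (.const 1)) .skip) (.assign 33 (.const 1)))

/-- The memory contains the formula. -/
structure HasFormula {n : ℕ} (F : CNFFormula n) (σ : RamState) : Prop where
  vars : σ.reg 0 = n
  length : σ.reg 1 = (formulaCode F).length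
  fst : ∀ i, σ.arr 0 i = ((formulaCode F).getD i (0, 0)).1
  snd : ∀ i, σ.arr 1 i = ((formulaCode F).getD i (0, 0)).2

theorem HasFormula.congr {n : ℕ} {F : CNFFormula n} {σ σ' : RamState} (h : HasFormula F σ)
    (h0 : σ'.reg 0 = σ.reg 0) (h1 : σ'.reg 1 = σ.reg 1) (h2 : σ'.arr 0 = σ.arr 0)
    (h3 : σ'.arr 1 = σ.arr 1) : HasFormula F σ' :=
  ⟨h0.trans h.vars, h1.trans h.length, fun i => by rw [h2, h.fst], fun i => by rw [h3, h.snd]⟩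

theorem snd_le_of_mem_formulaCode {n : ℕ} (F : CNFFormula n) (i : ℕ) :
    ((formulaCode F).getD i (0, 0)).2 ≤ 1 := by
  by_cases h : i < (formulaCode F).length
  · rw [List.getD_eq_getElem _ _ h]
    have := List.getElem_mem h
    generalize (formulaCode F)[i] = q at this
    simp only [formulaCode, List.mem_flatMap, List.mem_append, List.mem_map, List.mem_singleton]
      at this
    obtain ⟨C, -, ⟨l, -, rfl⟩ | rfl⟩ := this
    · dsimp only; split_ifs <;> simp
    · simp
  · rw [List.getD_eq_default _ _ (by omega)]; simp

theorem tr_check {E n : ℕ} {F : CNFFormula n} {σ : RamState} {Q : RamState → Prop} (hE : 2 ≤ E)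
    (hF : HasFormula F σ) (hval : ∀ i, σ.arr 3 i ≤ 2)
    (h : ∀ σ', Frame checkProg σ σ' → (σ'.reg 32 ≠ 0 ↔ Falsified F (σ.arr 3)) → Q σ') :
    Tr E checkProg ((formulaCode F).length * 6 + 4) σ Q := by
  refine Tr.bdd fun hbd => ?_
  have hE4 : 4 ≤ 2 ^ E := Nat.pow_le_pow_right (n := 2) (by simp) hE
  have hL : (formulaCode F).length < 2 ^ E := hF.length ▸ hbd.1 1
  let fold : ℕ → Bool × Bool := fun t => ((formulaCode F).take t).foldl (scanStep (σ.arr 3)) (true, false)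
  suffices H : Tr E checkProg (1 + (1 + ((formulaCode F).length * ((1 + (1 + 1)) + 1 + 2) + 2))) σ
      fun σ' => σ'.reg 33 = (fold (formulaCode F).length).1.toNat ∧
        σ'.reg 32 = (fold (formulaCode F).length).2.toNat by
    refine H.frame.mono (by omega) fun σ' h' => h σ' h'.1 ?_
    rw [h'.2.2]
    have := scan_formula (σ.arr 3) F false
    simp only [fold, List.take_length]
    rw [ne_eq, Bool.toNat_eq_zero, Bool.not_eq_false, this]
    simp
  refine tr_seq (tr_assign (RamExpr.small hE (by decide)) (by simp [RamExpr.eval]) ?_)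
  refine tr_seq (tr_assign (RamExpr.small hE (by decide)) (by simp only [RamExpr.eval]; omega) ?_)
  simp only [RamExpr.eval]
  refine tr_for (fun t σ' => σ'.reg 33 = (fold t).1.toNat ∧ σ'.reg 32 = (fold t).2.toNat)
    (by simp [RamExpr.nodes]) trivial hL (by decide) ?_ ?_ ?_ ?_
  · intro σ' hf
    have := hf.1 1 (by decide)
    simpa [RamExpr.eval, hF.length] using this
  · simp [fold]
  · rintro t σ' ht hf hbd' hr ⟨h33, h32⟩
    have a0 : σ'.arr 0 = σ.arr 0 := hf.2 0 (by decide)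
    have a1 : σ'.arr 1 = σ.arr 1 := hf.2 1 (by decide)
    have a3 : σ'.arr 3 = σ.arr 3 := hf.2 3 (by decide)
    have hfold : fold (t + 1) = scanStep (σ.arr 3) (fold t) ((formulaCode F).getD t (0, 0)) := by
      simp only [fold]
      rw [List.take_succ_eq_append_getElem ht, List.foldl_append, List.getD_eq_getElem _ _ ht]
      rfl
    have hc0 : σ'.arr 0 t = ((formulaCode F).getD t (0, 0)).1 := by rw [a0, hF.fst]
    have hc1 : σ'.arr 1 t = ((formulaCode F).getD t (0, 0)).2 := by rw [a1, hF.snd]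
    have hle := snd_le_of_mem_formulaCode F t
    generalize (formulaCode F).getD t (0, 0) = q at *
    refine tr_ite (RamExpr.small hE (by decide)) (fun hc => ?_) (fun hc => ?_)
    · simp only [RamExpr.eval, hr, hc0] at hc
      have hv := hval (q.1 - 1)
      refine tr_seq (tr_assign (RamExpr.small hE (by decide)) ?_ ?_)
      · simp only [RamExpr.eval, hr, hc0, hc1, a3]; omega
      simp only [RamExpr.eval, hr, hc0, hc1, a3]
      refine tr_ite (RamExpr.small hE (by decide)) (fun hc' => ?_) (fun hc' => ?_)
      · simp only [RamExpr.eval, RamState.setReg_reg, Function.update_self] at hc'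
        refine tr_assign (RamExpr.small hE (by decide)) (by simp [RamExpr.eval]) ?_
        have : σ.arr 3 (q.1 - 1) + q.2 ≠ 2 := by omega
        simp [RamExpr.eval, hfold, scanStep, hc, this, h32]
      · simp only [RamExpr.eval, RamState.setReg_reg, Function.update_self] at hc'
        refine tr_skip ?_
        have : σ.arr 3 (q.1 - 1) + q.2 = 2 := by omega
        simp [hfold, scanStep, hc, this, h32, h33]
    · simp only [RamExpr.eval, hr, hc0] at hc
      refine (tr_seq (N₁ := 1 + 1) (N₂ := 1) ?_).mono (by omega) fun _ h => h
      refine tr_ite (RamExpr.small hE (by decide)) (fun hc' => ?_) (fun hc' => ?_)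
      · simp only [RamExpr.eval, h33, ne_eq, Bool.toNat_eq_zero, Bool.not_eq_false] at hc'
        refine tr_assign (RamExpr.small hE (by decide)) (by simp only [RamExpr.eval]; omega) ?_
        refine tr_assign (RamExpr.small hE (by decide)) (by simp only [RamExpr.eval]; omega) ?_
        simp [RamExpr.eval, hfold, scanStep, hc, hc']
      · simp only [RamExpr.eval, h33, Bool.toNat_eq_zero] at hc'
        refine tr_skip ?_
        refine tr_assign (RamExpr.small hE (by decide)) (by simp only [RamExpr.eval]; omega) ?_
        simp [RamExpr.eval, hfold, scanStep, hc, hc', h32]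
  · intro σ' _ _ h'; exact h'

/-! ### One round of the random search -/

/-- The number with binary digits `τ c, …, τ (c + b - 1)`. -/
def tagOf (τ : ℕ → Bool) (c : ℕ) : ℕ → ℕ
  | 0 => 0
  | b + 1 => tagOf τ c b + tagOf τ c b + (τ (c + b)).toNat

theorem tagOf_lt (τ : ℕ → Bool) (c b : ℕ) : tagOf τ c b < 2 ^ b := by
  induction b with
  | zero => simp [tagOf]
  | succ b ih =>
    have := Bool.toNat_le (τ (c + b))
    rw [tagOf, pow_succ]
    omega

/-- For every variable, read a tag of `b` bits into array `8` and a coin into array `9`, and unset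
the variable in array `3`. -/
def readProg : RamProg :=
  forLoop 21 (.reg 0) <| .seq (.assign 31 (.const 0)) <|
    .seq (forLoop 22 (.reg 4) (.seq
      (.assign 31 (.add (.add (.reg 31) (.reg 31)) (.read 4 (.reg 8))))
      (.assign 8 (.add (.reg 8) (.const 1))))) <|
    .seq (.store 8 (.reg 21) (.reg 31)) <| .seq (.store 9 (.reg 21) (.read 4 (.reg 8))) <|
    .seq (.assign 8 (.add (.reg 8) (.const 1))) (.store 3 (.reg 21) (.const 0))

/-- The part of the tape used by one round is cut into blocks of `b + 1` cells, one per variable: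
`b` bits for the tag, then the coin. -/
theorem tr_read {E n b c : ℕ} {τ : ℕ → Bool} {σ : RamState} {Q : RamState → Prop} (hE : 2 ≤ E)
    (hn : σ.reg 0 = n) (hb : σ.reg 4 = b) (hc : σ.reg 8 = c)
    (hτ : ∀ i, σ.arr 4 i = (τ i).toNat) (hval : ∀ i, σ.arr 3 i ≤ 2)
    (hcE : c + n * (b + 1) < 2 ^ E) (hbE : 2 ^ b < 2 ^ E)
    (h : ∀ σ', Frame readProg σ σ' → σ'.reg 8 = c + n * (b + 1) →
      (∀ i < n, σ'.arr 8 i = tagOf τ (c + i * (b + 1)) b) →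
      (∀ i < n, σ'.arr 9 i = (τ (c + i * (b + 1) + b)).toNat) →
      (∀ i < n, σ'.arr 3 i = 0) → (∀ i, σ'.arr 3 i ≤ 2) → Q σ') :
    Tr E readProg (n * (b * 4 + 9) + 2) σ Q := by
  refine Tr.bdd fun hbd => ?_
  have hnE : n < 2 ^ E := hn ▸ hbd.1 0
  have hbE' : b < 2 ^ E := hb ▸ hbd.1 4
  have hE4 : 4 ≤ 2 ^ E := Nat.pow_le_pow_right (n := 2) (by simp) hE
  suffices H : Tr E readProg (n * ((1 + ((b * ((1 + 1) + 2) + 2) + (1 + (1 + (1 + 1))))) + 2) + 2) σ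
      fun σ' => σ'.reg 8 = c + n * (b + 1) ∧
        (∀ i < n, σ'.arr 8 i = tagOf τ (c + i * (b + 1)) b) ∧
        (∀ i < n, σ'.arr 9 i = (τ (c + i * (b + 1) + b)).toNat) ∧
        (∀ i < n, σ'.arr 3 i = 0) ∧ (∀ i, σ'.arr 3 i ≤ 2) by
    refine H.frame.mono (le_of_eq (by ring)) ?_
    rintro σ' ⟨hf, h1, h2, h3, h4, h5⟩
    exact h σ' hf h1 h2 h3 h4 h5
  refine tr_for (fun t σ' => σ'.reg 8 = c + t * (b + 1) ∧
      (∀ i < t, σ'.arr 8 i = tagOf τ (c + i * (b + 1)) b) ∧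
      (∀ i < t, σ'.arr 9 i = (τ (c + i * (b + 1) + b)).toNat) ∧
      (∀ i < t, σ'.arr 3 i = 0) ∧ (∀ i, σ'.arr 3 i ≤ 2)) (by simp [RamExpr.nodes]) trivial hnE
    (by decide) ?_ ?_ ?_ ?_
  · intro σ' hf
    have := hf.1 0 (by decide)
    simpa [RamExpr.eval, hn] using this
  · simpa [hc] using hval
  · rintro t σ₁ ht hf₁ hbd₁ hr₁ ⟨h8, ha8, ha9, ha3, ha3'⟩
    have hlt : c + (t + 1) * (b + 1) ≤ c + n * (b + 1) := by gcongr; omega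
    rw [add_one_mul] at hlt
    have e4 : σ₁.reg 4 = b := (hf₁.1 4 (by decide)).trans hb
    have eτ : ∀ i, σ₁.arr 4 i = (τ i).toNat := fun i => by rw [hf₁.2 4 (by decide), hτ]
    refine tr_seq (tr_assign (RamExpr.small hE (by decide)) (by simp [RamExpr.eval]) ?_)
    simp only [RamExpr.eval]
    refine tr_seq (tr_for (fun u σ' => σ'.reg 8 = c + t * (b + 1) + u ∧
      σ'.reg 31 = tagOf τ (c + t * (b + 1)) u)
      (by simp [RamExpr.nodes]) trivial hbE' (by decide) ?_ ?_ ?_ ?_)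
    · intro σ' hf
      have := hf.1 4 (by decide)
      simpa [RamExpr.eval, e4] using this
    · simp [h8, tagOf]
    · rintro u σ₂ hu hf₂ hbd₂ hr₂ ⟨g8, g31⟩
      have e4' : ∀ i, σ₂.arr 4 i = (τ i).toNat := fun i => by
        rw [hf₂.2 4 (by decide)]; simp [eτ]
      have hlt' := tagOf_lt τ (c + t * (b + 1)) (u + 1)
      have hpow : 2 ^ (u + 1) ≤ 2 ^ b := Nat.pow_le_pow_right (by simp) hu
      rw [tagOf] at hlt'
      refine tr_seq (tr_assign (RamExpr.small hE (by decide)) ?_ ?_)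
      · simp only [RamExpr.eval, g31, g8, e4']; omega
      refine tr_assign (RamExpr.small hE (by decide)) ?_ ?_
      · simp [RamExpr.eval, g8]; omega
      · simp [RamExpr.eval, g31, g8, e4', tagOf, add_assoc]
    · rintro σ₂ hf₂ hbd₂ ⟨g8, g31⟩
      have e4' : ∀ i, σ₂.arr 4 i = (τ i).toNat := fun i => by
        rw [hf₂.2 4 (by decide)]; simp [eτ]
      have e21 : σ₂.reg 21 = t := by rw [hf₂.1 21 (by decide)]; simpa using hr₁
      have e8 : σ₂.arr 8 = σ₁.arr 8 := by rw [hf₂.2 8 (by decide)]; simp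
      have e9 : σ₂.arr 9 = σ₁.arr 9 := by rw [hf₂.2 9 (by decide)]; simp
      have e3 : σ₂.arr 3 = σ₁.arr 3 := by rw [hf₂.2 3 (by decide)]; simp
      have htl := tagOf_lt τ (c + t * (b + 1)) b
      refine tr_seq (tr_store (RamExpr.small hE (by decide)) (RamExpr.small hE (by decide)) ?_ ?_)
      · simp only [RamExpr.eval, g31]; omega
      refine tr_seq (tr_store (RamExpr.small hE (by decide)) (RamExpr.small hE (by decide)) ?_ ?_)
      · have := Bool.toNat_le (τ (c + t * (b + 1) + b))
        simp [RamExpr.eval, g8, e4']; omega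
      refine tr_seq (tr_assign (RamExpr.small hE (by decide)) ?_ ?_)
      · simp [RamExpr.eval, g8]; omega
      refine tr_store (RamExpr.small hE (by decide)) (RamExpr.small hE (by decide)) ?_ ?_
      · simp [RamExpr.eval]
      · simp only [RamExpr.eval, RamState.setReg_reg, RamState.setArr_reg, RamState.setReg_arr,
          RamState.setArr_arr, e21, g31, g8, e8]
        refine ⟨by simp; ring, fun i hi => ?_, fun i hi => ?_, fun i hi => ?_, fun i => ?_⟩
        · by_cases hit : i = t
          · subst hit; simp
          · simpa [hit, e8] using ha8 i (by omega)
        · by_cases hit : i = t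
          · subst hit; simp [e4']
          · simpa [hit, e9] using ha9 i (by omega)
        · by_cases hit : i = t
          · subst hit; simp [e21]
          · simpa [hit, e3, e21] using ha3 i (by omega)
        · by_cases hit : i = t
          · subst hit; simp [e21]
          · simpa [hit, e3, e21] using ha3' i
  · intro σ' _ _ h'; exact h'

/-- Set the variable in register `22`: if one of its values falsifies a clause, take the other one,
and otherwise take the coin in array `9`. -/
def setProg : RamProg :=
  .seq (.store 3 (.reg 22) (.const 1)) <| .seq checkProg <|
    .ite (.reg 32) (.store 3 (.reg 22) (.const 2)) <|
    .seq (.store 3 (.reg 22) (.const 2)) <| .seq checkProg <|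
    .ite (.reg 32) (.store 3 (.reg 22) (.const 1))
      (.store 3 (.reg 22) (.add (.const 1) (.read 9 (.reg 22))))

open Classical in
/-- The value given to the variable `i` under the partial assignment `val` with the coin `coin`. -/
noncomputable def setValue {n : ℕ} (F : CNFFormula n) (val : ℕ → ℕ) (i : ℕ) (coin : Bool) : ℕ :=
  if Falsified F (Function.update val i 1) then 2
  else if Falsified F (Function.update val i 2) then 1 else 1 + coin.toNat

theorem setValue_le {n : ℕ} (F : CNFFormula n) (val : ℕ → ℕ) (i : ℕ) (coin : Bool) :
    1 ≤ setValue F val i coin ∧ setValue F val i coin ≤ 2 := by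
  have := Bool.toNat_le coin
  unfold setValue
  split_ifs <;> omega

theorem update_le_two {val : ℕ → ℕ} (h : ∀ i, val i ≤ 2) (i : ℕ) {v : ℕ} (hv : v ≤ 2) (j : ℕ) :
    Function.update val i v j ≤ 2 := by
  by_cases hij : j = i
  · subst hij; simpa using hv
  · simpa [hij] using h j

theorem tr_set {E n i : ℕ} {coin : Bool} {F : CNFFormula n} {σ : RamState} {Q : RamState → Prop}
    (hE : 2 ≤ E) (hF : HasFormula F σ) (hval : ∀ i, σ.arr 3 i ≤ 2) (hi : σ.reg 22 = i)
    (hcoin : σ.arr 9 i = coin.toNat)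
    (h : ∀ σ', Frame setProg σ σ' →
      σ'.arr 3 = Function.update (σ.arr 3) i (setValue F (σ.arr 3) i coin) → Q σ') :
    Tr E setProg ((formulaCode F).length * 12 + 13) σ Q := by
  have hE4 : 4 ≤ 2 ^ E := Nat.pow_le_pow_right (n := 2) (by simp) hE
  have hcl := Bool.toNat_le coin
  set L := (formulaCode F).length with hL
  suffices H : Tr E setProg (1 + ((L * 6 + 4) + ((1 + ((L * 6 + 4) + (1 + 1))) + 1))) σ fun σ' =>
      σ'.arr 3 = Function.update (σ.arr 3) i (setValue F (σ.arr 3) i coin) from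
    H.frame.mono (by omega) fun σ' h' => h σ' h'.1 h'.2
  refine tr_seq (tr_store (RamExpr.small hE (by decide)) (RamExpr.small hE (by decide)) ?_ ?_)
  · simp only [RamExpr.eval]; omega
  simp only [RamExpr.eval, hi]
  refine tr_seq (tr_check hE (hF.congr rfl rfl rfl rfl) ?_ fun σ₁ hf₁ h₁ => ?_)
  · simpa using update_le_two hval i (by simp : 1 ≤ 2)
  have a3 : σ₁.arr 3 = Function.update (σ.arr 3) i 1 := by rw [hf₁.2 3 (by decide)]; simp
  have e22 : σ₁.reg 22 = i := by rw [hf₁.1 22 (by decide)]; simpa using hi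
  have hF₁ : HasFormula F σ₁ := hF.congr (hf₁.1 0 (by decide)) (hf₁.1 1 (by decide))
    (hf₁.2 0 (by decide)) (hf₁.2 1 (by decide))
  have a9 : σ₁.arr 9 i = coin.toNat := by rw [hf₁.2 9 (by decide)]; simpa using hcoin
  simp only [RamState.setArr_arr, Function.update_self] at h₁
  refine tr_ite (RamExpr.small hE (by decide)) (fun hc => ?_) (fun hc => ?_)
  · refine (tr_store (RamExpr.small hE (by decide)) (RamExpr.small hE (by decide)) ?_ ?_).mono
      (by omega : 1 ≤ _) fun _ h => h
    · simp only [RamExpr.eval]; omega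
    · simp [RamExpr.eval, a3, e22, setValue, h₁.1 hc]
  · have hno : ¬ Falsified F (Function.update (σ.arr 3) i 1) := fun h => h₁.2 h hc
    refine tr_seq (tr_store (RamExpr.small hE (by decide)) (RamExpr.small hE (by decide)) ?_ ?_)
    · simp only [RamExpr.eval]; omega
    simp only [RamExpr.eval, e22]
    refine tr_seq (tr_check hE (hF₁.congr rfl rfl rfl rfl) ?_ fun σ₂ hf₂ h₂ => ?_)
    · simpa [a3] using update_le_two hval i (by simp : 2 ≤ 2)
    have b3 : σ₂.arr 3 = Function.update (σ.arr 3) i 2 := by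
      rw [hf₂.2 3 (by decide)]; simp [a3]
    have e22' : σ₂.reg 22 = i := by rw [hf₂.1 22 (by decide)]; simpa using e22
    have b9 : σ₂.arr 9 i = coin.toNat := by rw [hf₂.2 9 (by decide)]; simpa using a9
    simp only [RamState.setArr_arr, Function.update_self, a3, Function.update_idem] at h₂
    refine tr_ite (RamExpr.small hE (by decide)) (fun hc' => ?_) (fun hc' => ?_)
    · refine tr_store (RamExpr.small hE (by decide)) (RamExpr.small hE (by decide)) ?_ ?_
      · simp only [RamExpr.eval]; omega
      · simp [RamExpr.eval, b3, e22', setValue, hno, h₂.1 hc']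
    · have hno' : ¬ Falsified F (Function.update (σ.arr 3) i 2) := fun h => h₂.2 h hc'
      refine tr_store (RamExpr.small hE (by decide)) (RamExpr.small hE (by decide)) ?_ ?_
      · simp only [RamExpr.eval, e22', b9]; omega
      · simp [RamExpr.eval, b3, e22', setValue, hno, hno', b9]

/-! ### Correctness of a round -/

/-- The value of variable `i` in the assignment `z` is forced by a clause whose other variables have
smaller tags. -/
def Forced {n : ℕ} (F : CNFFormula n) (z : Fin n → Bool) (g : Fin n → ℕ) (i : Fin n) : Prop :=
  ∃ C ∈ F, (i, z i) ∈ C ∧ ∀ l ∈ C, l = (i, z i) ∨ (z l.1 ≠ l.2 ∧ g l.1 < g i)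

/-- The coins `v` agree with the assignment `z` wherever it is not forced. -/
def Hit {n : ℕ} (F : CNFFormula n) (z : Fin n → Bool) (g : Fin n → ℕ) (v : Fin n → Bool) : Prop :=
  ∀ i, v i = z i ∨ Forced F z g i

/-- The value `z i` never falsifies a clause, because `z` makes a literal of each clause true and
all other variables are unset or set as in `z`. If the coin is wrong, `i` is forced: the other
variables of the forcing clause have smaller tags and are already set as in `z`, so the wrong value
falsifies that clause and is avoided. -/
theorem setValue_eq {n : ℕ} {F : CNFFormula n} {z : Fin n → Bool} {g : Fin n → ℕ} {val : ℕ → ℕ}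
    {i : Fin n} {coin : Bool} (hz : Satisfies F z) (hcoin : coin = z i ∨ Forced F z g i)
    (hval : ∀ l : Fin n, l ≠ i → val l = 0 ∨ val l = 1 + (z l).toNat)
    (hval' : ∀ l : Fin n, g l < g i → val l = 1 + (z l).toNat) :
    setValue F val i coin = 1 + (z i).toNat := by
  have hA : ¬ Falsified F (Function.update val i (1 + (z i).toNat)) := by
    rintro ⟨C, hC, hl⟩
    obtain ⟨l, hlC, hzl⟩ := hz C hC
    have := hl l hlC
    by_cases hli : l.1 = i
    · rw [hli, Function.update_self, ← hli, hzl] at this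
      cases h2 : l.2 <;> simp [h2] at this
    · rw [Function.update_of_ne (fun h => hli (Fin.ext h))] at this
      rcases hval l.1 hli with h0 | h0
      · rw [h0] at this
        split_ifs at this <;> omega
      · rw [h0, hzl] at this
        cases h2 : l.2 <;> simp [h2] at this
  have hB : coin ≠ z i → Falsified F (Function.update val i (2 - (z i).toNat)) := by
    intro hne
    obtain ⟨C, hC, -, hall⟩ := hcoin.resolve_left hne
    refine ⟨C, hC, fun l hl => ?_⟩
    rcases hall l hl with rfl | ⟨hzl, hg⟩
    · rw [Function.update_self]
      cases z i <;> simp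
    · have hli : l.1 ≠ i := by rintro h; rw [h] at hg; omega
      rw [Function.update_of_ne (fun h => hli (Fin.ext h)), hval' l.1 hg]
      cases h1 : z l.1 <;> cases h2 : l.2 <;> simp_all
  unfold setValue
  cases hzi : z i
  · simp only [hzi, Bool.toNat_false, add_zero, tsub_zero] at hA hB ⊢
    rw [if_neg hA]
    by_cases hc : coin = false
    · subst hc; simp
    · rw [if_pos (hB hc)]
  · simp only [hzi, Bool.toNat_true, Nat.add_one_sub_one] at hA hB ⊢
    by_cases hc : coin = true
    · subst hc
      rw [if_neg hA]
      simp
    · rw [if_pos (hB hc)]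

/-- Set all variables, in the order of their tags. -/
def orderProg : RamProg :=
  forLoop 21 (.reg 3) <| forLoop 22 (.reg 0) <|
    .ite (.add (.sub (.read 8 (.reg 22)) (.reg 21)) (.sub (.reg 21) (.read 8 (.reg 22))))
      .skip setProg

/-- The partial assignment `val` is defined exactly on the variables in `S`, and it agrees there
with every solution that is hit. -/
structure OrderInv {n : ℕ} (F : CNFFormula n) (g : Fin n → ℕ) (v : Fin n → Bool)
    (S : Fin n → Prop) (val : ℕ → ℕ) : Prop where
  le_two : ∀ i, val i ≤ 2
  pos : ∀ l, S l → 1 ≤ val l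
  zero : ∀ l, ¬ S l → val l = 0
  eq : ∀ z, Satisfies F z → Hit F z g v → ∀ l, S l → val l = 1 + (z l).toNat

theorem OrderInv.congr {n : ℕ} {F : CNFFormula n} {g : Fin n → ℕ} {v : Fin n → Bool}
    {S S' : Fin n → Prop} {val : ℕ → ℕ} (h : OrderInv F g v S val) (hS : ∀ l, S l ↔ S' l) :
    OrderInv F g v S' val := by
  have : S = S' := funext fun l => propext (hS l)
  rwa [← this]

/-- `Forced` asks for strictly smaller tags, so only the variables with smaller tags must have been
set before. Ties between tags may be broken arbitrarily. -/
theorem OrderInv.set {n : ℕ} {F : CNFFormula n} {g : Fin n → ℕ} {v : Fin n → Bool}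
    {S S' : Fin n → Prop} {val : ℕ → ℕ} (h : OrderInv F g v S val) (i : Fin n)
    (hS' : ∀ l, S' l ↔ S l ∨ l = i) (hg : ∀ l, g l < g i → S l) :
    OrderInv F g v S' (Function.update val i (setValue F val i (v i))) := by
  have hsv := setValue_le F val i (v i)
  have hne : ∀ l : Fin n, l ≠ i → (l : ℕ) ≠ i := fun l hl h => hl (Fin.ext h)
  refine ⟨update_le_two h.le_two _ hsv.2, fun l hl => ?_, fun l hl => ?_, fun z hz hh l hl => ?_⟩
  · by_cases hli : l = i
    · subst hli; simpa using hsv.1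
    · rw [Function.update_of_ne (hne l hli)]
      exact h.pos l (((hS' l).1 hl).resolve_right hli)
  · have hli : l ≠ i := fun h' => hl ((hS' l).2 (Or.inr h'))
    rw [Function.update_of_ne (hne l hli)]
    exact h.zero l fun h' => hl ((hS' l).2 (Or.inl h'))
  · by_cases hli : l = i
    · subst hli
      rw [Function.update_self]
      refine setValue_eq hz (hh l) (fun l' _ => ?_) fun l' hl' => h.eq z hz hh l' (hg l' hl')
      by_cases hs : S l'
      · exact Or.inr (h.eq z hz hh l' hs)
      · exact Or.inl (h.zero l' hs)
    · rw [Function.update_of_ne (hne l hli)]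
      exact h.eq z hz hh l (((hS' l).1 hl).resolve_right hli)

/-- Instead of sorting, the program scans all variables once for every possible tag; this is cheap
because the number of tags will be at most `2 * n + 1`. At stage `(t, i)` the variables set are
those whose pair of tag and index is lexicographically smaller. -/
theorem tr_order {E n M : ℕ} {F : CNFFormula n} {g : Fin n → ℕ} {v : Fin n → Bool} {σ : RamState}
    {Q : RamState → Prop} (hE : 2 ≤ E) (hF : HasFormula F σ) (hM : σ.reg 3 = M)
    (hg : ∀ l : Fin n, σ.arr 8 l = g l) (hgM : ∀ l, g l < M)
    (hv : ∀ l : Fin n, σ.arr 9 l = (v l).toNat) (hinv : OrderInv F g v (fun _ => False) (σ.arr 3))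
    (h : ∀ σ', Frame orderProg σ σ' → OrderInv F g v (fun _ => True) (σ'.arr 3) → Q σ') :
    Tr E orderProg (M * (n * ((formulaCode F).length * 12 + 16) + 4) + 2) σ Q := by
  refine Tr.bdd fun hbd => ?_
  have hME : M < 2 ^ E := hM ▸ hbd.1 3
  have hnE : n < 2 ^ E := hF.vars ▸ hbd.1 0
  suffices H : Tr E orderProg
      (M * ((n * (((formulaCode F).length * 12 + 13 + 1) + 2) + 2) + 2) + 2) σ
      fun σ' => OrderInv F g v (fun _ => True) (σ'.arr 3) from
    H.frame.mono (le_of_eq (by ring)) fun σ' h' => h σ' h'.1 h'.2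
  refine tr_for (fun t σ' => OrderInv F g v (fun l => g l < t) (σ'.arr 3))
    (by simp [RamExpr.nodes]) trivial hME (by decide) ?_ ?_ ?_ ?_
  · intro σ' hf
    have := hf.1 3 (by decide)
    simpa [RamExpr.eval, hM] using this
  · exact hinv.congr (by simp)
  · intro t σ₁ ht hf₁ hbd₁ hr₁ hI₁
    refine tr_for (fun i σ' => OrderInv F g v (fun l => g l < t ∨ (g l = t ∧ (l : ℕ) < i))
      (σ'.arr 3)) (by simp [RamExpr.nodes]) trivial hnE (by decide) ?_ ?_ ?_ ?_
    · intro σ' hf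
      have := hf.1 0 (by decide)
      rw [hf₁.1 0 (by decide)] at this
      simpa [RamExpr.eval, hF.vars] using this
    · exact hI₁.congr (by simp)
    · intro i σ₂ hi hf₂ hbd₂ hr₂ hI₂
      have e21 : σ₂.reg 21 = t := (hf₂.1 21 (by decide)).trans hr₁
      have e8 : σ₂.arr 8 = σ.arr 8 := (hf₂.2 8 (by decide)).trans (hf₁.2 8 (by decide))
      have e9 : σ₂.arr 9 = σ.arr 9 := (hf₂.2 9 (by decide)).trans (hf₁.2 9 (by decide))
      have hg' := hg ⟨i, hi⟩
      have hv' := hv ⟨i, hi⟩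
      simp only at hg' hv'
      have hF₂ : HasFormula F σ₂ :=
        hF.congr ((hf₂.1 0 (by decide)).trans (hf₁.1 0 (by decide)))
        ((hf₂.1 1 (by decide)).trans (hf₁.1 1 (by decide)))
        ((hf₂.2 0 (by decide)).trans (hf₁.2 0 (by decide)))
        ((hf₂.2 1 (by decide)).trans (hf₁.2 1 (by decide)))
      refine tr_ite (RamExpr.small hE (by decide)) (fun hc => ?_) (fun hc => ?_)
      · simp only [RamExpr.eval, hr₂, e21, e8, hg'] at hc
        have hI₃ : OrderInv F g v (fun l => g l < t ∨ (g l = t ∧ (l : ℕ) < i + 1)) (σ₂.arr 3) := by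
          refine hI₂.congr fun l => ?_
          by_cases hl : (l : ℕ) = i
          · have : l = ⟨i, hi⟩ := Fin.ext hl
            subst this
            omega
          · omega
        exact (tr_skip (Q := fun σ' => OrderInv F g v
          (fun l => g l < t ∨ (g l = t ∧ (l : ℕ) < i + 1)) (σ'.arr 3)) hI₃).mono
          (by omega) fun _ h => h
      · simp only [RamExpr.eval, hr₂, e21, e8, hg'] at hc
        refine tr_set hE hF₂ hI₂.le_two hr₂ (coin := v ⟨i, hi⟩) (by rw [e9]; exact hv')
          fun σ₃ hf₃ h₃ => ?_
        rw [RamState.setReg_arr, h₃]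
        refine hI₂.set ⟨i, hi⟩ (fun l => ?_) (fun l hl => ?_)
        · by_cases hl : l = ⟨i, hi⟩
          · subst hl
            simp; omega
          · have : (l : ℕ) ≠ i := fun h => hl (Fin.ext h)
            simp only [hl, or_false]; omega
        · left; omega
    · intro σ₃ hf₃ hbd₃ hI₃
      exact hI₃.congr fun l => by simp; omega
  · intro σ' hf hbd' hI
    exact hI.congr fun l => by simp [hgM l]

/-! ### Recording solutions and repeating the rounds -/

/-- Append the assignment in array `3` to the list in array `5`. -/
def appendProg : RamProg :=
  .seq (forLoop 21 (.reg 0)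
    (.store 5 (.add (.reg 10) (.reg 21)) (.sub (.read 3 (.reg 21)) (.const 1)))) <|
  .seq (.assign 10 (.add (.reg 10) (.reg 0))) (.assign 9 (.add (.reg 9) (.const 1)))

/-- The memory contains the list `W` of assignments. -/
structure HasList {n : ℕ} (W : List (Fin n → Bool)) (σ : RamState) : Prop where
  length : σ.reg 9 = W.length
  pos : σ.reg 10 = W.length * n
  val : ∀ w (hw : w < W.length) (i : Fin n), σ.arr 5 (w * n + i) = (W[w] i).toNat

theorem tr_append {E n : ℕ} {z : Fin n → Bool} {W : List (Fin n → Bool)} {σ : RamState}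
    {Q : RamState → Prop} (hE : 2 ≤ E) (hn : σ.reg 0 = n) (hW : HasList W σ)
    (hz : ∀ l : Fin n, σ.arr 3 l = 1 + (z l).toNat) (hWE : (W.length + 1) * (n + 1) < 2 ^ E)
    (h : ∀ σ', Frame appendProg σ σ' → HasList (W ++ [z]) σ' → Q σ') :
    Tr E appendProg (n * 3 + 4) σ Q := by
  have hbW : (W.length + 1) * (n + 1) = W.length * n + n + W.length + 1 := by ring
  suffices H : Tr E appendProg ((n * (1 + 2) + 2) + (1 + 1)) σ fun σ' => HasList (W ++ [z]) σ' from
    H.frame.mono (by omega) fun σ' h' => h σ' h'.1 h'.2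
  refine tr_seq (tr_for (fun t σ' =>
    (∀ w (hw : w < W.length) (i : Fin n), σ'.arr 5 (w * n + i) = (W[w] i).toNat) ∧
    ∀ i : Fin n, (i : ℕ) < t → σ'.arr 5 (W.length * n + i) = (z i).toNat)
    (by simp [RamExpr.nodes]) trivial (by omega : n < 2 ^ E) (by decide) ?_ ?_ ?_ ?_)
  · intro σ' hf
    have := hf.1 0 (by decide)
    simpa [RamExpr.eval, hn] using this
  · exact ⟨hW.val, by simp⟩
  · rintro t σ₁ ht hf₁ hbd₁ hr₁ ⟨h1, h2⟩
    have e10 : σ₁.reg 10 = W.length * n := (hf₁.1 10 (by decide)).trans hW.pos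
    have e3 : σ₁.arr 3 = σ.arr 3 := hf₁.2 3 (by decide)
    have hzt := hz ⟨t, ht⟩
    have hzl := Bool.toNat_le (z ⟨t, ht⟩)
    simp only at hzt
    refine tr_store (RamExpr.small hE (by decide)) (RamExpr.small hE (by decide)) ?_ ?_
    · have : 4 ≤ 2 ^ E := Nat.pow_le_pow_right (n := 2) (by simp) hE
      simp only [RamExpr.eval, hr₁, e3, hzt]; omega
    · simp only [RamExpr.eval, hr₁, e3, hzt, e10, RamState.setReg_arr, RamState.setArr_arr,
        Function.update_self]
      refine ⟨fun w hw i => ?_, fun i hi => ?_⟩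
      · have : w * n + i ≠ W.length * n + t := by
          have : (w + 1) * n ≤ W.length * n := Nat.mul_le_mul_right _ hw
          rw [add_one_mul] at this
          have := i.2
          omega
        rw [Function.update_of_ne this, h1 w hw]
      · by_cases hit : (i : ℕ) = t
        · have : i = ⟨t, ht⟩ := Fin.ext hit
          subst this
          simp
        · rw [Function.update_of_ne (by omega), h2 i (by omega)]
  · rintro σ₁ hf₁ hbd₁ ⟨h1, h2⟩
    have e10 : σ₁.reg 10 = W.length * n := (hf₁.1 10 (by decide)).trans hW.pos
    have e9 : σ₁.reg 9 = W.length := (hf₁.1 9 (by decide)).trans hW.length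
    have e0 : σ₁.reg 0 = n := (hf₁.1 0 (by decide)).trans hn
    refine tr_seq (tr_assign (RamExpr.small hE (by decide)) ?_ ?_)
    · simp only [RamExpr.eval, e10, e0]; omega
    refine tr_assign (RamExpr.small hE (by decide)) ?_ ?_
    · simp [RamExpr.eval, e9]; omega
    · refine ⟨by simp [RamExpr.eval, e9], by simp [RamExpr.eval, e10, e0, add_one_mul],
        fun w hw i => ?_⟩
      simp only [RamState.setReg_arr]
      by_cases hwW : w < W.length
      · rw [h1 w hwW, List.getElem_append_left hwW]
      · have : w = W.length := by simp at hw; omega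
        subst this
        rw [h2 i i.2]
        simp

/-- One round of the random search. -/
def trialProg : RamProg :=
  .seq readProg <| .seq orderProg <| .seq checkProg <| .ite (.reg 32) .skip appendProg

/-- The tags read from the tape `τ` at position `c`. -/
def tapeTags {n : ℕ} (τ : ℕ → Bool) (b c : ℕ) (i : Fin n) : ℕ := tagOf τ (c + i * (b + 1)) b

/-- The coins read from the tape `τ` at position `c`. -/
def tapeCoins {n : ℕ} (τ : ℕ → Bool) (b c : ℕ) (i : Fin n) : Bool := τ (c + i * (b + 1) + b)

theorem not_falsified_iff {n : ℕ} (F : CNFFormula n) (z : Fin n → Bool) (val : ℕ → ℕ)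
    (hz : ∀ l : Fin n, val l = 1 + (z l).toNat) : ¬ Falsified F val ↔ Satisfies F z := by
  unfold Falsified Satisfies
  push Not
  refine forall₂_congr fun C _ => exists_congr fun l => and_congr_right fun _ => ?_
  rw [hz]
  cases z l.1 <;> cases l.2 <;> simp

/-- A round ends with a total assignment `zv`, and every solution that is hit equals it. So if the
final check fails, no solution was hit and nothing has to be appended. -/
theorem tr_trial {E n b c : ℕ} {F : CNFFormula n} {τ : ℕ → Bool} {W : List (Fin n → Bool)}
    {σ : RamState} {Q : RamState → Prop} (hE : 2 ≤ E) (hF : HasFormula F σ)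
    (hM : σ.reg 3 = 2 ^ b) (hb : σ.reg 4 = b) (hc : σ.reg 8 = c)
    (hτ : ∀ i, σ.arr 4 i = (τ i).toNat) (hval : ∀ i, σ.arr 3 i ≤ 2) (hW : HasList W σ)
    (hcE : c + n * (b + 1) < 2 ^ E) (hWE : (W.length + 1) * (n + 1) < 2 ^ E)
    (h : ∀ σ' W', Frame trialProg σ σ' → σ'.reg 8 = c + n * (b + 1) → (∀ i, σ'.arr 3 i ≤ 2) →
      HasList W' σ' → (W' = W ∨ ∃ z, Satisfies F z ∧ W' = W ++ [z]) →
      (∀ z, Satisfies F z → Hit F z (tapeTags τ b c) (tapeCoins τ b c) → z ∈ W') → Q σ') :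
    Tr E trialProg (n * (b * 4 + 9) + 2 ^ b * (n * ((formulaCode F).length * 12 + 16) + 4) +
      (formulaCode F).length * 6 + n * 3 + 13) σ Q := by
  refine Tr.bdd fun hbd => ?_
  have hbE : 2 ^ b < 2 ^ E := hM ▸ hbd.1 3
  suffices H : Tr E trialProg ((n * (b * 4 + 9) + 2) +
      ((2 ^ b * (n * ((formulaCode F).length * 12 + 16) + 4) + 2) +
        (((formulaCode F).length * 6 + 4) + ((n * 3 + 4) + 1)))) σ fun σ' => ∃ W',
      σ'.reg 8 = c + n * (b + 1) ∧ (∀ i, σ'.arr 3 i ≤ 2) ∧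
      HasList W' σ' ∧ (W' = W ∨ ∃ z, Satisfies F z ∧ W' = W ++ [z]) ∧
      (∀ z, Satisfies F z → Hit F z (tapeTags τ b c) (tapeCoins τ b c) → z ∈ W') by
    refine H.frame.mono (by omega) ?_
    rintro σ' ⟨hf, W', h1, h2, h3, h4, h5⟩
    exact h σ' W' hf h1 h2 h3 h4 h5
  refine tr_seq (tr_read hE hF.vars hb hc hτ hval hcE hbE fun σ₁ hf₁ h8 ha8 ha9 ha3 ha3' => ?_)
  have hF₁ : HasFormula F σ₁ := hF.congr (hf₁.1 0 (by decide)) (hf₁.1 1 (by decide))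
    (hf₁.2 0 (by decide)) (hf₁.2 1 (by decide))
  refine tr_seq (tr_order (g := tapeTags τ b c) (v := tapeCoins τ b c) hE hF₁
    ((hf₁.1 3 (by decide)).trans hM) (fun l => ha8 l l.2) (fun l => tagOf_lt _ _ _)
    (fun l => ha9 l l.2) ⟨ha3', by simp, fun l _ => ha3 l l.2, by simp⟩ fun σ₂ hf₂ h₂ => ?_)
  have hF₂ : HasFormula F σ₂ := hF₁.congr (hf₂.1 0 (by decide)) (hf₂.1 1 (by decide))
    (hf₂.2 0 (by decide)) (hf₂.2 1 (by decide))
  refine tr_seq (tr_check hE hF₂ h₂.le_two fun σ₃ hf₃ h₃ => ?_)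
  have a3 : σ₃.arr 3 = σ₂.arr 3 := hf₃.2 3 (by decide)
  have e8 : σ₃.reg 8 = c + n * (b + 1) :=
    (hf₃.1 8 (by decide)).trans ((hf₂.1 8 (by decide)).trans h8)
  let zv : Fin n → Bool := fun l => decide (σ₂.arr 3 l = 2)
  have hzv : ∀ l : Fin n, σ₂.arr 3 l = 1 + (zv l).toNat := by
    intro l
    have h1 := h₂.pos l trivial
    have h2 := h₂.le_two l
    by_cases hl : σ₂.arr 3 l = 2
    · simp [zv, hl]
    · simp only [zv, hl, decide_false, Bool.toNat_false]; omega
  have hsat := not_falsified_iff F zv _ hzv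
  have huniq : ∀ z, Satisfies F z → Hit F z (tapeTags τ b c) (tapeCoins τ b c) → z = zv := by
    intro z hz hh
    funext l
    have := (h₂.eq z hz hh l trivial).symm.trans (hzv l)
    cases h1 : z l <;> cases h2 : zv l <;> simp_all
  have hW₃ : HasList W σ₃ := by
    refine ⟨?_, ?_, fun w hw i => ?_⟩
    · rw [hf₃.1 9 (by decide), hf₂.1 9 (by decide), hf₁.1 9 (by decide), hW.length]
    · rw [hf₃.1 10 (by decide), hf₂.1 10 (by decide), hf₁.1 10 (by decide), hW.pos]
    · rw [hf₃.2 5 (by decide), hf₂.2 5 (by decide), hf₁.2 5 (by decide), hW.val]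
  refine tr_ite (RamExpr.small hE (by decide)) (fun hcond => ?_) (fun hcond => ?_)
  · refine (tr_skip ?_).mono (by omega : 1 ≤ _) fun _ h => h
    refine ⟨W, e8, by rw [a3]; exact h₂.le_two, hW₃, Or.inl rfl, fun z hz hh => ?_⟩
    have := huniq z hz hh
    subst this
    exact absurd (h₃.1 hcond) (hsat.2 hz)
  · have hs : Satisfies F zv := hsat.1 fun hfal => h₃.2 hfal hcond
    refine tr_append (z := zv) hE (hF₂.congr (hf₃.1 0 (by decide)) (hf₃.1 1 (by decide))
      (hf₃.2 0 (by decide)) (hf₃.2 1 (by decide))).vars hW₃ (by rw [a3]; exact hzv) hWE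
      fun σ₄ hf₄ h₄ => ?_
    refine ⟨W ++ [zv], (hf₄.1 8 (by decide)).trans e8, ?_, h₄, Or.inr ⟨zv, hs, rfl⟩,
      fun z hz hh => ?_⟩
    · rw [hf₄.2 3 (by decide), a3]; exact h₂.le_two
    · rw [huniq z hz hh]; simp

/-- The random search. -/
def searchProg : RamProg :=
  .seq (.assign 8 (.const 0)) <| .seq (.assign 9 (.const 0)) <| .seq (.assign 10 (.const 0)) <|
  forLoop 20 (.reg 6) trialProg

/-- The list `W` consists of solutions, and it contains all those that are hit in one of `T` rounds
with the tape `τ`. -/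
structure SearchResult {n : ℕ} (F : CNFFormula n) (τ : ℕ → Bool) (b T : ℕ)
    (W : List (Fin n → Bool)) : Prop where
  length_le : W.length ≤ T
  sat : ∀ z ∈ W, Satisfies F z
  complete : ∀ z, Satisfies F z → ∀ t < T,
    Hit F z (tapeTags τ b (t * (n * (b + 1)))) (tapeCoins τ b (t * (n * (b + 1)))) → z ∈ W

/-- The number of operations of one round of the random search. -/
def trialOps (n L b : ℕ) : ℕ :=
  n * (b * 4 + 9) + 2 ^ b * (n * (L * 12 + 16) + 4) + L * 6 + n * 3 + 13

theorem tr_search {E n b T : ℕ} {F : CNFFormula n} {τ : ℕ → Bool} {σ : RamState}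
    {Q : RamState → Prop} (hE : 2 ≤ E) (hF : HasFormula F σ) (hM : σ.reg 3 = 2 ^ b)
    (hb : σ.reg 4 = b) (hT : σ.reg 6 = T) (hτ : ∀ i, σ.arr 4 i = (τ i).toNat)
    (hval : ∀ i, σ.arr 3 i ≤ 2) (hTE : T * (n * (b + 1)) < 2 ^ E) (hWE : T * (n + 1) < 2 ^ E)
    (h : ∀ σ' W, Frame searchProg σ σ' → HasList W σ' → SearchResult F τ b T W → Q σ') :
    Tr E searchProg (T * (trialOps n (formulaCode F).length b + 2) + 5) σ Q := by
  refine Tr.bdd fun hbd => ?_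
  have hTE' : T < 2 ^ E := hT ▸ hbd.1 6
  have hpos : 0 < 2 ^ E := by positivity
  suffices H : Tr E searchProg
      (1 + (1 + (1 + (T * (trialOps n (formulaCode F).length b + 2) + 2)))) σ
      fun σ' => ∃ W, HasList W σ' ∧ SearchResult F τ b T W by
    refine H.frame.mono (by omega) ?_
    rintro σ' ⟨hf, W, h1, h2⟩
    exact h σ' W hf h1 h2
  refine tr_seq (tr_assign (RamExpr.small hE (by decide)) hpos ?_)
  refine tr_seq (tr_assign (RamExpr.small hE (by decide)) hpos ?_)
  refine tr_seq (tr_assign (RamExpr.small hE (by decide)) hpos ?_)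
  generalize hσ : RamState.setReg _ 10 _ = σ₀
  have e : ∀ r, r ≠ 8 → r ≠ 9 → r ≠ 10 → σ₀.reg r = σ.reg r := by
    intro r h8 h9 h10
    simp [← hσ, h8, h9, h10]
  have ea : σ₀.arr = σ.arr := by simp [← hσ]
  have e8 : σ₀.reg 8 = 0 := by simp [← hσ, RamExpr.eval]
  have e9 : σ₀.reg 9 = 0 := by simp [← hσ, RamExpr.eval]
  have e10 : σ₀.reg 10 = 0 := by simp [← hσ, RamExpr.eval]
  clear hσ
  refine tr_for (fun t σ' => σ'.reg 8 = t * (n * (b + 1)) ∧ (∀ i, σ'.arr 3 i ≤ 2) ∧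
    ∃ W, HasList W σ' ∧ SearchResult F τ b t W) (by simp [RamExpr.nodes]) trivial hTE'
    (by decide) ?_ ?_ ?_ ?_
  · intro σ' hf
    have := hf.1 6 (by decide)
    rw [e 6 (by decide) (by decide) (by decide), hT] at this
    exact this
  · refine ⟨by simp [e8], by simpa [ea] using hval, [], ⟨by simp [e9], by simp [e10], by simp⟩,
      ⟨by simp, by simp, by simp⟩⟩
  · rintro t σ₁ ht hf₁ hbd₁ hr₁ ⟨h8, h3, W, hW, hres⟩
    have hr : ∀ r, r ∉ (forLoop 20 (.reg 6) trialProg).regs → σ₁.reg r = σ.reg r := by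
      intro r hr
      have h1 := hf₁.1 r hr
      rw [h1, e r] <;> rintro rfl <;> exact hr (by decide)
    have ha : ∀ a, a ∉ (forLoop 20 (.reg 6) trialProg).arrs → σ₁.arr a = σ.arr a := by
      intro a ha
      rw [hf₁.2 a ha, ea]
    have hmul : t * (n * (b + 1)) + n * (b + 1) = (t + 1) * (n * (b + 1)) := by ring
    have hle : (t + 1) * (n * (b + 1)) ≤ T * (n * (b + 1)) := Nat.mul_le_mul_right _ ht
    have hle' : (W.length + 1) * (n + 1) ≤ T * (n + 1) :=
      Nat.mul_le_mul_right _ (by have := hres.length_le; omega)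
    refine tr_trial hE (hF.congr (hr 0 (by decide)) (hr 1 (by decide)) (ha 0 (by decide))
      (ha 1 (by decide))) ((hr 3 (by decide)).trans hM) ((hr 4 (by decide)).trans hb) h8
      (by rw [ha 4 (by decide)]; exact hτ) h3 hW (by omega) (by omega)
      fun σ₂ W' hf₂ h8' h3' hW' hor hhit => ?_
    refine ⟨by simpa [hmul] using h8', by simpa using h3', W', ⟨by simpa using hW'.length,
      by simpa using hW'.pos, by simpa using hW'.val⟩, ?_, ?_, ?_⟩
    · have := hres.length_le
      rcases hor with rfl | ⟨z, -, rfl⟩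
      · omega
      · simp; omega
    · rcases hor with rfl | ⟨z, hz, rfl⟩
      · exact hres.sat
      · intro y hy
        rcases List.mem_append.1 hy with hy | hy
        · exact hres.sat y hy
        · rw [List.mem_singleton.1 hy]; exact hz
    · intro z hz t' ht' hh
      by_cases htt : t' = t
      · subst htt; exact hhit z hz hh
      · have hm : z ∈ W := hres.complete z hz t' (by omega) hh
        rcases hor with rfl | ⟨y, -, rfl⟩
        · exact hm
        · exact List.mem_append_left _ hm
  · rintro σ' hf hbd' ⟨-, -, W, hW, hres⟩
    exact ⟨W, hW, hres⟩

/-! ### Dispersion of finite sequences of assignments -/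

/-- The sum of the distances between `w` and `X 0, …, X (m - 1)`. -/
def farness {n : ℕ} (X : ℕ → Fin n → Bool) (m : ℕ) (w : Fin n → Bool) : ℕ :=
  ∑ j ∈ Finset.range m, hammingDist w (X j)

/-- The sum of the distances between `X 0, …, X (m - 1)`, every pair being counted twice. -/
def dispersion {n : ℕ} (X : ℕ → Fin n → Bool) (m : ℕ) : ℕ :=
  ∑ j ∈ Finset.range m, farness X m (X j)

/-- Replacing `X j` by `w` increases the dispersion. -/
def Improves {n : ℕ} (X : ℕ → Fin n → Bool) (m : ℕ) (w : Fin n → Bool) (j : ℕ) : Prop :=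
  farness X m (X j) + hammingDist w (X j) < farness X m w

/-- The number of ones among the `i`-th bits of `X 0, …, X (m - 1)`. -/
def onesCount {n : ℕ} (X : ℕ → Fin n → Bool) (m : ℕ) (i : Fin n) : ℕ :=
  ∑ j ∈ Finset.range m, (X j i).toNat

theorem onesCount_le {n : ℕ} (X : ℕ → Fin n → Bool) (m : ℕ) (i : Fin n) : onesCount X m i ≤ m := by
  calc onesCount X m i ≤ ∑ j ∈ Finset.range m, 1 := Finset.sum_le_sum fun j _ => Bool.toNat_le _
    _ = m := by simp

theorem hammingDist_eq_sum {n : ℕ} (w x : Fin n → Bool) :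
    hammingDist w x = ∑ i, if w i = x i then 0 else 1 := by
  simp only [hammingDist, Finset.card_filter]
  exact Finset.sum_congr rfl fun i _ => by by_cases h : w i = x i <;> simp [h]

/-- Only the number of ones in each coordinate matters. Keeping these counts in array 7 makes the
test of an exchange linear in `n`, independently of the number of centers. -/
theorem farness_eq {n : ℕ} (X : ℕ → Fin n → Bool) (m : ℕ) (w : Fin n → Bool) :
    farness X m w = ∑ i, if w i then m - onesCount X m i else onesCount X m i := by
  simp only [farness, hammingDist_eq_sum]
  rw [Finset.sum_comm]
  refine Finset.sum_congr rfl fun i _ => ?_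
  cases h : w i
  · simp only [onesCount]
    exact Finset.sum_congr rfl fun j _ => by cases X j i <;> rfl
  · simp only [if_true]
    have : (∑ j ∈ Finset.range m, if true = X j i then 0 else 1) + onesCount X m i = m := by
      rw [onesCount, ← Finset.sum_add_distrib]
      calc _ = ∑ j ∈ Finset.range m, 1 :=
            Finset.sum_congr rfl fun j _ => by cases X j i <;> rfl
        _ = m := by simp
    omega

theorem farness_update {n : ℕ} (X : ℕ → Fin n → Bool) {m j : ℕ} (hj : j < m)
    (w y : Fin n → Bool) : farness (Function.update X j w) m y + hammingDist y (X j) =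
      farness X m y + hammingDist y w := by
  have hm := Finset.mem_range.2 hj
  simp only [farness]
  rw [← Finset.add_sum_erase _ _ hm, ← Finset.add_sum_erase (a := j) _ (fun j => hammingDist y (X j)) hm]
  have : ∑ a ∈ (Finset.range m).erase j, hammingDist y (Function.update X j w a) =
      ∑ a ∈ (Finset.range m).erase j, hammingDist y (X a) :=
    Finset.sum_congr rfl fun a ha => by rw [Function.update_of_ne (Finset.ne_of_mem_erase ha)]
  rw [this, Function.update_self]
  ring

/-- Every pair is counted twice, whence the factor `2`. The distance between `w` and the discarded
`X j` must not be credited to `w`, which explains the form of `Improves`. -/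
theorem dispersion_update {n : ℕ} (X : ℕ → Fin n → Bool) {m j : ℕ} (hj : j < m)
    (w : Fin n → Bool) : dispersion (Function.update X j w) m + 2 * (farness X m (X j) +
      hammingDist w (X j)) = dispersion X m + 2 * farness X m w := by
  have hm := Finset.mem_range.2 hj
  have h1 : ∑ a ∈ (Finset.range m).erase j,
        (farness (Function.update X j w) m (X a) + hammingDist (X a) (X j)) =
      ∑ a ∈ (Finset.range m).erase j, (farness X m (X a) + hammingDist (X a) w) :=
    Finset.sum_congr rfl fun a _ => farness_update X hj w _
  have h2 := farness_update X hj w w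
  have h3 : farness X m (X j) = ∑ a ∈ (Finset.range m).erase j, hammingDist (X a) (X j) := by
    rw [farness, ← Finset.add_sum_erase _ _ hm, hammingDist_self, zero_add]
    exact Finset.sum_congr rfl fun a _ => hammingDist_comm _ _
  have h4 : farness X m w = hammingDist w (X j) +
      ∑ a ∈ (Finset.range m).erase j, hammingDist (X a) w := by
    rw [farness, ← Finset.add_sum_erase _ _ hm]
    congr 1
    exact Finset.sum_congr rfl fun a _ => hammingDist_comm _ _
  have h5 : dispersion (Function.update X j w) m = farness (Function.update X j w) m w +
      ∑ a ∈ (Finset.range m).erase j, farness (Function.update X j w) m (X a) := by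
    rw [dispersion, ← Finset.add_sum_erase _ _ hm, Function.update_self]
    congr 1
    exact Finset.sum_congr rfl fun a ha => by
      rw [Function.update_of_ne (Finset.ne_of_mem_erase ha)]
  have h6 : dispersion X m = farness X m (X j) +
      ∑ a ∈ (Finset.range m).erase j, farness X m (X a) := by
    rw [dispersion, ← Finset.add_sum_erase _ _ hm]
  rw [Finset.sum_add_distrib, Finset.sum_add_distrib] at h1
  rw [hammingDist_self, add_zero] at h2
  omega

theorem Improves.dispersion_lt {n : ℕ} {X : ℕ → Fin n → Bool} {m j : ℕ} {w : Fin n → Bool}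
    (h : Improves X m w j) (hj : j < m) : dispersion X m < dispersion (Function.update X j w) m := by
  have := dispersion_update X hj w
  unfold Improves at h
  omega

theorem farness_le {n : ℕ} (X : ℕ → Fin n → Bool) (m : ℕ) (w : Fin n → Bool) :
    farness X m w ≤ m * n := by
  calc farness X m w ≤ ∑ j ∈ Finset.range m, n :=
        Finset.sum_le_sum fun j _ => hammingDist_le_card_fintype.trans (by simp)
    _ = m * n := by simp

theorem dispersion_le {n : ℕ} (X : ℕ → Fin n → Bool) (m : ℕ) : dispersion X m ≤ m * m * n := by
  calc dispersion X m ≤ ∑ j ∈ Finset.range m, m * n :=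
        Finset.sum_le_sum fun j _ => farness_le _ _ _
    _ = m * m * n := by simp [mul_assoc]

theorem onesCount_update {n : ℕ} (X : ℕ → Fin n → Bool) {m j : ℕ} (hj : j < m)
    (w : Fin n → Bool) (i : Fin n) : onesCount (Function.update X j w) m i =
      onesCount X m i + (w i).toNat - (X j i).toNat := by
  have hm := Finset.mem_range.2 hj
  simp only [onesCount]
  rw [← Finset.add_sum_erase _ _ hm, ← Finset.add_sum_erase (a := j) _ (fun j => (X j i).toNat) hm]
  have : ∑ a ∈ (Finset.range m).erase j, (Function.update X j w a i).toNat =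
      ∑ a ∈ (Finset.range m).erase j, (X a i).toNat :=
    Finset.sum_congr rfl fun a ha => by rw [Function.update_of_ne (Finset.ne_of_mem_erase ha)]
  rw [this, Function.update_self]
  omega

/-! ### Local search -/

/-- The memory contains the centers `X 0, …, X (m - 1)`. -/
structure HasCenters {n : ℕ} (X : ℕ → Fin n → Bool) (m : ℕ) (σ : RamState) : Prop where
  val : ∀ j < m, ∀ i : Fin n, σ.arr 6 (j * n + i) = (X j i).toNat
  count : ∀ i : Fin n, σ.arr 7 i = onesCount X m i

theorem HasCenters.congr {n m : ℕ} {X : ℕ → Fin n → Bool} {σ σ' : RamState}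
    (h : HasCenters X m σ) (h6 : σ'.arr 6 = σ.arr 6) (h7 : σ'.arr 7 = σ.arr 7) :
    HasCenters X m σ' :=
  ⟨by rw [h6]; exact h.val, by rw [h7]; exact h.count⟩

theorem tr_seq_mid {E N₁ N₂ : ℕ} {p q : RamProg} {σ : RamState} {Q : RamState → Prop}
    {R : RamState → Prop} (h : Tr E p N₁ σ R) (h' : ∀ σ', R σ' → Tr E q N₂ σ' Q) :
    Tr E (.seq p q) (N₁ + N₂) σ Q :=
  tr_seq (h.mono le_rfl h')

/-- Compare a listed assignment with a center. -/
def gainProg : RamProg :=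
  .seq (.assign 37 (.const 0)) <| .seq (.assign 38 (.const 0)) <| forLoop 23 (.reg 0) <|
  .seq (.assign 39 (.read 5 (.add (.reg 36) (.reg 23)))) <|
  .seq (.assign 40 (.read 6 (.add (.reg 35) (.reg 23)))) <|
  .seq (.assign 41 (.read 7 (.reg 23))) <|
  .seq (.ite (.reg 39) (.assign 37 (.add (.reg 37) (.sub (.reg 11) (.reg 41))))
    (.assign 37 (.add (.reg 37) (.reg 41)))) <|
  .seq (.ite (.reg 40) (.assign 38 (.add (.reg 38) (.sub (.reg 11) (.reg 41))))
    (.assign 38 (.add (.reg 38) (.reg 41)))) <|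
  .assign 38 (.add (.reg 38) (.add (.sub (.reg 39) (.reg 40)) (.sub (.reg 40) (.reg 39))))

theorem tr_gain {E n m j : ℕ} {w : Fin n → Bool} {X : ℕ → Fin n → Bool} {σ : RamState}
    {Q : RamState → Prop} (hE : 2 ≤ E) (hn : σ.reg 0 = n) (hm : σ.reg 11 = m) (hj : j < m)
    (hp : ∀ i : Fin n, σ.arr 5 (σ.reg 36 + i) = (w i).toNat) (h35 : σ.reg 35 = j * n)
    (hX : HasCenters X m σ) (hmE : (m + 1) * n < 2 ^ E)
    (h : ∀ σ', Frame gainProg σ σ' → σ'.reg 37 = farness X m w →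
      σ'.reg 38 = farness X m (X j) + hammingDist w (X j) → Q σ') :
    Tr E gainProg (n * 10 + 4) σ Q := by
  refine Tr.bdd fun hbd => ?_
  have hnE : n < 2 ^ E := hn ▸ hbd.1 0
  have h4E : 4 ≤ 2 ^ E := Nat.pow_le_pow_right (n := 2) (by simp) hE
  have hpos : 0 < 2 ^ E := by positivity
  set f : Fin n → ℕ := fun i => if w i then m - onesCount X m i else onesCount X m i with hf
  set g : Fin n → ℕ := fun i => (if X j i then m - onesCount X m i else onesCount X m i) +
    (if w i = X j i then 0 else 1) with hg
  have hfm : ∀ i, f i ≤ m := fun i => by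
    have := onesCount_le X m i
    simp only [hf]; split_ifs <;> omega
  have hgm : ∀ i, g i ≤ m + 1 := fun i => by
    have := onesCount_le X m i
    simp only [hg]; split_ifs <;> omega
  -- The summands are extended by `0` to all natural numbers, so that the loop invariant can speak
  -- of partial sums over `Finset.range t`.
  let F : ℕ → ℕ := fun i => if h : i < n then f ⟨i, h⟩ else 0
  let G : ℕ → ℕ := fun i => if h : i < n then g ⟨i, h⟩ else 0
  have hF : ∀ i (h : i < n), F i = f ⟨i, h⟩ := fun i h => by simp [F, h]
  have hG : ∀ i (h : i < n), G i = g ⟨i, h⟩ := fun i h => by simp [G, h]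
  have hFs : ∑ i ∈ Finset.range n, F i = farness X m w := by
    rw [← Fin.sum_univ_eq_sum_range, farness_eq]
    exact Finset.sum_congr rfl fun i _ => by rw [hF i i.2]
  have hGs : ∑ i ∈ Finset.range n, G i = farness X m (X j) + hammingDist w (X j) := by
    rw [← Fin.sum_univ_eq_sum_range, farness_eq, hammingDist_eq_sum, ← Finset.sum_add_distrib]
    exact Finset.sum_congr rfl fun i _ => by rw [hG i i.2]
  have hle : ∀ (H : ℕ → ℕ), (∀ i < n, H i ≤ m + 1) → ∀ t ≤ n,
      ∑ i ∈ Finset.range t, H i < 2 ^ E := by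
    intro H hH t ht
    refine lt_of_le_of_lt ?_ hmE
    calc _ ≤ ∑ i ∈ Finset.range t, (m + 1) :=
          Finset.sum_le_sum fun i hi => hH i (by have := Finset.mem_range.1 hi; omega)
      _ = t * (m + 1) := by simp
      _ ≤ (m + 1) * n := by rw [mul_comm]; exact Nat.mul_le_mul_left _ ht
  have hFle := hle F fun i hi => by rw [hF i hi]; exact (hfm _).trans (by omega)
  have hGle := hle G fun i hi => by rw [hG i hi]; exact hgm _
  suffices H : Tr E gainProg (1 + (1 + (n * ((1 + (1 + (1 + ((1 + 1) + ((1 + 1) + 1))))) + 2) + 2)))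
      σ fun σ' => σ'.reg 37 = farness X m w ∧
        σ'.reg 38 = farness X m (X j) + hammingDist w (X j) from
    H.frame.mono (by omega) fun σ' h' => h σ' h'.1 h'.2.1 h'.2.2
  refine tr_seq (tr_assign (RamExpr.small hE (by decide)) hpos ?_)
  refine tr_seq (tr_assign (RamExpr.small hE (by decide)) hpos ?_)
  refine tr_for (fun t σ' => σ'.reg 37 = ∑ i ∈ Finset.range t, F i ∧
    σ'.reg 38 = ∑ i ∈ Finset.range t, G i) (by simp [RamExpr.nodes]) trivial hnE
    (by decide) ?_ ?_ ?_ ?_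
  · intro σ' hf
    have := hf.1 0 (by decide)
    simpa [RamExpr.eval, hn] using this
  · simp [RamExpr.eval]
  · rintro t σ₁ ht hf₁ hbd₁ hr₁ ⟨h37, h38⟩
    have e36 : σ₁.reg 36 = σ.reg 36 := by rw [hf₁.1 36 (by decide)]; simp
    have e35 : σ₁.reg 35 = j * n := by rw [hf₁.1 35 (by decide)]; simpa using h35
    have e11 : σ₁.reg 11 = m := by rw [hf₁.1 11 (by decide)]; simpa using hm
    have a5 : σ₁.arr 5 = σ.arr 5 := hf₁.2 5 (by decide)
    have a6 : σ₁.arr 6 = σ.arr 6 := hf₁.2 6 (by decide)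
    have a7 : σ₁.arr 7 = σ.arr 7 := hf₁.2 7 (by decide)
    have h5 := hp ⟨t, ht⟩
    have h6 := hX.val j hj ⟨t, ht⟩
    have h7 := hX.count ⟨t, ht⟩
    simp only at h5 h6 h7
    have hFt := hFle (t + 1) (by omega)
    have hGt := hGle (t + 1) (by omega)
    rw [Finset.sum_range_succ, hF t ht] at hFt
    rw [Finset.sum_range_succ, hG t ht] at hGt
    rw [Finset.sum_range_succ, Finset.sum_range_succ, hF t ht, hG t ht,
      show f ⟨t, ht⟩ = if w ⟨t, ht⟩ then m - onesCount X m ⟨t, ht⟩ else onesCount X m ⟨t, ht⟩ from rfl,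
      show g ⟨t, ht⟩ = (if X j ⟨t, ht⟩ then m - onesCount X m ⟨t, ht⟩ else onesCount X m ⟨t, ht⟩) +
        (if w ⟨t, ht⟩ = X j ⟨t, ht⟩ then 0 else 1) from rfl]
    generalize ∑ i ∈ Finset.range t, F i = A at *
    generalize ∑ i ∈ Finset.range t, G i = B at *
    simp only [hf, hg] at hFt hGt
    have hc := onesCount_le X m ⟨t, ht⟩
    have hmm : m < 2 ^ E := hm ▸ hbd.1 11
    generalize onesCount X m ⟨t, ht⟩ = cc at *
    generalize w ⟨t, ht⟩ = u at *
    generalize X j ⟨t, ht⟩ = v at *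
    have hu := Bool.toNat_le u
    have hv := Bool.toNat_le v
    refine tr_seq (N₁ := 1) (N₂ := 7) (tr_assign (RamExpr.small hE (by decide)) ?_ ?_)
    · simp only [RamExpr.eval, hr₁, e36, a5, h5]; omega
    refine tr_seq (N₁ := 1) (N₂ := 6) (tr_assign (RamExpr.small hE (by decide)) ?_ ?_)
    · simp [RamExpr.eval, hr₁, e35, a6, h6]; omega
    refine tr_seq (N₁ := 1) (N₂ := 5) (tr_assign (RamExpr.small hE (by decide)) ?_ ?_)
    · simp [RamExpr.eval, hr₁, a7, h7]; omega
    refine tr_seq_mid (N₁ := 1 + 1) (N₂ := 3) (R := fun σ' => σ'.reg 37 = A + (if u then m - cc else cc) ∧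
      σ'.reg 38 = B ∧ σ'.reg 39 = u.toNat ∧ σ'.reg 40 = v.toNat ∧ σ'.reg 41 = cc ∧ σ'.reg 11 = m)
      (tr_ite (e := .reg 39) (RamExpr.small hE (by decide)) (fun hc1 => ?_) (fun hc1 => ?_)) ?_
    · simp [RamExpr.eval, hr₁, e36, a5, h5] at hc1
      refine tr_assign (RamExpr.small hE (by decide)) ?_ ?_
      · simp [RamExpr.eval, hr₁, a7, h7, h37, e11, e36, a5, h5]
        cases u <;> simp_all
      · simp [RamExpr.eval, hr₁, a7, h7, h37, e11, h38, e35, a6, h6, e36, a5, h5]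
        cases u <;> simp_all
    · simp [RamExpr.eval, hr₁, e36, a5, h5] at hc1
      refine tr_assign (RamExpr.small hE (by decide)) ?_ ?_
      · simp [RamExpr.eval, hr₁, a7, h7, h37, e36, a5, h5]
        cases u <;> simp_all
      · simp [RamExpr.eval, hr₁, a7, h7, h37, e11, h38, e35, a6, h6, e36, a5, h5]
        cases u <;> simp_all
    rintro σ₂ ⟨k37, k38, k39, k40, k41, k11⟩
    refine tr_seq_mid (N₁ := 1 + 1) (N₂ := 1) (R := fun σ' => σ'.reg 37 = A + (if u then m - cc else cc) ∧
      σ'.reg 38 = B + (if v then m - cc else cc) ∧ σ'.reg 39 = u.toNat ∧ σ'.reg 40 = v.toNat)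
      (tr_ite (e := .reg 40) (RamExpr.small hE (by decide)) (fun hc1 => ?_) (fun hc1 => ?_)) ?_
    · simp [RamExpr.eval, k40] at hc1
      subst hc1
      refine tr_assign (RamExpr.small hE (by decide)) ?_ ?_
      · simp only [RamExpr.eval, k38, k11, k41, if_true] at hGt ⊢; omega
      · simp [RamExpr.eval, k37, k38, k39, k40, k41, k11]
    · simp [RamExpr.eval, k40] at hc1
      subst hc1
      refine tr_assign (RamExpr.small hE (by decide)) ?_ ?_
      · simp only [RamExpr.eval, k38, k41, Bool.false_eq_true, if_false] at hGt ⊢; omega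
      · simp [RamExpr.eval, k37, k38, k39, k40, k41]
    rintro σ₃ ⟨l37, l38, l39, l40⟩
    have huv : (u.toNat - v.toNat) + (v.toNat - u.toNat) = if u = v then 0 else 1 := by
      cases u <;> cases v <;> rfl
    refine tr_assign (RamExpr.small hE (by decide)) ?_ ?_
    · simp only [RamExpr.eval, l38, l39, l40, huv]; omega
    · simp only [RamExpr.eval, l38, l39, l40, huv, RamState.setReg_reg]
      refine ⟨by simpa using l37, ?_⟩
      simp [add_assoc]
  · rintro σ' hf hbd' ⟨h1, h2⟩
    exact ⟨h1.trans hFs, h2.trans hGs⟩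

/-- Replace a center by a listed assignment. -/
def swapProg : RamProg :=
  forLoop 23 (.reg 0) <|
  .seq (.store 7 (.reg 23) (.sub (.add (.read 7 (.reg 23)) (.read 5 (.add (.reg 36) (.reg 23))))
    (.read 6 (.add (.reg 35) (.reg 23))))) <|
  .store 6 (.add (.reg 35) (.reg 23)) (.read 5 (.add (.reg 36) (.reg 23)))

theorem tr_swap {E n m j : ℕ} {w : Fin n → Bool} {X : ℕ → Fin n → Bool} {σ : RamState}
    {Q : RamState → Prop} (hE : 2 ≤ E) (hn : σ.reg 0 = n) (hm : m < 2 ^ E) (hj : j < m)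
    (hp : ∀ i : Fin n, σ.arr 5 (σ.reg 36 + i) = (w i).toNat) (h35 : σ.reg 35 = j * n)
    (hX : HasCenters X m σ)
    (h : ∀ σ', Frame swapProg σ σ' → HasCenters (Function.update X j w) m σ' → Q σ') :
    Tr E swapProg (n * 4 + 2) σ Q := by
  refine Tr.bdd fun hbd => ?_
  have hnE : n < 2 ^ E := hn ▸ hbd.1 0
  suffices H : Tr E swapProg (n * ((1 + 1) + 2) + 2)
      σ fun σ' => HasCenters (Function.update X j w) m σ' from
    H.frame.mono (by omega) fun σ' h' => h σ' h'.1 h'.2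
  refine tr_for (fun t σ' => (∀ a < m, ∀ i : Fin n, σ'.arr 6 (a * n + i) =
      if a = j ∧ (i : ℕ) < t then (w i).toNat else (X a i).toNat) ∧
    ∀ i : Fin n, σ'.arr 7 i = if (i : ℕ) < t then onesCount (Function.update X j w) m i
      else onesCount X m i) (by simp [RamExpr.nodes]) trivial hnE
    (by decide) ?_ ?_ ?_ ?_
  · intro σ' hf
    have := hf.1 0 (by decide)
    simpa [RamExpr.eval, hn] using this
  · exact ⟨by simpa using hX.val, by simpa using hX.count⟩
  · rintro t σ₁ ht hf₁ hbd₁ hr₁ ⟨h6, h7⟩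
    have e36 : σ₁.reg 36 = σ.reg 36 := by rw [hf₁.1 36 (by decide)]
    have e35 : σ₁.reg 35 = j * n := by rw [hf₁.1 35 (by decide)]; simpa using h35
    have a5 : σ₁.arr 5 = σ.arr 5 := hf₁.2 5 (by decide)
    have g5 := hp ⟨t, ht⟩
    have g6 := h6 j hj ⟨t, ht⟩
    have g7 := h7 ⟨t, ht⟩
    simp at g5 g6 g7
    have hup := onesCount_update X hj w ⟨t, ht⟩
    have hc := onesCount_le (Function.update X j w) m ⟨t, ht⟩
    have hwl := Bool.toNat_le (w ⟨t, ht⟩)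
    have h4E : 4 ≤ 2 ^ E := Nat.pow_le_pow_right (n := 2) (by simp) hE
    refine tr_seq (tr_store (RamExpr.small hE (by decide)) (RamExpr.small hE (by decide)) ?_ ?_)
    · simp only [RamExpr.eval, hr₁, e36, a5, g5, e35, g6, g7]; omega
    refine tr_store (RamExpr.small hE (by decide)) (RamExpr.small hE (by decide)) ?_ ?_
    · simp [RamExpr.eval, hr₁, e36, a5, g5]; omega
    simp [RamExpr.eval, hr₁, e36, a5, g5, e35, g6, g7]
    refine ⟨fun a ha i => ?_, fun i => ?_⟩
    · by_cases hai : a = j ∧ (i : ℕ) = t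
      · obtain ⟨rfl, h2⟩ := hai
        have : i = ⟨t, ht⟩ := Fin.ext h2
        subst this
        simp
      · have hne : a * n + i ≠ j * n + t := by
          intro heq
          have h1 := congrArg (· / n) heq
          have h2 := congrArg (· % n) heq
          simp only [Nat.mul_add_mod_of_lt i.2, Nat.mul_add_mod_of_lt ht] at h2
          have hn0 : 0 < n := by omega
          simp only [mul_comm _ n, Nat.mul_add_div hn0, Nat.div_eq_of_lt i.2, Nat.div_eq_of_lt ht,
            add_zero] at h1
          exact hai ⟨h1, h2⟩
        rw [Function.update_of_ne hne, h6 a ha]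
        by_cases haj : a = j
        · have : (i : ℕ) ≠ t := fun h => hai ⟨haj, h⟩
          have : (i : ℕ) < t ↔ (i : ℕ) ≤ t := by omega
          simp [haj, this]
        · simp [haj]
    · by_cases hit : (i : ℕ) = t
      · have : i = ⟨t, ht⟩ := Fin.ext hit
        subst this
        simp [hup]
      · rw [Function.update_of_ne hit, h7]
        have : (i : ℕ) < t ↔ (i : ℕ) ≤ t := by omega
        simp [this]
  · rintro σ' hf hbd' ⟨h1, h2⟩
    refine ⟨fun a ha i => ?_, fun i => by rw [h2, if_pos i.2]⟩
    rw [h1 a ha]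
    by_cases haj : a = j
    · subst haj; simp
    · simp [haj]

/-- No replacement of a center by an element of `W` increases the dispersion. -/
def LocalOpt {n : ℕ} (W : List (Fin n → Bool)) (X : ℕ → Fin n → Bool) (m : ℕ) : Prop :=
  ∀ w ∈ W, ∀ j < m, ¬ Improves X m w j

/-- Try all replacements of a center by a listed assignment. -/
def roundProg : RamProg :=
  .seq (.assign 36 (.const 0)) <| forLoop 21 (.reg 9) <|
  .seq (.seq (.assign 35 (.const 0)) <| forLoop 22 (.reg 11) <|
    .seq gainProg <| .seq (.ite (.sub (.reg 37) (.reg 38)) swapProg .skip) <|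
    .assign 35 (.add (.reg 35) (.reg 0))) <|
  .assign 36 (.add (.reg 36) (.reg 0))

/-- The centers `Y`, which belong to `W`, are better than `X`, or they are equal to `X` and no
replacement described by `P` increases the dispersion. -/
def RoundInv {n : ℕ} (W : List (Fin n → Bool)) (X : ℕ → Fin n → Bool) (m : ℕ)
    (P : ℕ → ℕ → Prop) (σ : RamState) : Prop :=
  ∃ Y, HasCenters Y m σ ∧ (∀ j < m, Y j ∈ W) ∧ (dispersion X m < dispersion Y m ∨
    (Y = X ∧ ∀ w (hw : w < W.length), ∀ j < m, P w j → ¬ Improves X m W[w] j))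

theorem RoundInv.imp {n m : ℕ} {W : List (Fin n → Bool)} {X : ℕ → Fin n → Bool}
    {P P' : ℕ → ℕ → Prop} {σ σ' : RamState} (h : RoundInv W X m P σ)
    (hP : ∀ w j, j < m → P' w j → P w j) (h6 : σ'.arr 6 = σ.arr 6) (h7 : σ'.arr 7 = σ.arr 7) :
    RoundInv W X m P' σ' := by
  obtain ⟨Y, h1, h2, h3⟩ := h
  refine ⟨Y, h1.congr h6 h7, h2, h3.imp_right fun h => ⟨h.1, fun w hw j hj hp => ?_⟩⟩
  exact h.2 w hw j hj (hP w j hj hp)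

/-- If some exchange takes place, the dispersion has grown. Otherwise the centers stayed the same
throughout, and every pair of a listed assignment and a position has been tested against them. -/
theorem tr_round {E n m : ℕ} {W : List (Fin n → Bool)} {X : ℕ → Fin n → Bool} {σ : RamState}
    {Q : RamState → Prop} (hE : 2 ≤ E) (hn : σ.reg 0 = n) (hm : σ.reg 11 = m) (hW : HasList W σ)
    (hX : HasCenters X m σ) (hXW : ∀ j < m, X j ∈ W) (hmE : (m + 1) * n < 2 ^ E)
    (hWE : W.length * n < 2 ^ E)
    (h : ∀ σ', Frame roundProg σ σ' → RoundInv W X m (fun _ _ => True) σ' → Q σ') :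
    Tr E roundProg (W.length * (m * (n * 14 + 10) + 6) + 3) σ Q := by
  refine Tr.bdd fun hbd => ?_
  have hlE : W.length < 2 ^ E := hW.length ▸ hbd.1 9
  have hmE' : m < 2 ^ E := hm ▸ hbd.1 11
  have hpos : 0 < 2 ^ E := by positivity
  suffices H : Tr E roundProg (1 + (W.length * (((1 + (m * (((n * 10 + 4) + ((n * 4 + 2 + 1) + 1))
      + 2) + 2)) + 1) + 2) + 2)) σ (RoundInv W X m (fun _ _ => True)) from
    H.frame.mono (le_of_eq (by ring)) fun σ' h' => h σ' h'.1 h'.2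
  refine tr_seq (tr_assign (RamExpr.small hE (by decide)) hpos ?_)
  refine tr_for (fun t σ' => σ'.reg 36 = t * n ∧ RoundInv W X m (fun w _ => w < t) σ')
    (by simp [RamExpr.nodes]) trivial hlE (by decide) ?_ ?_ ?_ ?_
  · intro σ' hf
    have := hf.1 9 (by decide)
    simpa [RamExpr.eval, hW.length] using this
  · refine ⟨by simp [RamExpr.eval], X, hX.congr (by simp) (by simp), hXW, Or.inr ⟨rfl, by simp⟩⟩
  · rintro t σ₁ ht hf₁ hbd₁ hr₁ ⟨h36, hinv⟩
    have e0 : σ₁.reg 0 = n := by rw [hf₁.1 0 (by decide)]; simpa using hn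
    have e11 : σ₁.reg 11 = m := by rw [hf₁.1 11 (by decide)]; simpa using hm
    have a5 : σ₁.arr 5 = σ.arr 5 := hf₁.2 5 (by decide)
    have htn : (t + 1) * n ≤ W.length * n := Nat.mul_le_mul_right _ ht
    rw [add_one_mul] at htn
    refine tr_seq_mid (R := fun σ' => σ'.reg 0 = n ∧ σ'.reg 36 = t * n ∧
      RoundInv W X m (fun w _ => w < t + 1) σ') ?_ ?_
    · refine tr_seq (tr_assign (RamExpr.small hE (by decide)) hpos ?_)
      refine tr_for (fun l σ' => σ'.reg 35 = l * n ∧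
        RoundInv W X m (fun w j => w < t ∨ (w = t ∧ j < l)) σ')
        (by simp [RamExpr.nodes]) trivial hmE' (by decide) ?_ ?_ ?_ ?_
      · intro σ' hf
        have := hf.1 11 (by decide)
        simpa [RamExpr.eval, e11] using this
      · exact ⟨by simp [RamExpr.eval], hinv.imp (by simp) (by simp) (by simp)⟩
      · rintro l σ₂ hl hf₂ hbd₂ hr₂ ⟨h35, Y, hY, hYW, hor⟩
        have e0' : σ₂.reg 0 = n := by rw [hf₂.1 0 (by decide)]; simpa using e0
        have e11' : σ₂.reg 11 = m := by rw [hf₂.1 11 (by decide)]; simpa using e11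
        have e36' : σ₂.reg 36 = t * n := by rw [hf₂.1 36 (by decide)]; simpa using h36
        have a5' : σ₂.arr 5 = σ.arr 5 := by rw [hf₂.2 5 (by decide)]; simpa using a5
        have hp : ∀ i : Fin n, σ₂.arr 5 (σ₂.reg 36 + i) = (W[t] i).toNat := by
          intro i
          rw [a5', e36', hW.val]
        refine tr_seq (tr_gain hE e0' e11' hl hp h35 hY hmE fun σ₃ hf₃ h37 h38 => ?_)
        have e35 : σ₃.reg 35 = l * n := by rw [hf₃.1 35 (by decide)]; exact h35
        have e36 : σ₃.reg 36 = t * n := by rw [hf₃.1 36 (by decide)]; exact e36'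
        have e0'' : σ₃.reg 0 = n := by rw [hf₃.1 0 (by decide)]; exact e0'
        have hp' : ∀ i : Fin n, σ₃.arr 5 (σ₃.reg 36 + i) = (W[t] i).toNat := by
          intro i
          rw [e36, ← e36', hf₃.2 5 (by decide)]; exact hp i
        have hY₃ : HasCenters Y m σ₃ := hY.congr (hf₃.2 6 (by decide)) (hf₃.2 7 (by decide))
        have hln : (l + 1) * n ≤ (m + 1) * n := Nat.mul_le_mul_right _ (by omega)
        rw [add_one_mul] at hln
        refine tr_seq_mid (R := fun σ' => σ'.reg 0 = n ∧ σ'.reg 35 = l * n ∧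
          RoundInv W X m (fun w j => w < t ∨ (w = t ∧ j < l + 1)) σ')
          (tr_ite (e := .sub (.reg 37) (.reg 38)) (RamExpr.small hE (by decide))
            (fun hc => ?_) (fun hc => ?_)) ?_
        · simp only [RamExpr.eval, h37, h38] at hc
          have himp : Improves Y m W[t] l := by unfold Improves; omega
          refine tr_swap hE e0'' hmE' hl hp' e35 hY₃ fun σ₄ hf₄ hY₄ => ?_
          refine ⟨(hf₄.1 0 (by decide)).trans e0'', (hf₄.1 35 (by decide)).trans e35, _, hY₄,
            fun j hj => ?_, Or.inl (lt_of_le_of_lt ?_ (himp.dispersion_lt hl))⟩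
          · by_cases hjl : j = l
            · subst hjl; simp
            · rw [Function.update_of_ne hjl]; exact hYW j hj
          · rcases hor with h | ⟨rfl, -⟩
            · exact h.le
            · exact le_rfl
        · simp only [RamExpr.eval, h37, h38] at hc
          have himp : ¬ Improves Y m W[t] l := by unfold Improves; omega
          refine Tr.mono (tr_skip (Q := fun σ' => σ'.reg 0 = n ∧ σ'.reg 35 = l * n ∧
            RoundInv W X m (fun w j => w < t ∨ (w = t ∧ j < l + 1)) σ')
            ⟨e0'', e35, Y, hY₃, hYW, ?_⟩) (by omega) fun _ h => h
          refine hor.imp_right ?_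
          rintro ⟨rfl, hno⟩
          refine ⟨rfl, fun w hw j hj hpj => ?_⟩
          by_cases hwj : w = t ∧ j = l
          · obtain ⟨rfl, rfl⟩ := hwj
            exact himp
          · exact hno w hw j hj (by omega)
        · rintro σ₄ ⟨k0, k35, k⟩
          refine tr_assign (RamExpr.small hE (by decide)) ?_ ?_
          · simp only [RamExpr.eval, k0, k35]; omega
          · exact ⟨by simp [RamExpr.eval, k0, k35, add_one_mul], k.imp (fun _ _ _ h => h) rfl rfl⟩
      · rintro σ₂ hf₂ hbd₂ ⟨-, hinv₂⟩
        refine ⟨?_, ?_, hinv₂.imp (fun w j hj hw => by omega) rfl rfl⟩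
        · rw [hf₂.1 0 (by decide)]; simpa using e0
        · rw [hf₂.1 36 (by decide)]; simpa using h36
    · rintro σ₂ ⟨k0, k36, k⟩
      refine tr_assign (RamExpr.small hE (by decide)) ?_ ?_
      · simp only [RamExpr.eval, k0, k36]; omega
      · exact ⟨by simp [RamExpr.eval, k0, k36, add_one_mul], k.imp (fun _ _ _ h => h) rfl rfl⟩
  · rintro σ' hf hbd' ⟨-, Y, h1, h2, h3⟩
    exact ⟨Y, h1, h2, h3.imp_right fun h => ⟨h.1, fun w hw j hj _ => h.2 w hw j hj hw⟩⟩

/-- The local search. -/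
def localProg : RamProg := forLoop 20 (.reg 12) roundProg

/-- The centers `Y` belong to `W`, and they are at least as good as some locally optimal choice of
centers. -/
def GoodCenters {n : ℕ} (W : List (Fin n → Bool)) (m : ℕ) (Y : ℕ → Fin n → Bool) : Prop :=
  (∀ j < m, Y j ∈ W) ∧ ∃ X, (∀ j < m, X j ∈ W) ∧ LocalOpt W X m ∧ dispersion X m ≤ dispersion Y m

/-- A round that does not start from a local optimum raises the dispersion by at least one, and the
dispersion is at most `m * m * n`; hence `m * m * n + 1` rounds suffice. The invariant does not
claim that the centers stay put at a local optimum, only that the dispersion never drops below it.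
-/
theorem tr_local {E n m : ℕ} {W : List (Fin n → Bool)} {X : ℕ → Fin n → Bool} {σ : RamState}
    {Q : RamState → Prop} (hE : 2 ≤ E) (hn : σ.reg 0 = n) (hm : σ.reg 11 = m) (hW : HasList W σ)
    (hR : σ.reg 12 = m * m * n + 1)
    (hX : HasCenters X m σ) (hXW : ∀ j < m, X j ∈ W) (hmE : (m + 1) * n < 2 ^ E)
    (hWE : W.length * n < 2 ^ E)
    (h : ∀ σ' Y, Frame localProg σ σ' → HasCenters Y m σ' → GoodCenters W m Y → Q σ') :
    Tr E localProg ((m * m * n + 1) * (W.length * (m * (n * 14 + 10) + 6) + 5) + 2) σ Q := by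
  refine Tr.bdd fun hbd => ?_
  suffices H : Tr E localProg ((m * m * n + 1) * (W.length * (m * (n * 14 + 10) + 6) + 3 + 2) + 2) σ
      fun σ' => ∃ Y, HasCenters Y m σ' ∧ GoodCenters W m Y from
    H.frame.mono le_rfl fun σ' h' => h'.2.elim fun Y hY => h σ' Y h'.1 hY.1 hY.2
  refine tr_for (fun t σ' => ∃ Y, HasCenters Y m σ' ∧ (∀ j < m, Y j ∈ W) ∧
    (GoodCenters W m Y ∨ t ≤ dispersion Y m)) (by simp [RamExpr.nodes]) trivial (hR ▸ hbd.1 12)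
    (by decide) ?_ ?_ ?_ ?_
  · intro σ' hf
    have := hf.1 12 (by decide)
    simpa [RamExpr.eval, hR] using this
  · exact ⟨X, hX.congr rfl rfl, hXW, Or.inr (by omega)⟩
  · rintro t σ₁ ht hf₁ hbd₁ hr₁ ⟨Y, hY, hYW, hor⟩
    have e0 : σ₁.reg 0 = n := by rw [hf₁.1 0 (by decide)]; simpa using hn
    have e11 : σ₁.reg 11 = m := by rw [hf₁.1 11 (by decide)]; simpa using hm
    have hW₁ : HasList W σ₁ := ⟨(hf₁.1 9 (by decide)).trans hW.length,
      (hf₁.1 10 (by decide)).trans hW.pos, by rw [hf₁.2 5 (by decide)]; exact hW.val⟩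
    refine tr_round hE e0 e11 hW₁ hY hYW hmE hWE ?_
    rintro σ₂ hf₂ ⟨Z, hZ, hZW, hor'⟩
    refine ⟨Z, hZ.congr rfl rfl, hZW, ?_⟩
    rcases hor' with hlt | ⟨rfl, hno⟩
    · rcases hor with ⟨-, X', h1, h2, h3⟩ | hle
      · exact Or.inl ⟨hZW, X', h1, h2, by omega⟩
      · exact Or.inr (by omega)
    · refine Or.inl ⟨hZW, Z, hZW, fun w hw j hj => ?_, le_rfl⟩
      obtain ⟨i, hi, rfl⟩ := List.getElem_of_mem hw
      exact hno i hi j hj trivial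
  · rintro σ' hf hbd' ⟨Y, h1, h2, h3⟩
    refine ⟨Y, h1, h3.resolve_right fun hle => ?_⟩
    have := dispersion_le Y m
    omega

/-! ### Initial centers and output -/

/-- Make the first listed assignment the value of all centers. -/
def initProg : RamProg :=
  .seq (forLoop 21 (.reg 0) <| .ite (.read 5 (.reg 21)) (.store 7 (.reg 21) (.reg 11))
    (.store 7 (.reg 21) (.const 0))) <|
  .seq (.assign 35 (.const 0)) <| forLoop 20 (.reg 11) <|
  .seq (forLoop 21 (.reg 0) (.store 6 (.add (.reg 35) (.reg 21)) (.read 5 (.reg 21)))) <|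
  .assign 35 (.add (.reg 35) (.reg 0))

theorem tr_init {E n m : ℕ} {w : Fin n → Bool} {σ : RamState}
    {Q : RamState → Prop} (hE : 2 ≤ E) (hn : σ.reg 0 = n) (hm : σ.reg 11 = m)
    (hw : ∀ i : Fin n, σ.arr 5 i = (w i).toNat) (hmE : (m + 1) * n < 2 ^ E)
    (h : ∀ σ', Frame initProg σ σ' → HasCenters (fun _ => w) m σ' → Q σ') :
    Tr E initProg (n * 4 + m * (n * 3 + 5) + 5) σ Q := by
  refine Tr.bdd fun hbd => ?_
  have hnE : n < 2 ^ E := hn ▸ hbd.1 0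
  have hmE' : m < 2 ^ E := hm ▸ hbd.1 11
  have hpos : 0 < 2 ^ E := by positivity
  have h4E : 4 ≤ 2 ^ E := Nat.pow_le_pow_right (n := 2) (by simp) hE
  suffices H : Tr E initProg ((n * ((1 + 1) + 2) + 2) + (1 + (m * (((n * (1 + 2) + 2) + 1) + 2) + 2)))
      σ (HasCenters (fun _ => w) m) from
    H.frame.mono (le_of_eq (by ring)) fun σ' h' => h σ' h'.1 h'.2
  refine tr_seq_mid (R := fun σ' => (∀ i : Fin n, σ'.arr 7 i = if w i then m else 0) ∧
    σ'.reg 0 = n ∧ σ'.reg 11 = m ∧ σ'.arr 5 = σ.arr 5) ?_ ?_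
  · refine tr_for (fun t σ' => ∀ i : Fin n, (i : ℕ) < t → σ'.arr 7 i = if w i then m else 0)
      (by simp [RamExpr.nodes]) trivial hnE (by decide) ?_ ?_ ?_ ?_
    · intro σ' hf
      have := hf.1 0 (by decide)
      simpa [RamExpr.eval, hn] using this
    · simp
    · rintro t σ₁ ht hf₁ hbd₁ hr₁ hI
      have e11 : σ₁.reg 11 = m := by rw [hf₁.1 11 (by decide)]; simpa using hm
      have a5 : σ₁.arr 5 = σ.arr 5 := hf₁.2 5 (by decide)
      have hwt := hw ⟨t, ht⟩
      simp only at hwt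
      have key : ∀ v, (v = if w ⟨t, ht⟩ then m else 0) → ∀ i : Fin n, (i : ℕ) < t + 1 →
          Function.update (σ₁.arr 7) t v i = if w i then m else 0 := by
        rintro v rfl i hi
        by_cases hit : (i : ℕ) = t
        · have : i = ⟨t, ht⟩ := Fin.ext hit
          subst this
          simp
        · rw [Function.update_of_ne hit, hI i (by omega)]
      refine tr_ite (RamExpr.small hE (by decide)) (fun hc => ?_) (fun hc => ?_)
      · simp only [RamExpr.eval, hr₁, a5, hwt] at hc
        refine tr_store (RamExpr.small hE (by decide)) (RamExpr.small hE (by decide))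
          (by simp only [RamExpr.eval, e11]; exact hmE') ?_
        simp only [RamExpr.eval, hr₁, e11, RamState.setReg_arr, RamState.setArr_arr,
          Function.update_self]
        refine key _ ?_
        cases hb : w ⟨t, ht⟩ <;> simp_all
      · simp only [RamExpr.eval, hr₁, a5, hwt] at hc
        refine tr_store (RamExpr.small hE (by decide)) (RamExpr.small hE (by decide)) hpos ?_
        simp only [RamExpr.eval, hr₁, RamState.setReg_arr, RamState.setArr_arr,
          Function.update_self]
        refine key _ ?_
        cases hb : w ⟨t, ht⟩ <;> simp_all
    · intro σ₁ hf₁ hbd₁ hI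
      refine ⟨fun i => hI i i.2, ?_, ?_, hf₁.2 5 (by decide)⟩
      · rw [hf₁.1 0 (by decide)]; simpa using hn
      · rw [hf₁.1 11 (by decide)]; simpa using hm
  · rintro σ₁ ⟨h7, h0, h11, h5⟩
    refine tr_seq (tr_assign (RamExpr.small hE (by decide)) hpos ?_)
    refine tr_for (fun t σ' => σ'.reg 35 = t * n ∧ ∀ j < t, ∀ i : Fin n,
      σ'.arr 6 (j * n + i) = (w i).toNat) (by simp [RamExpr.nodes]) trivial hmE' (by decide)
      ?_ ?_ ?_ ?_
    · intro σ' hf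
      have := hf.1 11 (by decide)
      simpa [RamExpr.eval, h11] using this
    · simp [RamExpr.eval]
    · rintro t σ₂ ht hf₂ hbd₂ hr₂ ⟨h35, hI⟩
      have e0 : σ₂.reg 0 = n := by rw [hf₂.1 0 (by decide)]; simpa using h0
      have a5 : σ₂.arr 5 = σ.arr 5 := by rw [hf₂.2 5 (by decide)]; simpa using h5
      have hmn : (t + 1) * n ≤ (m + 1) * n := Nat.mul_le_mul_right _ (by omega)
      rw [add_one_mul] at hmn
      refine tr_seq_mid (N₁ := n * (1 + 2) + 2) (N₂ := 1)
        (R := fun σ' => σ'.reg 0 = n ∧ σ'.reg 35 = t * n ∧ ∀ j < t + 1,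
        ∀ i : Fin n, σ'.arr 6 (j * n + i) = (w i).toNat) ?_ ?_
      · refine tr_for (fun l σ' => ∀ j < t + 1, ∀ i : Fin n, (j < t ∨ (i : ℕ) < l) →
          σ'.arr 6 (j * n + i) = (w i).toNat) (by simp [RamExpr.nodes]) trivial hnE (by decide)
          ?_ ?_ ?_ ?_
        · intro σ' hf
          have := hf.1 0 (by decide)
          simpa [RamExpr.eval, e0] using this
        · intro j hj i hi
          exact hI j (by omega) i
        · rintro l σ₃ hl hf₃ hbd₃ hr₃ hJ
          have e35 : σ₃.reg 35 = t * n := by rw [hf₃.1 35 (by decide)]; simpa using h35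
          have a5' : σ₃.arr 5 = σ.arr 5 := by rw [hf₃.2 5 (by decide)]; simpa using a5
          have hwl := hw ⟨l, hl⟩
          simp only at hwl
          have := Bool.toNat_le (w ⟨l, hl⟩)
          refine tr_store (RamExpr.small hE (by decide)) (RamExpr.small hE (by decide)) ?_ ?_
          · simp only [RamExpr.eval, hr₃, a5', hwl]; omega
          simp only [RamExpr.eval, hr₃, a5', hwl, e35, RamState.setReg_arr, RamState.setArr_arr,
            Function.update_self]
          intro j hj i hi
          by_cases heq : j * n + i = t * n + l
          · have hil : (i : ℕ) = l := by
              have := congrArg (· % n) heq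
              simpa [Nat.mul_add_mod_of_lt i.2, Nat.mul_add_mod_of_lt hl] using this
            have : i = ⟨l, hl⟩ := Fin.ext hil
            rw [heq, Function.update_self, this]
          · rw [Function.update_of_ne heq]
            refine hJ j hj i ?_
            by_contra hcon
            push Not at hcon
            have h1 : j = t := by omega
            have h2 : (i : ℕ) = l := by omega
            rw [h1, h2] at heq
            exact heq rfl
        · intro σ₃ hf₃ hbd₃ hJ
          refine ⟨?_, ?_, fun j hj i => hJ j hj i (Or.inr i.2)⟩
          · rw [hf₃.1 0 (by decide)]; exact e0
          · rw [hf₃.1 35 (by decide)]; exact h35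
      · rintro σ₃ ⟨k0, k35, k⟩
        refine tr_assign (RamExpr.small hE (by decide)) ?_ ?_
        · simp only [RamExpr.eval, k0, k35]; omega
        · exact ⟨by simp [RamExpr.eval, k0, k35, add_one_mul], k⟩
    · rintro σ₂ hf₂ hbd₂ ⟨-, hI⟩
      refine ⟨hI, fun i => ?_⟩
      rw [hf₂.2 7 (by decide)]
      simp only [RamState.setReg_arr, h7, onesCount]
      cases w i <;> simp

/-- Write `s` assignments, running through the centers cyclically. -/
def outputProg : RamProg :=
  .seq (.assign 35 (.const 0)) <| .seq (.assign 36 (.const 0)) <| .seq (.assign 42 (.const 0)) <|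
  forLoop 20 (.reg 2) <|
  .seq (forLoop 21 (.reg 0)
    (.store 2 (.add (.reg 36) (.reg 21)) (.read 6 (.add (.reg 35) (.reg 21))))) <|
  .seq (.assign 36 (.add (.reg 36) (.reg 0))) <|
  .seq (.assign 35 (.add (.reg 35) (.reg 0))) <|
  .seq (.assign 42 (.add (.reg 42) (.const 1))) <|
  .ite (.sub (.reg 11) (.reg 42)) .skip (.seq (.assign 42 (.const 0)) (.assign 35 (.const 0)))

theorem tr_output {E n m s : ℕ} {X : ℕ → Fin n → Bool} {σ : RamState}
    {Q : RamState → Prop} (hE : 2 ≤ E) (hn : σ.reg 0 = n) (hm : σ.reg 11 = m) (hs : σ.reg 2 = s)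
    (hm0 : 0 < m) (hX : HasCenters X m σ) (hmE : (m + 1) * (n + 1) < 2 ^ E) (hsE : s * n < 2 ^ E)
    (h : ∀ σ', Frame outputProg σ σ' →
      (∀ j < s, ∀ i : Fin n, σ'.arr 2 (j * n + i) = (X (j % m) i).toNat) → Q σ') :
    Tr E outputProg (s * (n * 3 + 10) + 5) σ Q := by
  refine Tr.bdd fun hbd => ?_
  have hnE : n < 2 ^ E := hn ▸ hbd.1 0
  have hsE' : s < 2 ^ E := hs ▸ hbd.1 2
  have hpos : 0 < 2 ^ E := by positivity
  have h4E : 4 ≤ 2 ^ E := Nat.pow_le_pow_right (n := 2) (by simp) hE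
  suffices H : Tr E outputProg (1 + (1 + (1 + (s * (((n * (1 + 2) + 2) + 6) + 2) + 2))))
      σ fun σ' => ∀ j < s, ∀ i : Fin n, σ'.arr 2 (j * n + i) = (X (j % m) i).toNat from
    H.frame.mono (le_of_eq (by ring)) fun σ' h' => h σ' h'.1 h'.2
  refine tr_seq (tr_assign (RamExpr.small hE (by decide)) hpos ?_)
  refine tr_seq (tr_assign (RamExpr.small hE (by decide)) hpos ?_)
  refine tr_seq (tr_assign (RamExpr.small hE (by decide)) hpos ?_)
  refine tr_for (fun t σ' => σ'.reg 36 = t * n ∧ σ'.reg 35 = (t % m) * n ∧ σ'.reg 42 = t % m ∧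
    ∀ j < t, ∀ i : Fin n, σ'.arr 2 (j * n + i) = (X (j % m) i).toNat)
    (by simp [RamExpr.nodes]) trivial hsE' (by decide) ?_ ?_ ?_ ?_
  · intro σ' hf
    have := hf.1 2 (by decide)
    simpa [RamExpr.eval, hs] using this
  · simp [RamExpr.eval]
  · rintro t σ₂ ht hf₂ hbd₂ hr₂ ⟨h36, h35, h42, hI⟩
    have e0 : σ₂.reg 0 = n := by rw [hf₂.1 0 (by decide)]; simpa using hn
    have e11 : σ₂.reg 11 = m := by rw [hf₂.1 11 (by decide)]; simpa using hm
    have a6 : σ₂.arr 6 = σ.arr 6 := by rw [hf₂.2 6 (by decide)]; simp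
    have hsn : (t + 1) * n ≤ s * n := Nat.mul_le_mul_right _ (by omega)
    rw [add_one_mul] at hsn
    have htm : t % m < m := Nat.mod_lt _ hm0
    have hmn : (t % m + 1) * (n + 1) ≤ (m + 1) * (n + 1) := Nat.mul_le_mul_right _ (by omega)
    have hmn' : (t % m + 1) * (n + 1) = t % m * n + n + t % m + 1 := by ring
    refine tr_seq_mid (N₁ := n * (1 + 2) + 2) (N₂ := 6)
      (R := fun σ' => σ'.reg 0 = n ∧ σ'.reg 11 = m ∧ σ'.reg 36 = t * n ∧
      σ'.reg 35 = (t % m) * n ∧ σ'.reg 42 = t % m ∧ ∀ j < t + 1,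
      ∀ i : Fin n, σ'.arr 2 (j * n + i) = (X (j % m) i).toNat) ?_ ?_
    · refine tr_for (fun l σ' => ∀ j < t + 1, ∀ i : Fin n, (j < t ∨ (i : ℕ) < l) →
          σ'.arr 2 (j * n + i) = (X (j % m) i).toNat) (by simp [RamExpr.nodes]) trivial hnE
          (by decide) ?_ ?_ ?_ ?_
      · intro σ' hf
        have := hf.1 0 (by decide)
        simpa [RamExpr.eval, e0] using this
      · intro j hj i hi
        exact hI j (by omega) i
      · rintro l σ₃ hl hf₃ hbd₃ hr₃ hJ
        have e35 : σ₃.reg 35 = (t % m) * n := by rw [hf₃.1 35 (by decide)]; simpa using h35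
        have e36 : σ₃.reg 36 = t * n := by rw [hf₃.1 36 (by decide)]; simpa using h36
        have a6' : σ₃.arr 6 = σ.arr 6 := by rw [hf₃.2 6 (by decide)]; simpa using a6
        have hwl := hX.val (t % m) htm ⟨l, hl⟩
        simp only at hwl
        have := Bool.toNat_le (X (t % m) ⟨l, hl⟩)
        refine tr_store (RamExpr.small hE (by decide)) (RamExpr.small hE (by decide)) ?_ ?_
        · simp only [RamExpr.eval, hr₃, a6', e35, hwl]; omega
        simp only [RamExpr.eval, hr₃, a6', hwl, e35, e36, RamState.setReg_arr,
          RamState.setArr_arr, Function.update_self]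
        intro j hj i hi
        by_cases heq : j * n + i = t * n + l
        · have hil : (i : ℕ) = l := by
            have := congrArg (· % n) heq
            simpa [Nat.mul_add_mod_of_lt i.2, Nat.mul_add_mod_of_lt hl] using this
          have hjt : j = t := by
            have : j * n = t * n := by omega
            exact Nat.eq_of_mul_eq_mul_right (by omega) this
          have : i = ⟨l, hl⟩ := Fin.ext hil
          rw [heq, Function.update_self, this, hjt]
        · rw [Function.update_of_ne heq]
          refine hJ j hj i ?_
          by_contra hcon
          push Not at hcon
          have h1 : j = t := by omega
          have h2 : (i : ℕ) = l := by omega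
          rw [h1, h2] at heq
          exact heq rfl
      · intro σ₃ hf₃ hbd₃ hJ
        refine ⟨?_, ?_, ?_, ?_, ?_, fun j hj i => hJ j hj i (Or.inr i.2)⟩
        · rw [hf₃.1 0 (by decide)]; exact e0
        · rw [hf₃.1 11 (by decide)]; exact e11
        · rw [hf₃.1 36 (by decide)]; exact h36
        · rw [hf₃.1 35 (by decide)]; exact h35
        · rw [hf₃.1 42 (by decide)]; exact h42
    · rintro σ₃ ⟨k0, k11, k36, k35, k42, k⟩
      have hsucc : (t + 1) % m = if m - (t % m + 1) = 0 then 0 else t % m + 1 := by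
        rw [Nat.add_mod]
        by_cases hm1 : m = 1
        · subst hm1; simp [Nat.mod_one]
        · rw [Nat.mod_eq_of_lt (show 1 < m by omega)]
          split_ifs with hz
          · have : t % m + 1 = m := by omega
            rw [this, Nat.mod_self]
          · exact Nat.mod_eq_of_lt (by omega)
      refine tr_seq (N₁ := 1) (N₂ := 5) (tr_assign (RamExpr.small hE (by decide)) ?_ ?_)
      · simp only [RamExpr.eval, k0, k36]; omega
      refine tr_seq (N₁ := 1) (N₂ := 4) (tr_assign (RamExpr.small hE (by decide)) ?_ ?_)
      · simp [RamExpr.eval, k0, k35]; omega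
      refine tr_seq (N₁ := 1) (N₂ := 3) (tr_assign (RamExpr.small hE (by decide)) ?_ ?_)
      · simp [RamExpr.eval, k42]; omega
      refine tr_ite (N := 2) (RamExpr.small hE (by decide)) (fun hc => ?_) (fun hc => ?_)
      · simp [RamExpr.eval, k11, k42] at hc
        rw [if_neg (by omega)] at hsucc
        refine Tr.mono (tr_skip ?_) (by omega) fun _ h => h
        simp [RamExpr.eval, k0, k36, k35, k42, hsucc, add_one_mul]
        simpa using k
      · simp [RamExpr.eval, k11, k42] at hc
        rw [if_pos (by omega)] at hsucc
        refine tr_seq (N₁ := 1) (N₂ := 1) (tr_assign (RamExpr.small hE (by decide)) hpos ?_)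
        refine tr_assign (RamExpr.small hE (by decide)) hpos ?_
        simp [RamExpr.eval, k0, k36, hsucc, add_one_mul]
        simpa using k
  · rintro σ' hf hbd' ⟨-, -, -, hI⟩
    exact hI

/-! ### Coins -/

/-- A uniform tape is a fair first coin followed by an independent uniform tape; this peels off one
iteration of the coin loop. -/
theorem uniformOfFintype_cons (d : ℕ) : PMF.uniformOfFintype (Fin (d + 1) → Bool) =
    (PMF.uniformOfFintype Bool).bind fun b =>
      (PMF.uniformOfFintype (Fin d → Bool)).map fun τ => (Fin.cons b τ : Fin (d + 1) → Bool) := by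
  ext τ
  rw [PMF.bind_apply, tsum_eq_single (τ 0), PMF.map_apply, tsum_eq_single (Fin.tail τ)]
  · rw [if_pos (Fin.cons_self_tail τ).symm]
    simp only [PMF.uniformOfFintype_apply, Fintype.card_bool, Fintype.card_fun, Fintype.card_fin]
    rw [← ENNReal.mul_inv (by simp) (by simp)]
    congr 1
    push_cast
    ring
  · intro τ' hτ'
    rw [if_neg]
    intro h
    exact hτ' (by simpa using (congrArg Fin.tail h).symm)
  · intro b hb
    rw [PMF.map_apply]
    convert mul_zero _
    rw [ENNReal.tsum_eq_zero]
    intro τ'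
    rw [if_neg]
    rintro rfl
    exact hb (by simp)

/-- Fill array `4` with coins. -/
def coinProg : RamProg :=
  forLoop 20 (.reg 7) (.seq (.flip 30) (.store 4 (.reg 20) (.reg 30)))

/-- The state after one round of `coinProg` with the given coin. -/
def coinStep (σ : RamState) (b : Bool) : RamState :=
  let σ₁ := (σ.tick 1).setReg 30 (if b then 1 else 0)
  let σ₂ := (σ₁.tick ((RamExpr.reg 20).cost σ₁ + (RamExpr.reg 30).cost σ₁ + 1)).setArr 4
    (σ₁.reg 20) (σ₁.reg 30)
  (σ₂.tick ((RamExpr.add (.reg 20) (.const 1)).cost σ₂ + 1)).setReg 20 (σ₂.reg 20 + 1)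

theorem exec_coinStep (f : ℕ) (σ : RamState) :
    (RamProg.seq (.seq (.flip 30) (.store 4 (.reg 20) (.reg 30)))
      (.assign 20 (.add (.reg 20) (.const 1)))).exec f σ =
    (PMF.uniformOfFintype Bool).bind fun b => PMF.pure (some (coinStep σ b)) := by
  simp only [RamProg.exec, PMF.map, PMF.bind_bind, Function.comp, PMF.pure_bind, Option.elim]
  rfl

theorem Bdd.tick {E : ℕ} {σ : RamState} (h : Bdd E σ) (t : ℕ) : Bdd E (σ.tick t) := h

theorem coinStep_bdd {E : ℕ} {σ : RamState} (hE : 2 ≤ E) (h : Bdd E σ)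
    (h20 : σ.reg 20 + 1 < 2 ^ E) (b : Bool) :
    Bdd E (coinStep σ b) ∧ (coinStep σ b).time ≤ σ.time + opCost E * 3 := by
  have h4E : 4 ≤ 2 ^ E := Nat.pow_le_pow_right (n := 2) (by simp) hE
  have hb : (if b then 1 else 0) < 2 ^ E := by split_ifs <;> omega
  have h1 := (h.tick 1).setReg 30 hb
  have h2 := (h1.tick ((RamExpr.reg 20).cost ((σ.tick 1).setReg 30 (if b then 1 else 0)) +
    (RamExpr.reg 30).cost ((σ.tick 1).setReg 30 (if b then 1 else 0)) + 1)).setArr 4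
      (((σ.tick 1).setReg 30 (if b then 1 else 0)).reg 20) (h1.1 30)
  have c1 := h1.cost_le' (e := .reg 20) (RamExpr.small hE (by decide))
  have c2 := h1.cost_le' (e := .reg 30) (RamExpr.small hE (by decide))
  have c3 := h2.cost_le' (e := .add (.reg 20) (.const 1)) (RamExpr.small hE (by decide))
  refine ⟨(h2.tick _).setReg 20 ?_, ?_⟩
  · simpa [RamState.tick] using h20
  · refine (show (coinStep σ b).time = σ.time + 1 + (_ + _ + 1) + (_ + 1) from rfl).le.trans ?_
    refine (Nat.add_le_add (Nat.add_le_add le_rfl (Nat.add_le_add (Nat.add_le_add c1 c2) le_rfl))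
      (Nat.add_le_add c3 le_rfl)).trans ?_
    unfold opCost
    omega

/-- The final state is a function `G` of the coins, with uniformly distributed argument. Everything
that follows can then be analysed deterministically for each tape separately. -/
theorem exec_coin_loop {E N : ℕ} (hE : 2 ≤ E) (hN : N < 2 ^ E) : ∀ (d t : ℕ) (σ : RamState),
    t + d = N → σ.reg 7 = N → σ.reg 20 = t → Bdd E σ → ∃ G : (Fin d → Bool) → RamState,
      (∀ τ, Bdd E (G τ) ∧ (∀ r, r ≠ 20 → r ≠ 30 → (G τ).reg r = σ.reg r) ∧
        (∀ a, a ≠ 4 → (G τ).arr a = σ.arr a) ∧ (∀ i : Fin d, (G τ).arr 4 (t + i) = (τ i).toNat) ∧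
        (∀ i, i < t ∨ N ≤ i → (G τ).arr 4 i = σ.arr 4 i) ∧
        (G τ).time ≤ σ.time + opCost E * (d * 4 + 1)) ∧
      ∀ f, ∀ g ≥ d + 1, RamProg.execLoop (.sub (.reg 7) (.reg 20))
        (RamProg.exec f (.seq (.seq (.flip 30) (.store 4 (.reg 20) (.reg 30)))
          (.assign 20 (.add (.reg 20) (.const 1))))) g σ =
        (PMF.uniformOfFintype (Fin d → Bool)).map fun τ => some (G τ) := by
  intro d
  induction d with
  | zero =>
    intro t σ ht h7 h20 hb
    have hc := hb.cost_le' (e := .sub (.reg 7) (.reg 20)) (RamExpr.small hE (by decide))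
    refine ⟨fun _ => σ.tick ((RamExpr.sub (.reg 7) (.reg 20)).cost σ + 1), fun τ => ⟨hb.tick _,
      fun _ _ _ => rfl, fun _ _ => rfl, fun i => i.elim0, fun _ _ => rfl, ?_⟩, fun f g hg => ?_⟩
    · simp only [RamState.tick, opCost]; omega
    · obtain ⟨g, rfl⟩ : ∃ g', g = g' + 1 := ⟨g - 1, by omega⟩
      rw [RamProg.execLoop, if_neg (by simp only [RamExpr.eval, h7, h20]; omega)]
      exact (PMF.map_const _ _).symm
  | succ d ih =>
    intro t σ ht h7 h20 hb
    have hc := hb.cost_le' (e := .sub (.reg 7) (.reg 20)) (RamExpr.small hE (by decide))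
    set σ₀ := σ.tick ((RamExpr.sub (.reg 7) (.reg 20)).cost σ + 1) with hσ₀
    have hstep := fun b => coinStep_bdd hE (hb.tick ((RamExpr.sub (.reg 7) (.reg 20)).cost σ + 1))
      (show σ.reg 20 + 1 < 2 ^ E by omega) b
    rw [← hσ₀] at hstep
    have h20' : ∀ b, (coinStep σ₀ b).reg 20 = t + 1 := fun b => by
      simp [coinStep, RamState.tick, hσ₀, h20]
    have hreg : ∀ b r, r ≠ 20 → r ≠ 30 → (coinStep σ₀ b).reg r = σ.reg r := fun b r h1 h2 => by
      simp [coinStep, RamState.tick, hσ₀, h1, h2]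
    have harr : ∀ b a, a ≠ 4 → (coinStep σ₀ b).arr a = σ.arr a := fun b a h1 => by
      simp [coinStep, RamState.tick, hσ₀, h1]
    have h4 : ∀ b, (coinStep σ₀ b).arr 4 = Function.update (σ.arr 4) t b.toNat := fun b => by
      cases b <;> simp [coinStep, RamState.tick, hσ₀, h20]
    choose G hG hrun using fun b => ih (t + 1) (coinStep σ₀ b) (by omega)
      ((hreg b 7 (by decide) (by decide)).trans h7) (h20' b) (hstep b).1
    refine ⟨fun τ => G (τ 0) (Fin.tail τ), fun τ => ?_, fun f g hg => ?_⟩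
    · obtain ⟨g1, g2, g3, g4, g5, g6⟩ := hG (τ 0) (Fin.tail τ)
      refine ⟨g1, fun r h1 h2 => (g2 r h1 h2).trans (hreg _ r h1 h2),
        fun a h1 => (g3 a h1).trans (harr _ a h1), fun i => ?_, fun i hi => ?_, ?_⟩
      · induction i using Fin.cases with
        | zero =>
          rw [g5 _ (by simp), h4]
          simp
        | succ i =>
          have := g4 i
          rw [Fin.tail] at this
          rw [← this]
          congr 1
          simp; omega
      · rw [g5 i (by omega), h4, Function.update_of_ne (by omega)]
      · have h1 := (hstep (τ 0)).2
        have h2 : σ₀.time = σ.time + ((RamExpr.sub (.reg 7) (.reg 20)).cost σ + 1) := rfl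
        have h3 : opCost E * ((d + 1) * 4 + 1) = opCost E * (d * 4 + 1) + opCost E * 4 := by ring
        rw [h3]
        have h4 : (RamExpr.sub (.reg 7) (.reg 20)).cost σ + 1 ≤ opCost E := by
          unfold opCost; omega
        change (G (τ 0) (Fin.tail τ)).time ≤ _
        omega
    · obtain ⟨g, rfl⟩ : ∃ g', g = g' + 1 := ⟨g - 1, by omega⟩
      rw [RamProg.execLoop, if_pos (by simp only [RamExpr.eval, h7, h20]; omega), exec_coinStep,
        PMF.bind_bind, uniformOfFintype_cons, PMF.map_bind]
      congr 1
      funext b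
      rw [PMF.pure_bind, PMF.map_comp]
      exact hrun b f g (by omega)

theorem exec_coinProg {E N : ℕ} {σ : RamState} (hE : 2 ≤ E) (hb : Bdd E σ) (h7 : σ.reg 7 = N) :
    ∃ G : (Fin N → Bool) → RamState,
      (∀ τ, Bdd E (G τ) ∧ (∀ r, r ≠ 20 → r ≠ 30 → (G τ).reg r = σ.reg r) ∧
        (∀ a, a ≠ 4 → (G τ).arr a = σ.arr a) ∧ (∀ i : Fin N, (G τ).arr 4 i = (τ i).toNat) ∧
        (∀ i, N ≤ i → (G τ).arr 4 i = σ.arr 4 i) ∧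
        (G τ).time ≤ σ.time + opCost E * (N * 4 + 2)) ∧
      ∀ f ≥ N + 1, coinProg.exec f σ =
        (PMF.uniformOfFintype (Fin N → Bool)).map fun τ => some (G τ) := by
  have hN : N < 2 ^ E := h7 ▸ hb.1 7
  set σ₀ := (σ.tick ((RamExpr.const 0).cost σ + 1)).setReg 20 0 with hσ₀
  obtain ⟨G, hG, hrun⟩ := exec_coin_loop hE hN N 0 σ₀ (by omega)
    (by simp [hσ₀, RamState.tick, h7]) (by simp [hσ₀])
    ((hb.tick _).setReg 20 (by positivity))
  refine ⟨G, fun τ => ?_, fun f hf => ?_⟩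
  · obtain ⟨g1, g2, g3, g4, g5, g6⟩ := hG τ
    refine ⟨g1, fun r h1 h2 => ?_, fun a h => g3 a h, fun i => by simpa using g4 i,
      fun i hi => g5 i (Or.inr hi), ?_⟩
    · rw [g2 r h1 h2]; simp [hσ₀, h1, RamState.tick]
    · have h1 : σ₀.time = σ.time + ((RamExpr.const 0).cost σ + 1) := rfl
      have h2 : (RamExpr.const 0).cost σ + 1 ≤ opCost E := by
        simp [RamExpr.cost, opCost]; omega
      have h3 : opCost E * (N * 4 + 2) = opCost E * (N * 4 + 1) + opCost E := by ring
      omega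
  · rw [coinProg, forLoop, RamProg.exec, RamProg.exec, PMF.pure_bind]
    simp only [Option.elim]
    rw [RamProg.exec]
    exact hrun f f hf

/-! ### The algorithm -/

/-- The part of the algorithm that follows the coin flips. -/
def postProg : RamProg :=
  .seq searchProg <| .ite (.reg 9) (.seq initProg <| .seq localProg outputProg) .skip

/-- A bound for the number of operations of `postProg`. -/
def postOps (n L b T m s : ℕ) : ℕ :=
  (T * (trialOps n L b + 2) + 5) + (((n * 4 + m * (n * 3 + 5) + 5) +
    (((m * m * n + 1) * (T * (m * (n * 14 + 10) + 6) + 5) + 2) + (s * (n * 3 + 10) + 5))) + 1)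

/-- The final state `σ` is the one expected with the tape `τ`. -/
def FinalState {n : ℕ} (F : CNFFormula n) (b T m s : ℕ) (τ : ℕ → Bool) (σ : RamState) : Prop :=
  ∃ W, SearchResult F τ b T W ∧ (W ≠ [] → ∃ Y, GoodCenters W m Y ∧
    ∀ j < s, ∀ i : Fin n, σ.arr 2 (j * n + i) = (Y (j % m) i).toNat)

theorem tr_post {E n b T m s : ℕ} {F : CNFFormula n} {τ : ℕ → Bool} {σ : RamState}
    (hE : 2 ≤ E) (hF : HasFormula F σ) (hM : σ.reg 3 = 2 ^ b)
    (hb : σ.reg 4 = b) (hT : σ.reg 6 = T) (hs : σ.reg 2 = s) (hm : σ.reg 11 = m)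
    (hR : σ.reg 12 = m * m * n + 1) (hτ : ∀ i, σ.arr 4 i = (τ i).toNat)
    (hval : ∀ i, σ.arr 3 i ≤ 2) (hTE : T * (n * (b + 1)) < 2 ^ E) (hWE : T * (n + 1) < 2 ^ E)
    (hm0 : 0 < m) (hms : m ≤ s) (hsE : (s + 1) * (n + 1) < 2 ^ E) :
    Tr E postProg (postOps n (formulaCode F).length b T m s) σ (FinalState F b T m s τ) := by
  have hmE : (m + 1) * (n + 1) < 2 ^ E := lt_of_le_of_lt (Nat.mul_le_mul_right _ (by omega)) hsE
  have hmE' : (m + 1) * n < 2 ^ E := lt_of_le_of_lt (Nat.mul_le_mul_left _ (by omega)) hmE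
  have hsE' : s * n < 2 ^ E := lt_of_le_of_lt (Nat.mul_le_mul (by omega) (by omega)) hsE
  unfold postOps
  refine tr_seq (tr_search hE hF hM hb hT hτ hval hTE hWE fun σ₁ W hf₁ hW hres => ?_)
  have hWT := hres.length_le
  have hWE' : W.length * n < 2 ^ E :=
    lt_of_le_of_lt (Nat.mul_le_mul hWT (by omega)) hWE
  refine tr_ite (RamExpr.small hE (by decide)) (fun hc => ?_) (fun hc => ?_)
  · simp only [RamExpr.eval, hW.length] at hc
    have hne : 0 < W.length := by omega
    refine tr_seq (tr_init (w := W[0]) hE ((hf₁.1 0 (by decide)).trans hF.vars)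
      ((hf₁.1 11 (by decide)).trans hm) (fun i => by simpa using hW.val 0 hne i) hmE'
      fun σ₂ hf₂ hX => ?_)
    have hW₂ : HasList W σ₂ := ⟨(hf₂.1 9 (by decide)).trans hW.length,
      (hf₂.1 10 (by decide)).trans hW.pos, by rw [hf₂.2 5 (by decide)]; exact hW.val⟩
    have hr₂ : ∀ r, r ∉ searchProg.regs → r ∉ initProg.regs → σ₂.reg r = σ.reg r :=
      fun r h1 h2 => (hf₂.1 r h2).trans (hf₁.1 r h1)
    refine tr_seq (Tr.mono (N := (m * m * n + 1) * (W.length * (m * (n * 14 + 10) + 6) + 5) + 2)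
      (tr_local hE ((hr₂ 0 (by decide) (by decide)).trans hF.vars)
      ((hr₂ 11 (by decide) (by decide)).trans hm) hW₂
      ((hr₂ 12 (by decide) (by decide)).trans hR) hX (fun j _ => List.getElem_mem hne) hmE' hWE'
      (Q := fun σ' => Tr E outputProg (s * (n * 3 + 10) + 5) σ' (FinalState F b T m s τ))
      fun σ₃ Y hf₃ hY hgood => ?_) ?_ fun _ h => h)
    · have hr₃ : ∀ r, r ∉ searchProg.regs → r ∉ initProg.regs → r ∉ localProg.regs →
          σ₃.reg r = σ.reg r := fun r h1 h2 h3 => (hf₃.1 r h3).trans (hr₂ r h1 h2)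
      refine tr_output hE ((hr₃ 0 (by decide) (by decide) (by decide)).trans hF.vars)
        ((hr₃ 11 (by decide) (by decide) (by decide)).trans hm)
        ((hr₃ 2 (by decide) (by decide) (by decide)).trans hs) hm0 hY hmE hsE' fun σ₄ hf₄ ho => ?_
      exact ⟨W, hres, fun _ => ⟨Y, hgood, ho⟩⟩
    · gcongr
  · simp only [RamExpr.eval, hW.length] at hc
    refine Tr.mono (tr_skip (Q := FinalState F b T m s τ) ⟨W, hres, fun h => ?_⟩) (by omega)
      fun _ h => h
    exact absurd (List.length_eq_zero_iff.1 hc) h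

/-- The algorithm. -/
def mainProg (k : ℕ) : RamProg := .seq (paramsProg k) <| .seq coinProg postProg

/-- A bound for the number of operations of `mainProg k`. -/
def mainOps (k n L b s : ℕ) : ℕ :=
  (3 * (n * n) + 25 * n + 3 * s + 3 * 2 ^ (k + 3) + 60) +
    ((trialCount k n * (n * (b + 1)) * 4 + 2) + postOps n L b (trialCount k n) (centers k s) s)

theorem paramsProg_regs (k : ℕ) : (paramsProg k).regs = (paramsProg 0).regs := rfl

theorem paramsProg_arrs (k : ℕ) : (paramsProg k).arrs = [] := rfl

/-- The tape that starts with the given coins and continues with zeros. -/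
def extendTape {N : ℕ} (τ : Fin N → Bool) (i : ℕ) : Bool := if h : i < N then τ ⟨i, h⟩ else false

theorem fst_le_of_mem_formulaCode {n : ℕ} (F : CNFFormula n) (i : ℕ) :
    ((formulaCode F).getD i (0, 0)).1 ≤ n := by
  by_cases h : i < (formulaCode F).length
  · rw [List.getD_eq_getElem _ _ h]
    have := List.getElem_mem h
    generalize (formulaCode F)[i] = q at this
    simp only [formulaCode, List.mem_flatMap, List.mem_append, List.mem_map, List.mem_singleton]
      at this
    obtain ⟨C, -, ⟨l, -, rfl⟩ | rfl⟩ := this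
    · exact l.1.2
    · simp
  · rw [List.getD_eq_default _ _ (by omega)]; simp

theorem inputState_bdd {n : ℕ} (F : CNFFormula n) (s E : ℕ) (hE : 2 ≤ E) (hn : n < 2 ^ E)
    (hL : (formulaCode F).length < 2 ^ E) (hs : s < 2 ^ E) : Bdd E (inputState F s) := by
  have h4E : 4 ≤ 2 ^ E := Nat.pow_le_pow_right (n := 2) (by simp) hE
  refine ⟨fun r => ?_, fun a i => ?_⟩
  · simp only [inputState]
    split_ifs <;> omega
  · have h1 := fst_le_of_mem_formulaCode F i
    have h2 := snd_le_of_mem_formulaCode F i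
    simp only [inputState]
    split_ifs <;> omega

theorem mainProg_haltsWith {E k n s : ℕ} (F : CNFFormula n) (hk : 0 < k) (hs : 1 ≤ s) (hE : 2 ≤ E)
    (hkE : k < 2 ^ E) (hnE : 2 * n + 2 < 2 ^ E) (hL : (formulaCode F).length < 2 ^ E)
    (hN : trialCount k n * (n * (n + 1) + n + 1) < 2 ^ E) (hR : s * s * n + 1 < 2 ^ E)
    (hsE : (s + 1) * (n + 1) < 2 ^ E) (hss : s * s < 2 ^ E) (h2n : 2 ^ n < 2 ^ E) :
    ∃ b, n < 2 ^ b ∧ 2 ^ b ≤ 2 * n + 1 ∧ b ≤ n ∧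
      ∃ G : (Fin (trialCount k n * (n * (b + 1))) → Bool) → RamState,
        (mainProg k).HaltsWith (inputState F s) ((PMF.uniformOfFintype _).map G) ∧
        ∀ τ, (G τ).time ≤ opCost E * mainOps k n (formulaCode F).length b s ∧
          FinalState F b (trialCount k n) (centers k s) s (extendTape τ) (G τ) := by
  have hms := centers_le k s
  have hmm : centers k s * centers k s ≤ s * s := Nat.mul_le_mul hms hms
  have hmmn : centers k s * centers k s * n ≤ s * s * n := Nat.mul_le_mul_right _ hmm
  have hsle : s ≤ (s + 1) * (n + 1) := by nlinarith
  obtain ⟨σ₁, c₁, hb₁, ⟨b, hpar⟩, hc₁, hrun₁⟩ := tr_params (s := s) (σ := inputState F s) hk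
    (by simp [inputState]) (by simp [inputState]) hE hkE hnE
    (lt_of_le_of_lt (Nat.mul_le_mul_left _ (by omega)) hN) (by omega) (by omega) (by omega) h2n
    (inputState_bdd F s E hE (by omega) hL (by omega))
  refine ⟨b, hpar.lt_tags, hpar.tags_le, hpar.bits_le, ?_⟩
  obtain ⟨f₁, hf₁⟩ := hrun₁ 0
  have hin : (inputState F s).atTime 0 = inputState F s := rfl
  rw [hin, zero_add] at hf₁
  obtain ⟨G₁, hG₁, hrun₂⟩ := exec_coinProg (σ := σ₁.atTime c₁) hE hb₁ hpar.coins
  have hr : ∀ τ r, r ∉ (paramsProg 0).regs → r ≠ 20 → r ≠ 30 →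
      (G₁ τ).reg r = (inputState F s).reg r := fun τ r h1 h2 h3 =>
    ((hG₁ τ).2.1 r h2 h3).trans (hpar.frame.1 r (by rwa [paramsProg_regs]))
  have ha : ∀ τ a, a ≠ 4 → (G₁ τ).arr a = (inputState F s).arr a := fun τ a h =>
    ((hG₁ τ).2.2.1 a h).trans (hpar.frame.2 a (by rw [paramsProg_arrs]; simp))
  have h4 : ∀ τ i, (G₁ τ).arr 4 i = (extendTape τ i).toNat := by
    intro τ i
    unfold extendTape
    split_ifs with h
    · exact (hG₁ τ).2.2.2.1 ⟨i, h⟩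
    · rw [(hG₁ τ).2.2.2.2.1 i (by omega)]
      simp only [RamState.atTime_arr]
      rw [hpar.frame.2 4 (by rw [paramsProg_arrs]; simp)]
      simp [inputState]
  have hpost := fun τ => tr_post (F := F) (E := E) (b := b) (T := trialCount k n)
    (m := centers k s) (s := s) (τ := extendTape τ) (σ := G₁ τ) hE
    ⟨by rw [hr τ 0 (by decide) (by decide) (by decide)]; rfl,
      by rw [hr τ 1 (by decide) (by decide) (by decide)]; rfl,
      by rw [ha τ 0 (by decide)]; exact fun _ => rfl,
      by rw [ha τ 1 (by decide)]; exact fun _ => rfl⟩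
    (((hG₁ τ).2.1 3 (by decide) (by decide)).trans hpar.tags)
    (((hG₁ τ).2.1 4 (by decide) (by decide)).trans hpar.bits)
    (((hG₁ τ).2.1 6 (by decide) (by decide)).trans hpar.trials)
    (by rw [hr τ 2 (by decide) (by decide) (by decide)]; rfl)
    (((hG₁ τ).2.1 11 (by decide) (by decide)).trans hpar.centers_eq)
    (((hG₁ τ).2.1 12 (by decide) (by decide)).trans hpar.rounds)
    (h4 τ)
    (fun i => by rw [ha τ 3 (by decide)]; simp [inputState])
    (lt_of_le_of_lt (Nat.mul_le_mul_left _ (by nlinarith [hpar.bits_le])) hN)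
    (lt_of_le_of_lt (Nat.mul_le_mul_left _ (by omega)) hN)
    (centers_pos k hs) hms hsE (hG₁ τ).1
  choose G c hbG hGfin hc hrunG using hpost
  choose f₂ hf₂ using fun τ => hrunG τ (G₁ τ).time
  have hself : ∀ σ : RamState, σ.atTime σ.time = σ := fun _ => rfl
  -- One amount of fuel must serve all tapes; there are finitely many, so the supremum of the
  -- individual amounts works.
  refine ⟨fun τ => (G τ).atTime ((G₁ τ).time + c τ), ⟨max f₁ (max
    (trialCount k n * (n * (b + 1)) + 1) (Finset.univ.sup f₂)), ?_⟩, fun τ => ⟨?_, ?_⟩⟩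
  · rw [mainProg, RamProg.exec, hf₁ _ (le_max_left _ _), PMF.pure_bind]
    simp only [Option.elim]
    rw [RamProg.exec, hrun₂ _ ((le_max_left _ _).trans (le_max_right _ _)), PMF.map_comp,
      PMF.bind_map]
    rw [PMF.map]
    congr 1
    funext τ
    have h1 := hf₂ τ (max f₁ (max (trialCount k n * (n * (b + 1)) + 1) (Finset.univ.sup f₂)))
      ((Finset.le_sup (Finset.mem_univ τ)).trans ((le_max_right _ _).trans (le_max_right _ _)))
    rw [hself] at h1
    simpa using h1
  · have h1 := (hG₁ τ).2.2.2.2.2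
    have h2 : (σ₁.atTime c₁).time = c₁ := rfl
    have h3 := hc τ
    change (G₁ τ).time + c τ ≤ _
    refine (Nat.add_le_add (h1.trans (Nat.add_le_add (h2.le.trans hc₁) le_rfl)) h3).trans
      (le_of_eq ?_)
    rw [mainOps]
    ring
  · exact hGfin τ

/-! ### The running time -/

theorem trialOps_le {n L b Z : ℕ} (hn : n + 1 ≤ Z) (hL : L ≤ Z) (hb : b ≤ n)
    (hM : 2 ^ b ≤ 2 * n + 1) : trialOps n L b ≤ 100 * Z ^ 3 := by
  have hZ : 1 ≤ Z := by omega
  have h1 : trialOps n L b ≤ Z * (Z * 4 + 9) + (2 * Z) * (Z * (Z * 12 + 16) + 4) + Z * 6 + Z * 3 + 13 := by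
    unfold trialOps
    gcongr <;> omega
  have m0 : 1 ≤ Z ^ 3 := Nat.one_le_pow _ _ hZ
  have m1 : Z ≤ Z ^ 3 := Nat.le_self_pow (by simp) _
  have m2 : Z ^ 2 ≤ Z ^ 3 := Nat.pow_le_pow_right hZ (by simp)
  nlinarith

/-- Every monomial on the left has degree at most `1`, `3` and `3` in `T`, `s` and `Z`, hence is at
most `T * s ^ 3 * Z ^ 3`. Only the coefficients remain to be added. -/
theorem ops_polynomial {T s Z : ℕ} (hT1 : 1 ≤ T) (hs : 1 ≤ s) (hZ : 1 ≤ Z) :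
    3 * (Z * Z) + 25 * Z + 3 * s + 3 * T + 60 + (T * (Z * Z) * 4 + 2 +
      (T * (100 * Z ^ 3 + 2) + 5 + (Z * 4 + s * (Z * 3 + 5) + 5 + ((s * s * Z + 1) *
      (T * (s * (Z * 14 + 10) + 6) + 5) + 2 + (s * (Z * 3 + 10) + 5)) + 1))) ≤
      1000 * (T * s ^ 3 * Z ^ 3) := by
  have mono : ∀ a ≤ 1, ∀ b ≤ 3, ∀ c ≤ 3, T ^ a * s ^ b * Z ^ c ≤ T ^ 1 * s ^ 3 * Z ^ 3 :=
    fun a ha b hb c hc => Nat.mul_le_mul (Nat.mul_le_mul (Nat.pow_le_pow_right hT1 ha)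
      (Nat.pow_le_pow_right hs hb)) (Nat.pow_le_pow_right hZ hc)
  have c000 := mono 0 (by simp) 0 (by simp) 0 (by simp)
  have c100 := mono 1 (by simp) 0 (by simp) 0 (by simp)
  have c010 := mono 0 (by simp) 1 (by simp) 0 (by simp)
  have c001 := mono 0 (by simp) 0 (by simp) 1 (by simp)
  have c002 := mono 0 (by simp) 0 (by simp) 2 (by simp)
  have c011 := mono 0 (by simp) 1 (by simp) 1 (by simp)
  have c021 := mono 0 (by simp) 2 (by simp) 1 (by simp)
  have c102 := mono 1 (by simp) 0 (by simp) 2 (by simp)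
  have c103 := mono 1 (by simp) 0 (by simp) 3 (by simp)
  have c110 := mono 1 (by simp) 1 (by simp) 0 (by simp)
  have c111 := mono 1 (by simp) 1 (by simp) 1 (by simp)
  have c121 := mono 1 (by simp) 2 (by simp) 1 (by simp)
  have c131 := mono 1 (by simp) 3 (by simp) 1 (by simp)
  have c132 := mono 1 (by simp) 3 (by simp) 2 (by simp)
  clear mono
  simp only [pow_zero, pow_one, one_mul, mul_one] at *
  generalize hP : T * s ^ 3 * Z ^ 3 = P at *
  linarith

theorem mainOps_le {k n L b s Z : ℕ} (hn : n + 1 ≤ Z) (hL : L ≤ Z) (hb : b ≤ n) (hs : 1 ≤ s)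
    (hM : 2 ^ b ≤ 2 * n + 1) :
    mainOps k n L b s ≤ 1000 * 2 ^ (k + 3) * 2 ^ (n - n / k) * s ^ 3 * Z ^ 5 := by
  have hZ : 1 ≤ Z := by omega
  have htr := trialOps_le hn hL hb hM
  have hC : 2 ^ (k + 3) ≤ trialCount k n := Nat.le_mul_of_pos_left _ (by positivity)
  have hT : trialCount k n ≤ 2 ^ (n - n / k) * Z * Z * 2 ^ (k + 3) := by
    unfold trialCount
    gcongr
  have hT1 : 1 ≤ trialCount k n := le_trans Nat.one_le_two_pow hC
  have hm := centers_le k s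
  unfold mainOps postOps
  generalize trialCount k n = T at *
  generalize centers k s = m at *
  generalize trialOps n L b = O at *
  generalize 2 ^ (k + 3) = C at *
  generalize 2 ^ (n - n / k) = x at *
  have h2 : 1000 * (T * s ^ 3 * Z ^ 3) ≤ 1000 * C * x * s ^ 3 * Z ^ 5 := by
    calc 1000 * (T * s ^ 3 * Z ^ 3) ≤ 1000 * ((x * Z * Z * C) * s ^ 3 * Z ^ 3) := by gcongr
      _ = _ := by ring
  have hn' : n ≤ Z := by omega
  have hbZ : b + 1 ≤ Z := by omega
  refine le_trans ?_ ((ops_polynomial hT1 hs hZ).trans h2)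
  gcongr

theorem size_le_self {s : ℕ} : s.size ≤ s := by
  rw [Nat.size_le]
  exact Nat.lt_two_pow_self

/-- The word size with which the algorithm is analyzed. -/
def wordSize (k Z s : ℕ) : ℕ := k + 4 + 5 * Z + 2 * s.size

/-- The word size must cover all numbers that occur: the number of rounds times the tape length per
round is below `2 ^ (5 * n + k + 4)`, and `s * s * n + 1` is at most `2 ^ (2 * s.size + n)`. There
are order `s ^ 3` operations; the fourth factor `s` comes from the crude bound `s.size ≤ s` in the
cost of an operation. -/
theorem mainProg_correct {k n s : ℕ} (F : CNFFormula n) (hk : 0 < k) (hs : 1 ≤ s) :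
    ∃ b, n < 2 ^ b ∧ b ≤ n ∧
      ∃ G : (Fin (trialCount k n * (n * (b + 1))) → Bool) → RamState,
        (mainProg k).HaltsWith (inputState F s) ((PMF.uniformOfFintype _).map G) ∧
        ∀ τ, (G τ).time ≤ 40000 * 2 ^ (k + 3) * (k + 100) * 2 ^ (n - n / k) * s ^ 4 *
            formulaSize F ^ 6 ∧
          FinalState F b (trialCount k n) (centers k s) s (extendTape τ) (G τ) := by
  set L := (formulaCode F).length with hL
  set Z := formulaSize F with hZdef
  have hZ : Z = n + L + 1 := rfl
  set E := wordSize k Z s with hE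
  have hEdef : E = k + 4 + 5 * Z + 2 * s.size := rfl
  have hpow : ∀ {a : ℕ}, a ≤ E → 2 ^ a ≤ 2 ^ E := fun h => Nat.pow_le_pow_right (by simp) h
  have hlt : ∀ {a : ℕ}, a < E → 2 ^ a < 2 ^ E := fun h => Nat.pow_lt_pow_right (by simp) h
  have hn2 : n + 1 ≤ 2 ^ n := Nat.lt_two_pow_self
  have hs2 : s + 1 ≤ 2 ^ s.size := Nat.lt_size_self s
  have hnE : 2 * n + 2 < 2 ^ E := by
    calc 2 * n + 2 ≤ 2 ^ (n + 1) := by rw [pow_succ]; omega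
      _ < 2 ^ E := hlt (by omega)
  have hN : trialCount k n * (n * (n + 1) + n + 1) < 2 ^ E := by
    calc trialCount k n * (n * (n + 1) + n + 1)
        = 2 ^ (n - n / k) * ((n + 1) * (n + 1) * (n + 1) * (n + 1)) * 2 ^ (k + 3) := by
          unfold trialCount; ring
      _ ≤ 2 ^ n * (2 ^ n * 2 ^ n * 2 ^ n * 2 ^ n) * 2 ^ (k + 3) := by
          gcongr
          · simp
          · exact Nat.sub_le _ _
      _ = 2 ^ (5 * n + k + 3) := by ring
      _ < 2 ^ E := hlt (by omega)
  have hR : s * s * n + 1 < 2 ^ E := by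
    calc s * s * n + 1 ≤ 2 ^ s.size * 2 ^ s.size * 2 ^ n := by
          have h1 : s * s * (n + 1) ≤ 2 ^ s.size * 2 ^ s.size * 2 ^ n := by gcongr <;> omega
          have h2 : 1 ≤ s * s := Nat.mul_le_mul hs hs
          nlinarith
      _ = 2 ^ (2 * s.size + n) := by ring
      _ < 2 ^ E := hlt (by omega)
  have hsE : (s + 1) * (n + 1) < 2 ^ E := by
    calc (s + 1) * (n + 1) ≤ 2 ^ s.size * 2 ^ n := by gcongr
      _ = 2 ^ (s.size + n) := by ring
      _ < 2 ^ E := hlt (by omega)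
  have hss : s * s < 2 ^ E := by
    calc s * s ≤ 2 ^ s.size * 2 ^ s.size := by gcongr <;> omega
      _ = 2 ^ (2 * s.size) := by ring
      _ < 2 ^ E := hlt (by omega)
  obtain ⟨b, h1, h2, h3, G, hG, hfin⟩ := mainProg_haltsWith (E := E) (k := k) (s := s) F hk hs
    (by omega) (lt_of_lt_of_le Nat.lt_two_pow_self (hpow (by omega))) hnE
    (lt_of_lt_of_le Nat.lt_two_pow_self (hpow (by omega))) hN hR hsE hss (hlt (by omega))
  refine ⟨b, h1, h3, G, hG, fun τ => ⟨(hfin τ).1.trans ?_, (hfin τ).2⟩⟩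
  have hops := mainOps_le (k := k) (L := L) (Z := Z) (by omega) (by omega) h3 hs h2
  have hcost : opCost E ≤ 40 * (k + 100) * (s * Z) := by
    have hsz := size_le_self (s := s)
    have hsZ : s ≤ s * Z := Nat.le_mul_of_pos_right _ (by omega)
    have hZs : Z ≤ s * Z := Nat.le_mul_of_pos_left _ hs
    have hks : k * 1 ≤ k * (s * Z) := Nat.mul_le_mul_left _ (by omega)
    unfold opCost
    rw [hEdef, mul_assoc, add_mul]
    omega
  calc _ ≤ (40 * (k + 100) * (s * Z)) *
        (1000 * 2 ^ (k + 3) * 2 ^ (n - n / k) * s ^ 3 * Z ^ 5) := Nat.mul_le_mul hcost hops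
    _ = _ := by ring

theorem two_pow_sub_div_le (k n : ℕ) :
    (2 : ℝ) ^ (n - n / k) ≤ 2 * (2 : ℝ) ^ ((n : ℝ) - (n : ℝ) / k) := by
  have h1 : (n : ℝ) / k ≤ ((n / k : ℕ) : ℝ) + 1 := by
    rw [← Nat.floor_div_eq_div (K := ℝ)]
    exact (Nat.lt_floor_add_one _).le
  have h2 : n / k ≤ n := Nat.div_le_self _ _
  calc (2 : ℝ) ^ (n - n / k) = (2 : ℝ) ^ ((n : ℝ) - (n / k : ℕ)) := by
        rw [← Nat.cast_sub h2, Real.rpow_natCast]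
    _ ≤ (2 : ℝ) ^ (1 + ((n : ℝ) - (n : ℝ) / k)) :=
        Real.rpow_le_rpow_of_exponent_le (by norm_num) (by linarith)
    _ = _ := by rw [Real.rpow_add (by norm_num), Real.rpow_one]

/-! ### Sets of vertices of the cube -/

/-- The assignment that differs from `z` exactly in the variable `i`. -/
def flipBit {n : ℕ} (z : Fin n → Bool) (i : Fin n) : Fin n → Bool := Function.update z i (!z i)

@[simp] theorem flipBit_self {n : ℕ} (z : Fin n → Bool) (i : Fin n) : flipBit z i i = !z i := by
  simp [flipBit]

theorem flipBit_of_ne {n : ℕ} (z : Fin n → Bool) {i l : Fin n} (h : l ≠ i) :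
    flipBit z i l = z l := by
  simp [flipBit, h]

@[simp] theorem flipBit_flipBit {n : ℕ} (z : Fin n → Bool) (i : Fin n) :
    flipBit (flipBit z i) i = z := by
  funext l
  by_cases h : l = i
  · subst h; simp
  · simp [flipBit_of_ne, h]

/-- The number of edges of the cube from `z` to the set `A`. -/
def edgesTo {n : ℕ} (A : Finset (Fin n → Bool)) (z : Fin n → Bool) : ℕ :=
  (Finset.univ.filter fun i => flipBit z i ∈ A).card

theorem edgesTo_union {n : ℕ} {A B : Finset (Fin n → Bool)} (h : Disjoint A B)
    (z : Fin n → Bool) : edgesTo (A ∪ B) z = edgesTo A z + edgesTo B z := by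
  simp only [edgesTo]
  rw [← Finset.card_union_of_disjoint]
  · congr 1; ext i; simp
  · rw [Finset.disjoint_filter]
    intro i _ h1 h2
    exact Finset.disjoint_left.1 h h1 h2

/-- Both sides count the edges between `A` and `B`: for each direction, flipping that bit is an
involution that matches their endpoints. -/
theorem sum_edgesTo_comm {n : ℕ} (A B : Finset (Fin n → Bool)) :
    ∑ z ∈ A, edgesTo B z = ∑ w ∈ B, edgesTo A w := by
  have h : ∀ A B : Finset (Fin n → Bool), ∑ z ∈ A, edgesTo B z =
      ∑ i, (A.filter fun z => flipBit z i ∈ B).card := by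
    intro A B
    simp only [edgesTo, Finset.card_filter]
    rw [Finset.sum_comm]
  rw [h, h]
  refine Finset.sum_congr rfl fun i _ => ?_
  refine Finset.card_bij' (fun z _ => flipBit z i) (fun z _ => flipBit z i) ?_ ?_ ?_ ?_
  · intro z hz; simp at hz ⊢; exact hz.symm
  · intro z hz; simp at hz ⊢; exact hz.symm
  · intro z _; simp
  · intro z _; simp

theorem two_rpow_le_one_add {x : ℝ} (h0 : 0 ≤ x) (h1 : x ≤ 1) : (2 : ℝ) ^ x ≤ 1 + x := by
  have := rpow_one_add_le_one_add_mul_self (s := 1) (by norm_num) h0 h1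
  norm_num at this
  exact this

/-- Divided by `a` and `b`, the two parts of the entropy are log₂(1 + b/a) ≥ b/a, because 2^x ≤ 1 +
x on [0, 1], and log₂((a + b)/b) ≥ 1. Each part contributes one of the two summands `b`. -/
theorem entropy_ineq {a b : ℝ} (hb : 0 < b) (hab : b ≤ a) :
    a * Real.logb 2 a + b * Real.logb 2 b + 2 * b ≤ (a + b) * Real.logb 2 (a + b) := by
  have ha : 0 < a := by linarith
  have h1 : b / a ≤ Real.logb 2 (a + b) - Real.logb 2 a := by
    rw [← Real.logb_div (by linarith) (by linarith), Real.le_logb_iff_rpow_le (by norm_num)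
      (by positivity)]
    refine (two_rpow_le_one_add (by positivity) (by rw [div_le_one ha]; exact hab)).trans ?_
    rw [add_div, div_self ha.ne']
  have h2 : 1 ≤ Real.logb 2 (a + b) - Real.logb 2 b := by
    rw [← Real.logb_div (by linarith) (by linarith), Real.le_logb_iff_rpow_le (by norm_num)
      (by positivity), Real.rpow_one, le_div_iff₀ hb]
    linarith
  have h3 : a * (b / a) = b := by field_simp
  have h4 := mul_le_mul_of_nonneg_left h1 ha.le
  have h5 := mul_le_mul_of_nonneg_left h2 hb.le
  rw [h3] at h4
  linarith

/-- The edge-isoperimetric inequality of the cube. -/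
theorem sum_edgesTo_self_le {n : ℕ} (A : Finset (Fin n → Bool)) :
    ((∑ z ∈ A, edgesTo A z : ℕ) : ℝ) ≤ A.card * Real.logb 2 A.card := by
  induction hc : A.card using Nat.strong_induction_on generalizing A with
  | _ c ih =>
    by_cases hconst : ∀ x ∈ A, ∀ y ∈ A, x = y
    · have hzero : ∑ z ∈ A, edgesTo A z = 0 := by
        refine Finset.sum_eq_zero fun z hz => ?_
        rw [edgesTo, Finset.card_eq_zero, Finset.filter_eq_empty_iff]
        intro i _ hi
        have := congrFun (hconst _ hi z hz) i
        simp at this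
      rw [hzero]
      have : c ≤ 1 := hc ▸ Finset.card_le_one.2 hconst
      interval_cases c <;> simp
    · push Not at hconst
      obtain ⟨x, hx, y, hy, hxy⟩ := hconst
      -- Split `A` along a coordinate in which two of its elements differ, so that both halves are
      -- nonempty. Edges between the halves run in direction `i` only: they form a matching, of size
      -- at most that of the smaller half. This is the summand `2 * b` of `entropy_ineq`, each edge
      -- being counted from both ends.
      obtain ⟨i, hi⟩ := Function.ne_iff.1 hxy
      have key : ∀ β : Bool, ∃ A₀ A₁ : Finset (Fin n → Bool), (∀ z, z ∈ A₀ ↔ z ∈ A ∧ z i = β) ∧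
          (∀ z, z ∈ A₁ ↔ z ∈ A ∧ z i ≠ β) :=
        fun β => ⟨A.filter fun z => z i = β, A.filter fun z => z i ≠ β, by simp, by simp⟩
      obtain ⟨A₀, A₁, h₀, h₁⟩ := key (x i)
      have hdisj : Disjoint A₀ A₁ := Finset.disjoint_left.2 fun z hz hz' =>
        ((h₁ z).1 hz').2 ((h₀ z).1 hz).2
      have hunion : A = A₀ ∪ A₁ := by
        ext z; simp [h₀, h₁]; tauto
      have hcard : A₀.card + A₁.card = c := by
        rw [← hc, hunion, Finset.card_union_of_disjoint hdisj]
      have hx₀ : 0 < A₀.card := Finset.card_pos.2 ⟨x, (h₀ x).2 ⟨hx, rfl⟩⟩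
      have hy₁ : 0 < A₁.card := Finset.card_pos.2 ⟨y, (h₁ y).2 ⟨hy, fun h => hi h.symm⟩⟩
      have i₀ := ih _ (by omega) A₀ rfl
      have i₁ := ih _ (by omega) A₁ rfl
      have hle₁ : ∀ z ∈ A₀, edgesTo A₁ z ≤ 1 := by
        intro z hz
        refine (Finset.card_le_card (t := {i}) fun l hl => ?_).trans (by simp)
        simp only [Finset.mem_filter, Finset.mem_univ, true_and] at hl
        by_contra hli
        have h2 := ((h₁ _).1 hl).2
        rw [flipBit_of_ne z (fun h => hli (by simp [h]))] at h2
        exact h2 ((h₀ z).1 hz).2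
      have hle₀ : ∀ z ∈ A₁, edgesTo A₀ z ≤ 1 := by
        intro z hz
        refine (Finset.card_le_card (t := {i}) fun l hl => ?_).trans (by simp)
        simp only [Finset.mem_filter, Finset.mem_univ, true_and] at hl
        by_contra hli
        have h2 := ((h₀ _).1 hl).2
        rw [flipBit_of_ne z (fun h => hli (by simp [h]))] at h2
        exact ((h₁ z).1 hz).2 h2
      have hE : ∑ z ∈ A, edgesTo A z = ∑ z ∈ A₀, edgesTo A₀ z + ∑ z ∈ A₁, edgesTo A₁ z +
          2 * ∑ z ∈ A₀, edgesTo A₁ z := by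
        rw [hunion, Finset.sum_union hdisj]
        simp only [edgesTo_union hdisj, Finset.sum_add_distrib]
        have := sum_edgesTo_comm A₀ A₁
        omega
      have hm₀ : ∑ z ∈ A₀, edgesTo A₁ z ≤ A₀.card := by
        simpa using Finset.sum_le_sum hle₁
      have hm₁ : ∑ z ∈ A₀, edgesTo A₁ z ≤ A₁.card := by
        rw [sum_edgesTo_comm]
        simpa using Finset.sum_le_sum hle₀
      rw [hE, ← hcard]
      generalize ∑ z ∈ A₀, edgesTo A₁ z = mm at *
      have hm₀' : (mm : ℝ) ≤ A₀.card := by exact_mod_cast hm₀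
      have hm₁' : (mm : ℝ) ≤ A₁.card := by exact_mod_cast hm₁
      push_cast at *
      rcases le_total (A₀.card : ℝ) A₁.card with hle | hle
      · have := entropy_ineq (by exact_mod_cast hx₀) hle
        rw [add_comm (A₁.card : ℝ) A₀.card] at this
        linarith
      · have := entropy_ineq (by exact_mod_cast hy₁) hle
        linarith

/-! ### Weights and edge boundaries -/

/-- The weight of a set `A` of solutions in the random search. -/
noncomputable def searchWeight {n : ℕ} (k : ℕ) (Ω A : Finset (Fin n → Bool)) : ℝ :=
  ∑ z ∈ A, (2 : ℝ) ^ (-(edgesTo Ω z : ℝ) / k)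

theorem exp_tangent (a x : ℝ) : (2 : ℝ) ^ a * (1 + (x - a) * Real.log 2) ≤ (2 : ℝ) ^ x := by
  have h : (2 : ℝ) ^ x = (2 : ℝ) ^ a * Real.exp ((x - a) * Real.log 2) := by
    rw [mul_comm (x - a), ← Real.rpow_def_of_pos (by norm_num), ← Real.rpow_add (by norm_num)]
    congr 1; ring
  rw [h]
  have := Real.add_one_le_exp ((x - a) * Real.log 2)
  gcongr
  linarith

/-- Jensen's inequality for powers of two. -/
theorem two_rpow_mean_le {ι : Type*} (s : Finset ι) (f : ι → ℝ) (a : ℝ)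
    (h : s.card * a ≤ ∑ i ∈ s, f i) : s.card * (2 : ℝ) ^ a ≤ ∑ i ∈ s, (2 : ℝ) ^ f i := by
  have h1 : ∑ i ∈ s, (2 : ℝ) ^ a * (1 + (f i - a) * Real.log 2) ≤ ∑ i ∈ s, (2 : ℝ) ^ f i :=
    Finset.sum_le_sum fun i _ => exp_tangent a (f i)
  refine le_trans ?_ h1
  rw [← Finset.mul_sum, Finset.sum_add_distrib, ← Finset.sum_mul, Finset.sum_sub_distrib]
  simp only [Finset.sum_const, nsmul_eq_mul, mul_one]
  have hlog : 0 ≤ Real.log 2 := Real.log_nonneg (by norm_num)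
  rw [mul_comm]
  gcongr
  nlinarith

/-- By Jensen the weight is at least |A| 2^(-d/k), where d is the average degree of `A` into `Ω`;
weight below 1/2 forces d > k (log₂|A| + 1). Edges inside `A` account for at most log₂|A| of d, and
at least (k-1)(log₂|A| + 1) is left for the outside. -/
theorem cross_lt {n k j : ℕ} {Ω A : Finset (Fin n → Bool)} (hk : 1 ≤ k) (hA : A ⊆ Ω)
    (hcard : 2 ^ j ≤ A.card) (hw : searchWeight k Ω A < 1 / 2) :
    (k - 1) * (j + 1) * A.card < ∑ z ∈ A, edgesTo (Ω \ A) z := by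
  have hpos : 0 < A.card := lt_of_lt_of_le (by positivity) hcard
  have hposR : (0 : ℝ) < A.card := by exact_mod_cast hpos
  have hkR : (0 : ℝ) < k := by exact_mod_cast hk
  set a : ℝ := ((∑ z ∈ A, edgesTo Ω z : ℕ) : ℝ) / A.card with ha
  have h1 : A.card * (2 : ℝ) ^ (-a / k) ≤ searchWeight k Ω A := by
    refine two_rpow_mean_le A (fun z => -(edgesTo Ω z : ℝ) / k) _ (le_of_eq ?_)
    rw [← Finset.sum_div, Finset.sum_neg_distrib, ha]
    push_cast
    field_simp
  have h2 : (A.card : ℝ) = (2 : ℝ) ^ Real.logb 2 A.card :=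
    (Real.rpow_logb (by norm_num) (by norm_num) hposR).symm
  have h3 : Real.logb 2 A.card + -a / k < -1 := by
    have h4 := h1.trans_lt hw
    rw [h2, ← Real.rpow_add (by norm_num)] at h4
    rw [← Real.rpow_lt_rpow_left_iff (x := 2) (by norm_num), Real.rpow_neg_one]
    linarith
  have h4 : (k : ℝ) * (Real.logb 2 A.card + 1) * A.card < ((∑ z ∈ A, edgesTo Ω z : ℕ) : ℝ) := by
    rw [← lt_div_iff₀ hposR, ← ha]
    rw [neg_div] at h3
    have : Real.logb 2 A.card + 1 < a / k := by linarith
    rw [lt_div_iff₀ hkR] at this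
    linarith
  have h5 : ∑ z ∈ A, edgesTo Ω z = ∑ z ∈ A, edgesTo A z + ∑ z ∈ A, edgesTo (Ω \ A) z := by
    rw [← Finset.sum_add_distrib]
    refine Finset.sum_congr rfl fun z _ => ?_
    rw [← edgesTo_union Finset.disjoint_sdiff, Finset.union_sdiff_of_subset hA]
  have h6 := sum_edgesTo_self_le A
  have h7 : (j : ℝ) ≤ Real.logb 2 A.card := by
    rw [Real.le_logb_iff_rpow_le (by norm_num) hposR, Real.rpow_natCast]
    exact_mod_cast hcard
  have h8 : (((k - 1) * (j + 1) * A.card : ℕ) : ℝ) < ((∑ z ∈ A, edgesTo (Ω \ A) z : ℕ) : ℝ) := by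
    rw [h5] at h4
    push_cast [Nat.cast_sub hk] at h4 h6 ⊢
    have h9 : ((k : ℝ) - 1) * (j + 1) ≤ (k - 1) * (Real.logb 2 A.card + 1) := by
      have : (1 : ℝ) ≤ k := by exact_mod_cast hk
      gcongr
    nlinarith
  exact_mod_cast h8

/-- More than (k-1)(j+1)|A| edges leave `A`. At most (k-2)(j+1)|A| of them avoid `A'`, so more than
(j+1)|A| end in `A' \ A`. Each vertex there receives at most j+1, hence `A' \ A` is larger than `A`.
-/
theorem card_doubles {n k j : ℕ} {Ω A A' : Finset (Fin n → Bool)} (hk : 2 ≤ k) (hAA : A ⊆ A')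
    (hA' : A' ⊆ Ω) (hcard : 2 ^ j ≤ A.card) (hw : searchWeight k Ω A < 1 / 2)
    (hout : ∀ z ∈ A, edgesTo (Ω \ A') z ≤ (k - 2) * (j + 1))
    (hin : ∀ w ∈ A' \ A, edgesTo A w ≤ j + 1) : 2 ^ (j + 1) ≤ A'.card := by
  have h1 := cross_lt (by omega) (hAA.trans hA') hcard hw
  have h2 : ∑ z ∈ A, edgesTo (Ω \ A) z = ∑ z ∈ A, edgesTo (Ω \ A') z +
      ∑ w ∈ A' \ A, edgesTo A w := by
    rw [sum_edgesTo_comm (A' \ A), ← Finset.sum_add_distrib]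
    refine Finset.sum_congr rfl fun z _ => ?_
    rw [← edgesTo_union]
    · congr 1
      ext w
      simp only [Finset.mem_sdiff, Finset.mem_union]
      have := @hA' w
      have := @hAA w
      tauto
    · exact Finset.disjoint_left.2 fun w hw hw' =>
        (Finset.mem_sdiff.1 hw).2 (Finset.mem_sdiff.1 hw').1
  have h3 : ∑ z ∈ A, edgesTo (Ω \ A') z ≤ A.card * ((k - 2) * (j + 1)) := by
    simpa using Finset.sum_le_sum hout
  have h4 : ∑ w ∈ A' \ A, edgesTo A w ≤ (A' \ A).card * (j + 1) := by
    simpa using Finset.sum_le_sum hin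
  have h5 : (A' \ A).card + A.card = A'.card := Finset.card_sdiff_add_card_eq_card hAA
  have h6 : A.card < (A' \ A).card := by
    obtain ⟨k, rfl⟩ : ∃ k', k = k' + 2 := ⟨k - 2, by omega⟩
    have e1 : k + 2 - 1 = k + 1 := by omega
    have e2 : k + 2 - 2 = k := by omega
    rw [e1] at h1
    rw [e2] at h3
    have : A.card * (j + 1) < (A' \ A).card * (j + 1) := by nlinarith
    exact Nat.lt_of_mul_lt_mul_right this
  rw [pow_succ]
  omega

/-! ### Solutions close to a given solution -/

/-- The variables on which two assignments differ. -/
def diffSet {n : ℕ} (z y : Fin n → Bool) : Finset (Fin n) := Finset.univ.filter fun i => z i ≠ y i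

@[simp] theorem mem_diffSet {n : ℕ} {z y : Fin n → Bool} {i : Fin n} :
    i ∈ diffSet z y ↔ z i ≠ y i := by
  simp [diffSet]

@[simp] theorem diffSet_self {n : ℕ} (y : Fin n → Bool) : diffSet y y = ∅ := by
  ext; simp

theorem diffSet_flipBit_of_mem {n : ℕ} {z y : Fin n → Bool} {i : Fin n} (h : i ∈ diffSet z y) :
    diffSet (flipBit z i) y = (diffSet z y).erase i := by
  ext l
  by_cases hl : l = i
  · subst hl
    simp only [mem_diffSet, flipBit_self, Finset.mem_erase] at h ⊢
    cases hz : z l <;> cases hy : y l <;> simp_all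
  · simp [flipBit_of_ne, hl]

theorem diffSet_flipBit_of_notMem {n : ℕ} {z y : Fin n → Bool} {i : Fin n}
    (h : i ∉ diffSet z y) : diffSet (flipBit z i) y = insert i (diffSet z y) := by
  ext l
  by_cases hl : l = i
  · subst hl
    simp only [mem_diffSet, flipBit_self, Finset.mem_insert] at h ⊢
    cases hz : z l <;> cases hy : y l <;> simp_all
  · simp [flipBit_of_ne, hl]

/-- The elements of `Ω` that differ from `y` in at most `j` variables from `P`. -/
def nearSet {n : ℕ} (Ω : Finset (Fin n → Bool)) (y : Fin n → Bool) (P : Finset (Fin n)) (j : ℕ) :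
    Finset (Fin n → Bool) :=
  Ω.filter fun z => (diffSet z y ∩ P).card ≤ j

/-- An edge can leave the set only by creating a new difference inside `P`, and only from an element
that already has the full number `j` of differences there. -/
theorem nearSet_edge {n j : ℕ} {Ω : Finset (Fin n → Bool)} {y z : Fin n → Bool}
    {P : Finset (Fin n)} {i : Fin n} (hz : z ∈ nearSet Ω y P j)
    (hi : flipBit z i ∈ Ω \ nearSet Ω y P j) : i ∈ P \ diffSet z y ∧
      (diffSet z y ∩ P).card = j ∧ flipBit z i ∈ nearSet Ω y P (j + 1) := by
  simp only [nearSet, Finset.mem_filter, Finset.mem_sdiff, not_and, not_le] at hz hi ⊢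
  have h1 := hi.2 hi.1
  by_cases hd : i ∈ diffSet z y
  · rw [diffSet_flipBit_of_mem hd, Finset.erase_inter] at h1
    have := Finset.card_erase_le (s := diffSet z y ∩ P) (a := i)
    omega
  · rw [diffSet_flipBit_of_notMem hd] at h1 ⊢
    by_cases hP : i ∈ P
    · have h2 : (insert i (diffSet z y) ∩ P).card = (diffSet z y ∩ P).card + 1 := by
        rw [Finset.insert_inter_of_mem hP, Finset.card_insert_of_notMem]
        simp [hd, hP] at hd ⊢
      exact ⟨⟨hP, hd⟩, by omega, hi.1, by omega⟩
    · rw [Finset.insert_inter_of_notMem hP] at h1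
      omega

/-- Suppose all these sets are light. Edges from level `j` lead at most to level `j + 1`, and an
element of the new layer can return only by undoing one of its at most `j + 1` differences in `P`.
So `card_doubles` makes the sets grow, until level `|P| / k` has too few places left for the edges
required by `cross_lt`. -/
theorem exists_nearSet {n k : ℕ} {Ω : Finset (Fin n → Bool)} (hk : 2 ≤ k) {y : Fin n → Bool}
    (hy : y ∈ Ω) (P : Finset (Fin n)) :
    ∃ j, k * j ≤ P.card ∧ 1 / 2 ≤ searchWeight k Ω (nearSet Ω y P j) := by
  by_contra hcon
  push Not at hcon
  have hmono : ∀ j, nearSet Ω y P j ⊆ nearSet Ω y P (j + 1) := fun j z hz => by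
    simp only [nearSet, Finset.mem_filter] at hz ⊢
    exact ⟨hz.1, by omega⟩
  have hgrow : ∀ j, k * j ≤ P.card → 2 ^ j ≤ (nearSet Ω y P j).card := by
    intro j
    induction j with
    | zero =>
      intro _
      exact Finset.card_pos.2 ⟨y, by simp [nearSet, hy]⟩
    | succ j ih =>
      intro hj
      have hj' : k * j ≤ P.card := (Nat.mul_le_mul_left _ (by omega)).trans hj
      refine card_doubles hk (hmono j) (Finset.filter_subset _ _) (ih hj') (hcon j hj')
        (fun z hz => ?_) fun w hw => ?_
      · rw [edgesTo, Finset.card_eq_zero.2]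
        · exact Nat.zero_le _
        · rw [Finset.filter_eq_empty_iff]
          intro i _ hi
          rw [Finset.mem_sdiff] at hi
          by_cases hi' : flipBit z i ∈ nearSet Ω y P j
          · exact hi.2 (hmono j hi')
          · exact hi.2 (nearSet_edge hz (Finset.mem_sdiff.2 ⟨hi.1, hi'⟩)).2.2
      · obtain ⟨hw1, hw2⟩ := Finset.mem_sdiff.1 hw
        have hwΩ := (Finset.mem_filter.1 hw1).1
        refine le_trans (Finset.card_le_card fun i hi => ?_) (Finset.mem_filter.1 hw1).2
        simp only [Finset.mem_filter, Finset.mem_univ, true_and] at hi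
        have := nearSet_edge (i := i) hi (by rw [flipBit_flipBit]; exact Finset.mem_sdiff.2 ⟨hwΩ, hw2⟩)
        obtain ⟨h1, h2⟩ := Finset.mem_sdiff.1 this.1
        refine Finset.mem_inter.2 ⟨?_, h1⟩
        simp only [mem_diffSet, flipBit_self, not_not] at h2 ⊢
        rw [← h2]
        simp
  -- A boundary element at this level has exactly `J` differences in `P` and can leave only at the
  -- other |P| - J ≤ (k-1)(J+1) places, since |P| < k(J+1).
  set J := P.card / k with hJ
  have hJ1 : k * J ≤ P.card := Nat.mul_div_le _ _
  have hJ2 : P.card < k * (J + 1) := by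
    have := Nat.lt_mul_div_succ P.card (show 0 < k by omega)
    exact this
  have h1 := cross_lt (k := k) (by omega) (Finset.filter_subset _ _) (hgrow J hJ1) (hcon J hJ1)
  have h2 : ∑ z ∈ nearSet Ω y P J, edgesTo (Ω \ nearSet Ω y P J) z ≤
      (nearSet Ω y P J).card * ((k - 1) * (J + 1)) := by
    rw [← smul_eq_mul, ← Finset.sum_const]
    refine Finset.sum_le_sum fun z hz => ?_
    by_cases hne : ∃ i, flipBit z i ∈ Ω \ nearSet Ω y P J
    · obtain ⟨i₀, hi₀⟩ := hne
      have hJc := (nearSet_edge hz hi₀).2.1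
      refine le_trans (Finset.card_le_card (t := P \ diffSet z y) fun i hi => ?_) ?_
      · simp only [Finset.mem_filter, Finset.mem_univ, true_and] at hi
        exact (nearSet_edge hz hi).1
      · have h3 := Finset.card_sdiff_add_card_inter P (diffSet z y)
        rw [Finset.inter_comm] at h3
        obtain ⟨k, rfl⟩ : ∃ k', k = k' + 1 := ⟨k - 1, by omega⟩
        simp only [Nat.add_sub_cancel]
        nlinarith
    · push Not at hne
      rw [edgesTo, Finset.card_eq_zero.2]
      · exact Nat.zero_le _
      · rw [Finset.filter_eq_empty_iff]
        exact fun i _ => hne i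
  rw [mul_comm] at h2
  exact absurd h1 (not_lt.2 h2)

/-- The elements of `Ω` that differ from `y` in at most `j` variables, and in few variables from
every initial segment with respect to the ranking `e`. -/
def sparseSet {n : ℕ} (Ω : Finset (Fin n → Bool)) (k : ℕ) (y : Fin n → Bool)
    (e : Equiv.Perm (Fin n)) (j : ℕ) : Finset (Fin n → Bool) :=
  Ω.filter fun z => (diffSet z y).card ≤ j ∧
    ∀ q < j, ((diffSet z y).filter fun i => (e i : ℕ) < (k - 2) * (q + 1)).card ≤ q

/-- Suppose all these sets are light. A flip at a place of rank at least (k-2)(j+1) changes none of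
the segments constrained at level `j + 1`, so it stays inside that level; at most (k-2)(j+1) edges
per element escape. An edge back from the new layer must undo one of at most `j + 1` differences. By
`card_doubles` the sets would double forever, which is absurd in a finite cube. -/
theorem exists_sparseSet {n k : ℕ} {Ω : Finset (Fin n → Bool)} (hk : 2 ≤ k) {y : Fin n → Bool}
    (hy : y ∈ Ω) (e : Equiv.Perm (Fin n)) :
    ∃ j, 1 / 2 ≤ searchWeight k Ω (sparseSet Ω k y e j) := by
  by_contra hcon
  push Not at hcon
  have hmono : ∀ j, sparseSet Ω k y e j ⊆ sparseSet Ω k y e (j + 1) := fun j z hz => by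
    simp only [sparseSet, Finset.mem_filter] at hz ⊢
    refine ⟨hz.1, by omega, fun q hq => ?_⟩
    by_cases hqj : q = j
    · subst hqj
      exact (Finset.card_filter_le _ _).trans hz.2.1
    · exact hz.2.2 q (by omega)
  have hgrow : ∀ j, 2 ^ j ≤ (sparseSet Ω k y e j).card := by
    intro j
    induction j with
    | zero => exact Finset.card_pos.2 ⟨y, by simp [sparseSet, hy]⟩
    | succ j ih =>
      refine card_doubles hk (hmono j) (Finset.filter_subset _ _) ih (hcon j)
        (fun z hz => ?_) fun w hw => ?_
      · have hcard : (Finset.univ.filter fun i => (e i : ℕ) < (k - 2) * (j + 1)).card ≤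
            (k - 2) * (j + 1) := by
          rw [← Finset.card_range ((k - 2) * (j + 1))]
          refine Finset.card_le_card_of_injOn (fun i => (e i : ℕ)) (fun i hi => ?_) ?_
          · simpa using hi
          · exact fun a _ b _ h => e.injective (Fin.ext h)
        refine le_trans (Finset.card_le_card fun i hi => ?_) hcard
        simp only [Finset.mem_filter, Finset.mem_univ, true_and, Finset.mem_sdiff] at hi ⊢
        by_contra hlight
        push Not at hlight
        apply hi.2
        have hz' := hz
        simp only [sparseSet, Finset.mem_filter] at hz' ⊢
        refine ⟨hi.1, ?_, fun q hq => ?_⟩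
        · by_cases hd : i ∈ diffSet z y
          · rw [diffSet_flipBit_of_mem hd]
            exact (Finset.card_erase_le).trans (by omega)
          · rw [diffSet_flipBit_of_notMem hd]
            exact (Finset.card_insert_le _ _).trans (by omega)
        · have hle := (Finset.mem_filter.1 (hmono j hz)).2.2 q hq
          refine le_trans (Finset.card_le_card fun l hl => ?_) hle
          have hqj : (k - 2) * (q + 1) ≤ (k - 2) * (j + 1) := Nat.mul_le_mul_left _ (by omega)
          simp only [Finset.mem_filter, mem_diffSet] at hl ⊢
          have hli : l ≠ i := by rintro rfl; omega
          rw [flipBit_of_ne _ hli] at hl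
          exact hl
      · obtain ⟨hw1, hw2⟩ := Finset.mem_sdiff.1 hw
        have hw1' := (Finset.mem_filter.1 hw1)
        refine le_trans (Finset.card_le_card fun i hi => ?_) hw1'.2.1
        simp only [Finset.mem_filter, Finset.mem_univ, true_and] at hi
        by_contra hd
        apply hw2
        simp only [sparseSet, Finset.mem_filter] at hi ⊢
        rw [diffSet_flipBit_of_notMem hd] at hi
        refine ⟨hw1'.1, (Finset.card_le_card (Finset.subset_insert _ _)).trans hi.2.1,
          fun q hq => (Finset.card_le_card ?_).trans (hi.2.2 q hq)⟩
        exact Finset.filter_subset_filter _ (Finset.subset_insert _ _)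
  have h1 := hgrow (n + 1)
  have h2 : (sparseSet Ω k y e (n + 1)).card ≤ 2 ^ n := by
    refine (Finset.card_le_univ _).trans (by simp)
  rw [pow_succ] at h1
  have : 0 < 2 ^ n := by positivity
  omega

/-- An initial segment `S` has only ranks below |S|. If it had `q + 1` differences and (k-2)(q+1) >
|S|, all of them would lie at ranks below (k-2)(q+1), where at most `q` are allowed. -/
theorem sparseSet_lowerSet {n k j : ℕ} {Ω : Finset (Fin n → Bool)} {y z : Fin n → Bool}
    {e : Equiv.Perm (Fin n)} (hz : z ∈ sparseSet Ω k y e j) {S : Finset (Fin n)}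
    (hS : ∀ i ∈ S, ∀ l, e l ≤ e i → l ∈ S) : (k - 2) * (diffSet z y ∩ S).card ≤ S.card := by
  by_contra hcon
  push Not at hcon
  obtain ⟨q, hq⟩ : ∃ q, (diffSet z y ∩ S).card = q + 1 := by
    refine ⟨(diffSet z y ∩ S).card - 1, ?_⟩
    have : (diffSet z y ∩ S).card ≠ 0 := by
      intro h0; rw [h0] at hcon; simp at hcon
    omega
  have hz' := (Finset.mem_filter.1 hz).2
  have hle : (diffSet z y ∩ S).card ≤ (diffSet z y).card :=
    Finset.card_le_card Finset.inter_subset_left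
  have h1 := hz'.2 q (by omega)
  have h2 : diffSet z y ∩ S ⊆ (diffSet z y).filter fun i => (e i : ℕ) < (k - 2) * (q + 1) := by
    intro i hi
    obtain ⟨hi1, hi2⟩ := Finset.mem_inter.1 hi
    refine Finset.mem_filter.2 ⟨hi1, ?_⟩
    have h3 : ((Finset.Iic (e i)).map e.symm.toEmbedding).card ≤ S.card := by
      refine Finset.card_le_card fun l hl => ?_
      simp only [Finset.mem_map, Finset.mem_Iic, Equiv.coe_toEmbedding] at hl
      obtain ⟨a, ha, rfl⟩ := hl
      exact hS i hi2 _ (by simpa using ha)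
    rw [Finset.card_map, Fin.card_Iic] at h3
    rw [← hq]
    omega
  have := Finset.card_le_card h2
  omega

/-! ### The success probability of one round of the random search -/

/-- A discrete form of ∫ k t^(k-1) dt = m^k: the increment (m+1)^k - m^k is at most k (m+1)^(k-1) by
Bernoulli. -/
theorem pow_le_mul_sum_pow {k : ℕ} (hk : 1 ≤ k) (m : ℕ) :
    (m : ℝ) ^ k ≤ k * ∑ t ∈ Finset.range (m + 1), (t : ℝ) ^ (k - 1) := by
  obtain ⟨k, rfl⟩ : ∃ k', k = k' + 1 := ⟨k - 1, by omega⟩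
  simp only [Nat.add_sub_cancel]
  induction m with
  | zero =>
    rw [Nat.cast_zero, zero_pow (by omega)]
    positivity
  | succ m ih =>
    rw [Finset.sum_range_succ, mul_add]
    have hp : (0 : ℝ) < m + 1 := by positivity
    have hle : -(1 / ((m : ℝ) + 1)) ≥ -2 := by
      have : 1 / ((m : ℝ) + 1) ≤ 1 := by rw [div_le_one hp]; simp
      linarith
    have hb := one_add_mul_le_pow hle (k + 1)
    have h1 : (1 + -(1 / ((m : ℝ) + 1))) = m / (m + 1) := by field_simp; ring
    rw [h1, div_pow, le_div_iff₀ (by positivity)] at hb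
    have h2 : (1 + ((k + 1 : ℕ) : ℝ) * -(1 / ((m : ℝ) + 1))) * ((m : ℝ) + 1) ^ (k + 1) =
        ((m : ℝ) + 1) ^ (k + 1) - (k + 1 : ℕ) * ((m : ℝ) + 1) ^ k := by
      field_simp
      ring
    rw [h2] at hb
    push_cast at *
    linarith

/-- Given the tag t of `i`, each other variable of `V` has a smaller tag with probability t/M,
independently. Averaging over t with |V| replaced by k yields at least (1/k)((M-1)/M)^k, and
Bernoulli bounds this below by 1/k - 1/M, the last term paying for ties. -/
theorem card_strictMax {n k M : ℕ} (hM : 0 < M) (hk : 1 ≤ k) {V : Finset (Fin n)} {i : Fin n}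
    (hi : i ∈ V) (hV : V.card ≤ k) : (M : ℝ) ^ n * (1 / k - 1 / M) ≤
      (Finset.univ.filter fun g : Fin n → Fin M => ∀ l ∈ V, l ≠ i → g l < g i).card := by
  have hMR : (0 : ℝ) < M := by exact_mod_cast hM
  have hkR : (0 : ℝ) < k := by exact_mod_cast hk
  rw [Finset.card_eq_sum_card_fiberwise (f := fun g : Fin n → Fin M => g i) (t := Finset.univ)
    (fun _ _ => Finset.mem_univ _)]
  have hfib : ∀ t : Fin M, (((Finset.univ.filter fun g : Fin n → Fin M =>
      ∀ l ∈ V, l ≠ i → g l < g i).filter fun g => g i = t).card : ℝ) =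
      (M : ℝ) ^ n * ((1 / M) * ((t : ℝ) / M) ^ (V.card - 1)) := by
    intro t
    have hset : ((Finset.univ.filter fun g : Fin n → Fin M =>
        ∀ l ∈ V, l ≠ i → g l < g i).filter fun g => g i = t) = Fintype.piFinset fun l =>
          if l = i then {t} else if l ∈ V then Finset.Iio t else Finset.univ := by
      ext g
      simp only [Finset.mem_filter, Finset.mem_univ, true_and, Fintype.mem_piFinset]
      constructor
      · rintro ⟨h1, rfl⟩ l
        split_ifs with h2 h3
        · simp [h2]
        · simpa using h1 l h3 h2
        · simp
      · intro h
        have hgi : g i = t := by simpa using h i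
        refine ⟨fun l hl hli => ?_, hgi⟩
        have := h l
        rw [if_neg hli, if_pos hl, Finset.mem_Iio] at this
        rwa [hgi]
    rw [hset, Fintype.card_piFinset, Nat.cast_prod]
    have hterm : ∀ l : Fin n, (((if l = i then {t} else if l ∈ V then Finset.Iio t
        else Finset.univ : Finset (Fin M)).card : ℕ) : ℝ) =
        M * ((if l = i then 1 / (M : ℝ) else 1) * (if l ∈ V.erase i then (t : ℝ) / M else 1)) := by
      intro l
      by_cases h1 : l = i
      · simp [h1, hMR.ne']
      · by_cases h2 : l ∈ V
        · simp [h1, h2]; field_simp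
        · simp [h1, h2]
    simp only [hterm]
    rw [Finset.prod_mul_distrib, Finset.prod_mul_distrib, Finset.prod_ite_eq' , Finset.prod_ite_mem,
      Finset.univ_inter, Finset.prod_const, Finset.prod_const, Finset.card_erase_of_mem hi]
    simp
  push_cast
  rw [Finset.sum_congr rfl fun t _ => hfib t, ← Finset.mul_sum]
  refine mul_le_mul_of_nonneg_left ?_ (by positivity)
  have h1 : ∀ t : Fin M, 1 / (M : ℝ) * ((t : ℝ) / M) ^ (k - 1) ≤
      1 / M * ((t : ℝ) / M) ^ (V.card - 1) := by
    intro t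
    refine mul_le_mul_of_nonneg_left (pow_le_pow_of_le_one (by positivity) ?_ (by omega))
      (by positivity)
    rw [div_le_one hMR]
    exact_mod_cast t.2.le
  refine le_trans ?_ (Finset.sum_le_sum fun t _ => h1 t)
  rw [Fin.sum_univ_eq_sum_range (fun t => 1 / (M : ℝ) * ((t : ℝ) / M) ^ (k - 1))]
  obtain ⟨m, rfl⟩ : ∃ m, M = m + 1 := ⟨M - 1, by omega⟩
  have h2 := pow_le_mul_sum_pow hk m
  have h3 : ∑ t ∈ Finset.range (m + 1), 1 / ((m + 1 : ℕ) : ℝ) * ((t : ℝ) / (m + 1 : ℕ)) ^ (k - 1) =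
      (∑ t ∈ Finset.range (m + 1), (t : ℝ) ^ (k - 1)) / ((m + 1 : ℕ) : ℝ) ^ k := by
    rw [Finset.sum_div]
    refine Finset.sum_congr rfl fun t _ => ?_
    obtain ⟨k, rfl⟩ : ∃ k', k = k' + 1 := ⟨k - 1, by omega⟩
    simp only [Nat.add_sub_cancel, div_pow, pow_succ]
    field_simp
  rw [h3, le_div_iff₀ (by positivity)]
  have hle : -(1 / ((m + 1 : ℕ) : ℝ)) ≥ -2 := by
    have : 1 / ((m + 1 : ℕ) : ℝ) ≤ 1 := by rw [div_le_one hMR]; simp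
    linarith
  have hb := one_add_mul_le_pow hle k
  have h4 : (1 + -(1 / ((m + 1 : ℕ) : ℝ))) = m / ((m + 1 : ℕ) : ℝ) := by
    field_simp; push_cast; ring
  rw [h4, div_pow, le_div_iff₀ (by positivity)] at hb
  have h5 : (k : ℝ) * ((1 / k - 1 / ((m + 1 : ℕ) : ℝ)) * ((m + 1 : ℕ) : ℝ) ^ k) =
      (1 + k * -(1 / ((m + 1 : ℕ) : ℝ))) * ((m + 1 : ℕ) : ℝ) ^ k := by
    field_simp
    ring
  have h6 := hb.trans h2
  rw [← h5] at h6
  exact le_of_mul_le_mul_left h6 hkR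

/-! ### Forced variables and the chance of hitting a solution -/

open Classical in
/-- The set of solutions of a formula. -/
noncomputable def solutions {n : ℕ} (F : CNFFormula n) : Finset (Fin n → Bool) :=
  Finset.univ.filter (Satisfies F)

@[simp] theorem mem_solutions {n : ℕ} {F : CNFFormula n} {z : Fin n → Bool} :
    z ∈ solutions F ↔ Satisfies F z := by
  simp [solutions]

-- A clause violated after flipping `i` has no true literal under `z` except at `i`. It therefore
-- forces `i` as soon as `i` has the strictly largest tag among its at most `k` variables.
open Classical in
theorem card_forced {n k M : ℕ} {F : CNFFormula n} (hF : IsKCNF k F) (hM : 0 < M) (hk : 1 ≤ k)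
    {z : Fin n → Bool} (hz : Satisfies F z) {i : Fin n} (hi : flipBit z i ∉ solutions F) :
    (M : ℝ) ^ n * (1 / k - 1 / M) ≤
      (Finset.univ.filter fun g : Fin n → Fin M => Forced F z (fun l => (g l : ℕ)) i).card := by
  simp only [mem_solutions, Satisfies] at hi
  push Not at hi
  obtain ⟨C, hC, hfal⟩ := hi
  obtain ⟨l, hl, hzl⟩ := hz C hC
  have hcase : ∀ l' ∈ C, l'.1 = i → l' = (i, z i) := by
    rintro ⟨a, β⟩ hl' rfl
    have := hfal _ hl'
    simp only [flipBit_self] at this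
    refine Prod.ext rfl ?_
    cases h : z a <;> cases β <;> simp_all
  have hli : l.1 = i := by
    by_contra h
    have := hfal l hl
    rw [flipBit_of_ne z h] at this
    exact this hzl
  have hiC : (i, z i) ∈ C := hcase l hl hli ▸ hl
  set V : Finset (Fin n) := (C.map Prod.fst).toFinset with hV
  have hVi : i ∈ V := by
    rw [hV, List.mem_toFinset]
    exact List.mem_map.2 ⟨_, hiC, rfl⟩
  have hVk : V.card ≤ k := (List.toFinset_card_le _).trans (by simpa using hF C hC)
  refine (card_strictMax hM hk hVi hVk).trans ?_
  refine Nat.cast_le.2 (Finset.card_le_card fun g hg => ?_)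
  simp only [Finset.mem_filter, Finset.mem_univ, true_and] at hg ⊢
  refine ⟨C, hC, hiC, fun l' hl' => ?_⟩
  by_cases h : l'.1 = i
  · exact Or.inl (hcase l' hl' h)
  · refine Or.inr ⟨?_, ?_⟩
    · have := hfal l' hl'
      rwa [flipBit_of_ne z h] at this
    · exact hg l'.1 (by rw [hV, List.mem_toFinset]; exact List.mem_map.2 ⟨_, hl', rfl⟩) h

open Classical in
/-- The tags and coins with which the solution `z` is hit. -/
noncomputable def hitSet {n : ℕ} (F : CNFFormula n) (M : ℕ) (z : Fin n → Bool) :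
    Finset ((Fin n → Fin M) × (Fin n → Bool)) :=
  Finset.univ.filter fun p => Hit F z (fun l => (p.1 l : ℕ)) p.2

open Classical in
theorem card_hit_coins {n : ℕ} (F : CNFFormula n) (z : Fin n → Bool) (g : Fin n → ℕ) :
    (Finset.univ.filter fun v : Fin n → Bool => Hit F z g v).card =
      2 ^ (Finset.univ.filter fun i => Forced F z g i).card := by
  have hset : (Finset.univ.filter fun v : Fin n → Bool => Hit F z g v) =
      Fintype.piFinset fun i => if Forced F z g i then Finset.univ else {z i} := by
    ext v
    rw [Finset.mem_filter, Fintype.mem_piFinset]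
    simp only [Finset.mem_univ, true_and, Hit]
    refine forall_congr' fun i => ?_
    split_ifs with h <;> simp [h]
  rw [hset, Fintype.card_piFinset, ← Finset.prod_const, Finset.prod_filter]
  refine Finset.prod_congr rfl fun i _ => ?_
  split_ifs <;> simp

-- For given tags the hit probability is 2^(-n) times two to the number of forced variables. The
-- expected number of forced variables is at least (n - deg z)(1/k - 1/M), and the term 1/M costs
-- less than one in total because n < M. Jensen moves the expectation into the exponent.
open Classical in
theorem card_hitSet_ge {n k M : ℕ} {F : CNFFormula n} (hF : IsKCNF k F) (hnM : n < M) (hk : 1 ≤ k)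
    {z : Fin n → Bool} (hz : Satisfies F z) :
    (M : ℝ) ^ n * (2 : ℝ) ^ (((n : ℝ) - edgesTo (solutions F) z) / k - 1) ≤
      (hitSet F M z).card := by
  have hM : 0 < M := by omega
  have hMR : (0 : ℝ) < M := by exact_mod_cast hM
  have hcard : (hitSet F M z).card = ∑ g : Fin n → Fin M,
      2 ^ (Finset.univ.filter fun i => Forced F z (fun l => (g l : ℕ)) i).card := by
    rw [hitSet, Finset.card_filter, Fintype.sum_prod_type]
    refine Finset.sum_congr rfl fun g _ => ?_
    rw [← card_hit_coins, Finset.card_filter]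
  rw [hcard]
  push_cast
  have hun : ((Finset.univ : Finset (Fin n → Fin M)).card : ℝ) = (M : ℝ) ^ n := by simp
  rw [← hun]
  have hJ := two_rpow_mean_le (Finset.univ : Finset (Fin n → Fin M))
    (fun g => ((Finset.univ.filter fun i => Forced F z (fun l => (g l : ℕ)) i).card : ℝ))
    (((n : ℝ) - edgesTo (solutions F) z) / k - 1) ?_
  · simpa only [Real.rpow_natCast] using hJ
  · rw [hun]
    have hswap : ∑ g : Fin n → Fin M,
        ((Finset.univ.filter fun i => Forced F z (fun l => (g l : ℕ)) i).card : ℝ) =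
        ∑ i, ((Finset.univ.filter fun g : Fin n → Fin M =>
          Forced F z (fun l => (g l : ℕ)) i).card : ℝ) := by
      simp only [Finset.card_filter]
      push_cast
      rw [Finset.sum_comm]
    rw [hswap]
    have hI : ((Finset.univ.filter fun i => flipBit z i ∉ solutions F).card : ℝ) =
        (n : ℝ) - edgesTo (solutions F) z := by
      have := Finset.card_filter_add_card_filter_not (s := (Finset.univ : Finset (Fin n)))
        (fun i => flipBit z i ∈ solutions F)
      rw [Finset.card_univ, Fintype.card_fin] at this
      have h : (((Finset.univ.filter fun i => flipBit z i ∈ solutions F).card : ℕ) : ℝ) +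
          (Finset.univ.filter fun i => flipBit z i ∉ solutions F).card = n := by
        exact_mod_cast this
      rw [edgesTo]
      linarith
    calc (M : ℝ) ^ n * (((n : ℝ) - edgesTo (solutions F) z) / k - 1)
        ≤ (M : ℝ) ^ n * (((n : ℝ) - edgesTo (solutions F) z) * (1 / k - 1 / M)) := by
          gcongr
          rw [← hI, mul_sub, mul_one_div, mul_one_div]
          have : ((Finset.univ.filter fun i => flipBit z i ∉ solutions F).card : ℝ) / M ≤ 1 := by
            rw [div_le_one hMR]
            have := Finset.card_le_univ (Finset.univ.filter fun i => flipBit z i ∉ solutions F)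
            rw [Fintype.card_fin] at this
            exact_mod_cast this.trans hnM.le
          linarith
      _ = ∑ i ∈ Finset.univ.filter fun i => flipBit z i ∉ solutions F,
            (M : ℝ) ^ n * (1 / k - 1 / M) := by
          rw [Finset.sum_const, nsmul_eq_mul, hI]; ring
      _ ≤ ∑ i ∈ Finset.univ.filter fun i => flipBit z i ∉ solutions F,
            ((Finset.univ.filter fun g : Fin n → Fin M =>
              Forced F z (fun l => (g l : ℕ)) i).card : ℝ) :=
          Finset.sum_le_sum fun i hi => card_forced hF hM hk hz (Finset.mem_filter.1 hi).2
      _ ≤ _ := Finset.sum_le_sum_of_subset_of_nonneg (Finset.filter_subset _ _)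
          fun _ _ _ => Nat.cast_nonneg _

/-- Take a difference `i` of smallest tag. If the coin decides `i` in both solutions, they agree
there. If `i` is forced in one of them, the other literals of the forcing clause lie at smaller
tags, so they are false in the other solution too, which must then satisfy the clause at `i` with
the same value. -/
theorem hit_unique {n : ℕ} {F : CNFFormula n} {z z' : Fin n → Bool} {g : Fin n → ℕ}
    {v : Fin n → Bool} (hz : Satisfies F z) (hz' : Satisfies F z') (h : Hit F z g v)
    (h' : Hit F z' g v) : z = z' := by
  by_contra hne
  obtain ⟨i, hi, hmin⟩ := Finset.exists_min_image (diffSet z z') g (by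
    obtain ⟨i, hi⟩ := Function.ne_iff.1 hne
    exact ⟨i, by simpa using hi⟩)
  have key : ∀ {z z' : Fin n → Bool}, Satisfies F z' → z i ≠ z' i →
      (∀ l, g l < g i → z l = z' l) → Forced F z g i → False := by
    rintro z z' hz' hi hmin ⟨C, hC, -, hall⟩
    obtain ⟨l, hl, hzl⟩ := hz' C hC
    rcases hall l hl with rfl | ⟨h1, h2⟩
    · exact hi hzl.symm
    · exact h1 ((hmin _ h2).trans hzl)
  have heq : ∀ l, g l < g i → z l = z' l := by
    intro l hl
    by_contra hne
    exact absurd (hmin l (by simpa using hne)) (by omega)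
  have hi' : z i ≠ z' i := by simpa using hi
  rcases h i with h1 | h1
  · rcases h' i with h2 | h2
    · exact hi' (h1.symm.trans h2)
    · exact key hz hi'.symm (fun l hl => (heq l hl).symm) h2
  · exact key hz' hi' heq h1

/-- The hit sets are disjoint by `hit_unique`, so their sizes add up. The weight is exactly what
remains of the sum after 2^(n/k - 1) is factored out. -/
theorem card_biUnion_hitSet_ge {n k M : ℕ} {F : CNFFormula n} (hF : IsKCNF k F) (hnM : n < M)
    (hk : 1 ≤ k) {A : Finset (Fin n → Bool)} (hA : A ⊆ solutions F)
    (hw : 1 / 2 ≤ searchWeight k (solutions F) A) :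
    (M : ℝ) ^ n * (2 : ℝ) ^ ((n : ℝ) / k - 2) ≤ (A.biUnion (hitSet F M)).card := by
  classical
  rw [Finset.card_biUnion]
  · push_cast
    have hMR : (0 : ℝ) < M := by exact_mod_cast (by omega : 0 < M)
    refine le_trans ?_ (Finset.sum_le_sum fun z hz =>
      card_hitSet_ge hF hnM hk (mem_solutions.1 (hA hz)))
    have h1 : ∀ z, (M : ℝ) ^ n * (2 : ℝ) ^ (((n : ℝ) - edgesTo (solutions F) z) / k - 1) =
        (M : ℝ) ^ n * (2 : ℝ) ^ ((n : ℝ) / k - 1) *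
          (2 : ℝ) ^ (-(edgesTo (solutions F) z : ℝ) / k) := by
      intro z
      rw [mul_assoc, ← Real.rpow_add (by norm_num)]
      congr 2
      ring
    simp only [h1]
    rw [← Finset.mul_sum]
    have h2 : (M : ℝ) ^ n * (2 : ℝ) ^ ((n : ℝ) / k - 2) =
        (M : ℝ) ^ n * (2 : ℝ) ^ ((n : ℝ) / k - 1) * (1 / 2) := by
      rw [mul_assoc]
      congr 1
      rw [show (n : ℝ) / k - 2 = ((n : ℝ) / k - 1) - 1 by ring, Real.rpow_sub_one (by norm_num)]
      ring
    rw [h2]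
    exact mul_le_mul_of_nonneg_left hw (by positivity)
  · intro z hz z' hz' hne
    refine Finset.disjoint_left.2 fun p hp hp' => hne ?_
    simp only [hitSet, Finset.mem_filter, Finset.mem_univ, true_and] at hp hp'
    exact hit_unique (mem_solutions.1 (hA hz)) (mem_solutions.1 (hA hz')) hp hp'

/-! ### The success probability of the random search -/

theorem tagOf_injective {τ τ' : ℕ → Bool} {c b : ℕ} (h : tagOf τ c b = tagOf τ' c b) :
    ∀ l < b, τ (c + l) = τ' (c + l) := by
  induction b with
  | zero => simp
  | succ b ih =>
    simp only [tagOf] at h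
    have h1 := Bool.toNat_le (τ (c + b))
    have h2 := Bool.toNat_le (τ' (c + b))
    have h3 : tagOf τ c b = tagOf τ' c b := by omega
    have h4 : (τ (c + b)).toNat = (τ' (c + b)).toNat := by omega
    intro l hl
    by_cases hlb : l = b
    · subst hlb
      revert h4
      cases τ (c + l) <;> cases τ' (c + l) <;> simp
    · exact ih h3 l (by omega)

/-- The tags and coins of the rounds of the random search. -/
def roundData {n b T : ℕ} (τ : Fin (T * (n * (b + 1))) → Bool) (t : Fin T) :
    (Fin n → Fin (2 ^ b)) × (Fin n → Bool) :=
  (fun i => ⟨tapeTags (extendTape τ) b (t * (n * (b + 1))) i, tagOf_lt _ _ _⟩,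
    tapeCoins (extendTape τ) b (t * (n * (b + 1))))

theorem roundData_injective {n b T : ℕ} :
    Function.Injective (roundData : (Fin (T * (n * (b + 1))) → Bool) → _) := by
  intro τ τ' h
  have key : ∀ p < T * (n * (b + 1)), extendTape τ p = extendTape τ' p := by
    intro p hp
    have hB : 0 < n * (b + 1) := by
      rcases Nat.eq_zero_or_pos (n * (b + 1)) with h0 | h0
      · rw [h0] at hp; omega
      · exact h0
    set t := p / (n * (b + 1)) with ht
    have htT : t < T := by rw [ht, Nat.div_lt_iff_lt_mul hB]; exact hp
    set r := p % (n * (b + 1)) with hr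
    have hrB : r < n * (b + 1) := Nat.mod_lt _ hB
    have hp' : p = t * (n * (b + 1)) + (r / (b + 1)) * (b + 1) + r % (b + 1) := by
      rw [add_assoc, Nat.div_add_mod', ht, hr, Nat.div_add_mod']
    have hi : r / (b + 1) < n := by rw [Nat.div_lt_iff_lt_mul (by omega)]; exact hrB
    have hl : r % (b + 1) < b + 1 := Nat.mod_lt _ (by omega)
    generalize r / (b + 1) = i at *
    generalize r % (b + 1) = l at *
    have h1 := congrFun h ⟨t, htT⟩
    rw [hp']
    by_cases hlb : l = b
    · subst hlb
      exact congrFun (congrArg Prod.snd h1) ⟨i, hi⟩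
    · have h2 := congrArg Fin.val (congrFun (congrArg Prod.fst h1) ⟨i, hi⟩)
      exact tagOf_injective h2 l (by omega)
  funext p
  have := key p p.2
  simpa [extendTape] using this

/-- Tapes correspond one to one to sequences of `T` independent choices of tags and coins, so the
probability of missing a set in all rounds is a `T`-th power. -/
theorem roundData_bijective {n b T : ℕ} :
    Function.Bijective (roundData : (Fin (T * (n * (b + 1))) → Bool) → _) := by
  rw [Fintype.bijective_iff_injective_and_card]
  refine ⟨roundData_injective, ?_⟩
  simp only [Fintype.card_fun, Fintype.card_prod, Fintype.card_fin, Fintype.card_bool]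
  rw [← pow_mul, ← pow_add, ← pow_mul]
  congr 1
  ring

open Classical in
theorem card_miss {n b T : ℕ} (H : Finset ((Fin n → Fin (2 ^ b)) × (Fin n → Bool))) :
    (Finset.univ.filter fun τ : Fin (T * (n * (b + 1))) → Bool => ∀ t, roundData τ t ∉ H).card =
      (2 ^ (n * (b + 1)) - H.card) ^ T := by
  have h1 : (Finset.univ.filter fun τ : Fin (T * (n * (b + 1))) → Bool =>
      ∀ t, roundData τ t ∉ H).card = (Fintype.piFinset fun _ : Fin T => Hᶜ).card := by
    refine Finset.card_bij (fun τ _ => roundData τ) ?_ ?_ ?_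
    · intro τ hτ; simpa using hτ
    · intro τ _ τ' _ h; exact roundData_injective h
    · intro β hβ
      obtain ⟨τ, rfl⟩ := roundData_bijective.2 β
      exact ⟨τ, by simpa using hβ, rfl⟩
  rw [h1, Fintype.card_piFinset]
  simp only [Finset.card_compl, Finset.prod_const, Finset.card_univ, Fintype.card_fin]
  congr 2
  simp only [Fintype.card_fun, Fintype.card_prod, Fintype.card_fin, Fintype.card_bool]
  rw [← pow_mul, ← pow_add]
  congr 1
  ring

-- With success probability p ≥ 2^(-n + n/k - 2) per round, the number of rounds is such that p T ≥
-- 2 (n+1)². Here the factor `2 ^ (k + 3) ≥ 8` pays for the 2^(-2) and leaves the 2. All rounds fail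
-- with probability (1-p)^T ≤ e^(-pT), and 1/e ≤ 1/2.
open Classical in
theorem card_miss_le {n k b : ℕ} {F : CNFFormula n} (hF : IsKCNF k F) (hnb : n < 2 ^ b)
    (hk : 1 ≤ k) {A : Finset (Fin n → Bool)} (hA : A ⊆ solutions F)
    (hw : 1 / 2 ≤ searchWeight k (solutions F) A) :
    ((Finset.univ.filter fun τ : Fin (trialCount k n * (n * (b + 1))) → Bool =>
      ∀ t, roundData τ t ∉ A.biUnion (hitSet F (2 ^ b))).card : ℝ) ≤
      2 ^ (trialCount k n * (n * (b + 1))) * (2 : ℝ)⁻¹ ^ (2 * (n + 1) ^ 2) := by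
  set H := A.biUnion (hitSet F (2 ^ b)) with hH
  have hHge := card_biUnion_hitSet_ge hF hnb hk hA hw
  rw [← hH] at hHge
  have hHle : H.card ≤ 2 ^ (n * (b + 1)) := by
    refine (Finset.card_le_univ H).trans (le_of_eq ?_)
    simp only [Fintype.card_fun, Fintype.card_prod, Fintype.card_fin, Fintype.card_bool]
    rw [← pow_mul, ← pow_add]
    congr 1
    ring
  rw [card_miss]
  set T := trialCount k n with hT
  set B : ℝ := 2 ^ (n * (b + 1)) with hB
  have hBpos : 0 < B := by positivity
  push_cast [Nat.cast_sub hHle]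
  rw [← hB]
  set p : ℝ := H.card / B with hp
  have hp1 : p ≤ 1 := by
    rw [hp, div_le_one hBpos, hB]; exact_mod_cast hHle
  have hBH : B - H.card = B * (1 - p) := by rw [hp]; field_simp
  rw [hBH, mul_pow, hB, ← pow_mul, mul_comm (n * (b + 1)) T]
  refine mul_le_mul_of_nonneg_left ?_ (by positivity)
  have hple : (2 : ℝ) ^ (n : ℕ) * p ≥ (2 : ℝ) ^ ((n : ℝ) / k - 2) := by
    rw [ge_iff_le, hp, mul_div_assoc', le_div_iff₀ hBpos, hB]
    have : (2 : ℝ) ^ (n * (b + 1)) = 2 ^ n * ((2 : ℝ) ^ b) ^ n := by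
      rw [← pow_mul, ← pow_add]; congr 1; ring
    rw [this]
    push_cast at hHge
    calc _ = 2 ^ n * (((2 : ℝ) ^ b) ^ n * (2 : ℝ) ^ ((n : ℝ) / k - 2)) := by ring
      _ ≤ _ := by gcongr
  have hpT : 2 * ((n : ℝ) + 1) ^ 2 ≤ p * T := by
    have hkn : n / k ≤ n := Nat.div_le_self _ _
    have h1 : (2 : ℝ) ^ (n / k) ≤ (2 : ℝ) ^ ((n : ℝ) / k) := by
      rw [← Real.rpow_natCast]
      exact Real.rpow_le_rpow_of_exponent_le (by norm_num) Nat.cast_div_le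
    have h2 : (2 : ℝ) ^ (n : ℕ) = 2 ^ (n - n / k) * 2 ^ (n / k) := by
      rw [← pow_add]; congr 1; omega
    have h3 : (1 : ℝ) ≤ 2 ^ (n - n / k) * p * 4 := by
      rw [Real.rpow_sub (by norm_num)] at hple
      norm_num at hple
      rw [h2] at hple
      have h4 : (2 : ℝ) ^ (n / k) ≤ 2 ^ (n - n / k) * 2 ^ (n / k) * p * 4 := by linarith
      have h5 : (0 : ℝ) < 2 ^ (n / k) := by positivity
      refine le_of_mul_le_mul_left ?_ h5
      linarith
    have h6 : (T : ℝ) = 2 ^ (n - n / k) * ((n : ℝ) + 1) ^ 2 * 2 ^ (k + 3) := by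
      rw [hT, trialCount]; push_cast; ring
    have h7 : (8 : ℝ) ≤ 2 ^ (k + 3) := by
      calc (8 : ℝ) = 2 ^ 3 := by norm_num
        _ ≤ 2 ^ (k + 3) := pow_le_pow_right₀ (by norm_num) (by omega)
    have hp0 : 0 ≤ p := by positivity
    rw [h6]
    calc 2 * ((n : ℝ) + 1) ^ 2 = 1 * (2 * ((n : ℝ) + 1) ^ 2) := by ring
      _ ≤ (2 ^ (n - n / k) * p * 4) * (2 * ((n : ℝ) + 1) ^ 2) := by gcongr
      _ = p * (2 ^ (n - n / k) * ((n : ℝ) + 1) ^ 2 * 8) := by ring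
      _ ≤ _ := by gcongr
  calc (1 - p) ^ T ≤ (Real.exp (-p)) ^ T := by
        gcongr
        exact Real.one_sub_le_exp_neg p
    _ = Real.exp (-(p * T)) := by rw [← Real.exp_nat_mul]; congr 1; ring
    _ ≤ Real.exp (-1 * ((2 * (n + 1) ^ 2 : ℕ) : ℝ)) := by
        rw [Real.exp_le_exp]; push_cast; linarith
    _ = (Real.exp (-1)) ^ (2 * (n + 1) ^ 2) := by rw [mul_comm, Real.exp_nat_mul]
    _ ≤ _ := by
        gcongr
        rw [Real.exp_neg]
        gcongr
        have := Real.add_one_le_exp (1 : ℝ)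
        linarith

/-! ### Richness of the solutions found -/

/-- What the random search is expected to find. -/
structure Rich {n : ℕ} (k : ℕ) (F : CNFFormula n) (H : Set (Fin n → Bool)) : Prop where
  near : ∀ y, Satisfies F y → ∀ P : Finset (Fin n),
    ∃ w ∈ H, k * (diffSet w y ∩ P).card ≤ P.card
  sparse : ∀ y, Satisfies F y → ∀ e : Equiv.Perm (Fin n), ∃ w ∈ H, ∀ S : Finset (Fin n),
    (∀ i ∈ S, ∀ l, e l ≤ e i → l ∈ S) → (k - 2) * (diffSet w y ∩ S).card ≤ S.card

/-- The solutions that are hit in some round. -/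
def hitSolutions {n b T : ℕ} (F : CNFFormula n) (τ : Fin (T * (n * (b + 1))) → Bool) :
    Set (Fin n → Bool) :=
  {z | Satisfies F z ∧ ∃ t, roundData τ t ∈ hitSet F (2 ^ b) z}

-- Union bound over at most 2^n solutions y, 2^n sets P and n! ≤ 2^(n²) rankings, together at most
-- 2^((n+1)²) events, each of probability at most 2^(-2(n+1)²).
open Classical in
theorem card_not_rich_le {n k b : ℕ} {F : CNFFormula n} (hF : IsKCNF k F) (hnb : n < 2 ^ b)
    (hk : 2 ≤ k) :
    ((Finset.univ.filter fun τ : Fin (trialCount k n * (n * (b + 1))) → Bool =>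
      ¬ Rich k F (hitSolutions F τ)).card : ℝ) ≤
      2 ^ (trialCount k n * (n * (b + 1))) * (2 : ℝ)⁻¹ ^ n := by
  let ι := {y // Satisfies F y} × (Finset (Fin n) ⊕ Equiv.Perm (Fin n))
  have hgood : ∀ x : ι, ∃ A ⊆ solutions F, 1 / 2 ≤ searchWeight k (solutions F) A ∧
      Sum.elim (fun P => ∀ w ∈ A, k * (diffSet w x.1.1 ∩ P).card ≤ P.card)
        (fun e => ∀ w ∈ A, ∀ S : Finset (Fin n),
          (∀ i ∈ S, ∀ l, e l ≤ e i → l ∈ S) → (k - 2) * (diffSet w x.1.1 ∩ S).card ≤ S.card)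
        x.2 := by
    rintro ⟨⟨y, hy⟩, P | e⟩
    · obtain ⟨j, hj, hw⟩ := exists_nearSet hk (mem_solutions.2 hy) P
      refine ⟨_, Finset.filter_subset _ _, hw, fun w hw => le_trans ?_ hj⟩
      exact Nat.mul_le_mul_left _ (Finset.mem_filter.1 hw).2
    · obtain ⟨j, hw⟩ := exists_sparseSet hk (mem_solutions.2 hy) e
      exact ⟨_, Finset.filter_subset _ _, hw, fun w hw S hS => sparseSet_lowerSet hw hS⟩
  choose A hAsub hAw hAprop using hgood
  have hsub : (Finset.univ.filter fun τ : Fin (trialCount k n * (n * (b + 1))) → Bool =>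
      ¬ Rich k F (hitSolutions F τ)) ⊆ Finset.univ.biUnion fun x : ι =>
        Finset.univ.filter fun τ : Fin (trialCount k n * (n * (b + 1))) → Bool =>
          ∀ t, roundData τ t ∉ (A x).biUnion (hitSet F (2 ^ b)) := by
    intro τ hτ
    simp only [Finset.mem_filter, Finset.mem_univ, true_and, Finset.mem_biUnion] at hτ ⊢
    by_contra hcon
    push Not at hcon
    have hw : ∀ x : ι, ∃ w ∈ A x, w ∈ hitSolutions F τ := by
      intro x
      obtain ⟨t, w, hw, ht⟩ := hcon x
      exact ⟨w, hw, mem_solutions.1 (hAsub x hw), t, ht⟩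
    refine hτ ⟨fun y hy P => ?_, fun y hy e => ?_⟩
    · obtain ⟨w, hw1, hw2⟩ := hw ⟨⟨y, hy⟩, Sum.inl P⟩
      exact ⟨w, hw2, hAprop ⟨⟨y, hy⟩, Sum.inl P⟩ w hw1⟩
    · obtain ⟨w, hw1, hw2⟩ := hw ⟨⟨y, hy⟩, Sum.inr e⟩
      exact ⟨w, hw2, hAprop ⟨⟨y, hy⟩, Sum.inr e⟩ w hw1⟩
  have hcard : Fintype.card ι ≤ 2 ^ ((n + 1) ^ 2) := by
    have h1 : Fintype.card {y // Satisfies F y} ≤ 2 ^ n :=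
      (Fintype.card_subtype_le _).trans (by simp)
    have h2 : Nat.factorial n ≤ 2 ^ (n * n) := by
      refine (Nat.factorial_le_pow n).trans ?_
      rw [pow_mul]
      exact Nat.pow_le_pow_left Nat.lt_two_pow_self.le _
    have h3 : 2 ^ n ≤ 2 ^ (n * n + n) := Nat.pow_le_pow_right (by simp) (by omega)
    have h4 : 2 ^ (n * n) ≤ 2 ^ (n * n + n) := Nat.pow_le_pow_right (by simp) (by omega)
    simp only [ι, Fintype.card_prod, Fintype.card_sum, Fintype.card_finset, Fintype.card_fin,
      Fintype.card_perm]
    calc _ ≤ 2 ^ n * (2 ^ (n * n + n) + 2 ^ (n * n + n)) :=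
          Nat.mul_le_mul h1 (Nat.add_le_add h3 (h2.trans h4))
      _ = 2 ^ ((n + 1) ^ 2) := by ring
  calc _ ≤ ((∑ x : ι, (Finset.univ.filter fun τ : Fin (trialCount k n * (n * (b + 1))) → Bool =>
          ∀ t, roundData τ t ∉ (A x).biUnion (hitSet F (2 ^ b))).card : ℕ) : ℝ) :=
        Nat.cast_le.2 ((Finset.card_le_card hsub).trans Finset.card_biUnion_le)
    _ ≤ ∑ x : ι, 2 ^ (trialCount k n * (n * (b + 1))) * (2 : ℝ)⁻¹ ^ (2 * (n + 1) ^ 2) := by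
        push_cast
        exact Finset.sum_le_sum fun x _ => card_miss_le hF hnb (by omega) (hAsub x) (hAw x)
    _ = (Fintype.card ι : ℝ) *
          (2 ^ (trialCount k n * (n * (b + 1))) * (2 : ℝ)⁻¹ ^ (2 * (n + 1) ^ 2)) := by simp
    _ ≤ (2 : ℝ) ^ ((n + 1) ^ 2) *
          (2 ^ (trialCount k n * (n * (b + 1))) * (2 : ℝ)⁻¹ ^ (2 * (n + 1) ^ 2)) := by
        gcongr
        exact_mod_cast hcard
    _ = 2 ^ (trialCount k n * (n * (b + 1))) * (2 : ℝ)⁻¹ ^ ((n + 1) ^ 2) := by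
        have : (2 : ℝ) ^ ((n + 1) ^ 2) * (2 : ℝ)⁻¹ ^ (2 * (n + 1) ^ 2) = (2 : ℝ)⁻¹ ^ ((n + 1) ^ 2) := by
          rw [two_mul, pow_add, ← mul_assoc, ← mul_pow]
          norm_num
        rw [← this]; ring
    _ ≤ _ := by
        refine mul_le_mul_of_nonneg_left ?_ (by positivity)
        refine pow_le_pow_of_le_one (by norm_num) (by norm_num) ?_
        nlinarith

/-! ### Local optima are nearly optimal -/

/-- The sum of the distances between `w` and the assignments `X j` with `j ∈ J`. -/
def farnessOn {n : ℕ} (J : Finset ℕ) (X : ℕ → Fin n → Bool) (w : Fin n → Bool) : ℕ :=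
  ∑ j ∈ J, hammingDist w (X j)

/-- The number of ones among the `i`-th bits of the assignments `X j` with `j ∈ J`. -/
def onesOn {n : ℕ} (J : Finset ℕ) (X : ℕ → Fin n → Bool) (i : Fin n) : ℕ :=
  (J.filter fun j => X j i = true).card

/-- The number of the assignments `X j` with `j ∈ J` whose `i`-th bit differs from `β`. -/
def missOn {n : ℕ} (J : Finset ℕ) (X : ℕ → Fin n → Bool) (i : Fin n) (β : Bool) : ℕ :=
  if β then J.card - onesOn J X i else onesOn J X i

theorem onesOn_le {n : ℕ} (J : Finset ℕ) (X : ℕ → Fin n → Bool) (i : Fin n) :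
    onesOn J X i ≤ J.card := Finset.card_filter_le _ _

theorem sum_ite_bool (J : Finset ℕ) (x : ℕ → Bool) (A B : ℕ) :
    ∑ j ∈ J, (if x j then A else B) = (J.filter fun j => x j = true).card * A +
      (J.card - (J.filter fun j => x j = true).card) * B := by
  rw [Finset.sum_ite, Finset.sum_const, Finset.sum_const, smul_eq_mul, smul_eq_mul]
  have := Finset.card_filter_add_card_filter_not (s := J) (fun j => x j = true)
  congr 2
  omega

theorem farnessOn_eq {n : ℕ} (J : Finset ℕ) (X : ℕ → Fin n → Bool) (w : Fin n → Bool) :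
    farnessOn J X w = ∑ i, missOn J X i (w i) := by
  simp only [farnessOn, hammingDist_eq_sum]
  rw [Finset.sum_comm]
  refine Finset.sum_congr rfl fun i _ => ?_
  have h1 := sum_ite_bool J (fun j => X j i) 1 0
  have h2 := sum_ite_bool J (fun j => X j i) 0 1
  simp only [mul_one, mul_zero, add_zero, zero_add] at h1 h2
  cases h : w i
  · simp only [missOn, Bool.false_eq_true, if_false, onesOn, ← h1]
    exact Finset.sum_congr rfl fun j _ => by cases X j i <;> rfl
  · simp only [missOn, if_true, onesOn, ← h2]
    exact Finset.sum_congr rfl fun j _ => by cases X j i <;> rfl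

theorem sum_farnessOn {n : ℕ} (I J : Finset ℕ) (O X : ℕ → Fin n → Bool) :
    ∑ l ∈ I, farnessOn J X (O l) = ∑ i, (onesOn I O i * (J.card - onesOn J X i) +
      (I.card - onesOn I O i) * onesOn J X i) := by
  simp only [farnessOn_eq]
  rw [Finset.sum_comm]
  refine Finset.sum_congr rfl fun i _ => ?_
  simp only [missOn]
  rw [sum_ite_bool]
  rfl

/-- The smallest possible value of `farnessOn J X`, all assignments being allowed. -/
def baseOn {n : ℕ} (J : Finset ℕ) (X : ℕ → Fin n → Bool) : ℕ :=
  ∑ i, min (J.card - onesOn J X i) (onesOn J X i)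

/-- The decrease of `farnessOn J X` if the `i`-th bit of `y` is flipped. -/
def lossOn {n : ℕ} (J : Finset ℕ) (X : ℕ → Fin n → Bool) (y : Fin n → Bool) (i : Fin n) : ℕ :=
  missOn J X i (y i) - missOn J X i (!y i)

theorem farnessOn_eq_base_add {n : ℕ} (J : Finset ℕ) (X : ℕ → Fin n → Bool) (y : Fin n → Bool) :
    farnessOn J X y = baseOn J X + ∑ i, lossOn J X y i := by
  rw [farnessOn_eq, baseOn, ← Finset.sum_add_distrib]
  refine Finset.sum_congr rfl fun i _ => ?_
  cases h : y i <;> simp [missOn, lossOn, h] <;> omega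

/-- Only the coordinates where `w` and `y` differ matter. If `y` has the nearer bit there, the
truncated loss is `0` and the change to `w` can only help. -/
theorem farnessOn_le_add {n : ℕ} (J : Finset ℕ) (X : ℕ → Fin n → Bool) (y w : Fin n → Bool) :
    farnessOn J X y ≤ farnessOn J X w + ∑ i ∈ diffSet w y, lossOn J X y i := by
  rw [farnessOn_eq, farnessOn_eq, diffSet, Finset.sum_filter, ← Finset.sum_add_distrib]
  refine Finset.sum_le_sum fun i _ => ?_
  by_cases h : w i = y i
  · simp [h]
  · have : w i = !y i := by cases h1 : w i <;> cases h2 : y i <;> simp_all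
    rw [if_pos h, this, lossOn]
    omega

/-- Rank the variables by decreasing weight (hence the order dual). Each set of variables of weight
above a threshold `v` is then an initial segment, where the density of differences is controlled;
summing over `v` recovers the weights. -/
theorem Rich.exists_weight {n k : ℕ} {F : CNFFormula n} {H : Set (Fin n → Bool)}
    (h : Rich k F H) {y : Fin n → Bool} (hy : Satisfies F y) (a : Fin n → ℕ) :
    ∃ w ∈ H, (k - 2) * ∑ i ∈ diffSet w y, a i ≤ ∑ i, a i := by
  set f : Fin n → ℕᵒᵈ := fun i => OrderDual.toDual (a i) with hf
  set e := (Tuple.sort f).symm with he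
  have hanti : ∀ i l, e l ≤ e i → a i ≤ a l := by
    intro i l hle
    have := Tuple.monotone_sort f hle
    simpa [he, hf] using this
  obtain ⟨w, hw, hS⟩ := h.sparse y hy e
  refine ⟨w, hw, ?_⟩
  set C := ∑ i, a i with hC
  have hcake : ∀ D : Finset (Fin n), ∑ i ∈ D, a i =
      ∑ v ∈ Finset.range C, (D ∩ Finset.univ.filter fun i => v < a i).card := by
    intro D
    have h1 : ∀ i, a i = ∑ v ∈ Finset.range C, if v < a i then 1 else 0 := by
      intro i
      rw [← Finset.card_filter]
      have : (Finset.range C).filter (fun v => v < a i) = Finset.range (a i) := by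
        ext v
        have hle : a i ≤ C := Finset.single_le_sum (fun _ _ => Nat.zero_le _) (Finset.mem_univ i)
        simp only [Finset.mem_filter, Finset.mem_range]
        omega
      rw [this, Finset.card_range]
    rw [Finset.sum_congr rfl fun i _ => h1 i, Finset.sum_comm]
    refine Finset.sum_congr rfl fun v _ => ?_
    rw [← Finset.card_filter]
    congr 1
    ext i
    simp
  have htot := hcake Finset.univ
  rw [hC, htot, hcake, Finset.mul_sum]
  refine Finset.sum_le_sum fun v _ => ?_
  rw [Finset.univ_inter]
  refine hS _ fun i hi l hl => ?_
  simp only [Finset.mem_filter, Finset.mem_univ, true_and] at hi ⊢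
  exact lt_of_lt_of_le hi (hanti i l hl)

/-- With a single nonzero weight there is only one level set to control, so the stronger density 1/k
of `Rich.near` applies. -/
theorem Rich.exists_const {n k c : ℕ} {F : CNFFormula n} {H : Set (Fin n → Bool)}
    (h : Rich k F H) {y : Fin n → Bool} (hy : Satisfies F y) {a : Fin n → ℕ}
    (ha : ∀ i, a i = 0 ∨ a i = c) : ∃ w ∈ H, k * ∑ i ∈ diffSet w y, a i ≤ ∑ i, a i := by
  obtain ⟨w, hw, hle⟩ := h.near y hy (Finset.univ.filter fun i => a i ≠ 0)
  refine ⟨w, hw, ?_⟩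
  have key : ∀ D : Finset (Fin n), ∑ i ∈ D, a i =
      (D ∩ Finset.univ.filter fun i => a i ≠ 0).card * c := by
    intro D
    rw [Finset.inter_filter, Finset.inter_univ, ← smul_eq_mul, ← Finset.sum_const,
      Finset.sum_filter]
    refine Finset.sum_congr rfl fun i _ => ?_
    rcases ha i with h0 | h0 <;> simp [h0]
  rw [key, key Finset.univ, Finset.univ_inter, ← mul_assoc]
  exact Nat.mul_le_mul_right _ hle

/-- One or two bits are either evenly split, with no loss, or unanimous. -/
theorem lossOn_of_card_le_two {n : ℕ} {J : Finset ℕ} (hJ : J.card ≤ 2) (X : ℕ → Fin n → Bool)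
    (y : Fin n → Bool) (i : Fin n) : lossOn J X y i = 0 ∨ lossOn J X y i = J.card := by
  have := onesOn_le J X i
  cases h : y i <;> simp [lossOn, missOn, h] <;> omega

/-- In terms of f = `farnessOn J X`, the conclusion reads q (f(y) - f(w)) ≤ f(y) - base. The right
side is the sum of all losses of `y`, and f(y) - f(w) is at most the sum over the differing
variables. -/
theorem Rich.exists_far {n k q : ℕ} {F : CNFFormula n} {H : Set (Fin n → Bool)}
    (h : Rich k F H) {J : Finset ℕ} (hq : q = k - 2 ∨ (q = k ∧ J.card ≤ 2)) {y : Fin n → Bool}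
    (hy : Satisfies F y) (X : ℕ → Fin n → Bool) :
    ∃ w ∈ H, q * farnessOn J X y + baseOn J X ≤ q * farnessOn J X w + farnessOn J X y := by
  have hex : ∃ w ∈ H, q * ∑ i ∈ diffSet w y, lossOn J X y i ≤ ∑ i, lossOn J X y i := by
    rcases hq with rfl | ⟨rfl, hJ⟩
    · exact h.exists_weight hy _
    · exact h.exists_const hy (lossOn_of_card_le_two hJ X y)
  obtain ⟨w, hw, hle⟩ := hex
  refine ⟨w, hw, ?_⟩
  have h1 := Nat.mul_le_mul_left q (farnessOn_le_add J X y w)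
  have h2 := farnessOn_eq_base_add J X y
  rw [mul_add] at h1
  omega

/-! ### Inequalities for local optima -/

theorem farness_eq_farnessOn {n : ℕ} (X : ℕ → Fin n → Bool) (m : ℕ) (w : Fin n → Bool) :
    farness X m w = farnessOn (Finset.range m) X w := rfl

/-- An exchange at position `j` compares the distances of `w` and `X j` to the remaining centers
only, so local optimality says exactly that no listed `w` is farther from them than `X j`. -/
theorem LocalOpt.farnessOn_le {n k q m j : ℕ} {F : CNFFormula n} {W : List (Fin n → Bool)}
    {X : ℕ → Fin n → Bool} (hX : LocalOpt W X m) (hR : Rich k F {z | z ∈ W}) (hj : j < m)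
    (hq : q = k - 2 ∨ (q = k ∧ m ≤ 3)) {y : Fin n → Bool} (hy : Satisfies F y) :
    q * farnessOn ((Finset.range m).erase j) X y + baseOn ((Finset.range m).erase j) X ≤
      q * farness X m (X j) + farnessOn ((Finset.range m).erase j) X y := by
  have hm := Finset.mem_range.2 hj
  obtain ⟨w, hw, hle⟩ := hR.exists_far (q := q) (J := (Finset.range m).erase j)
    (by rw [Finset.card_erase_of_mem hm, Finset.card_range]; omega) hy X
  have h1 := hX w hw j hj
  unfold Improves at h1
  have h2 : farness X m w = hammingDist w (X j) + farnessOn ((Finset.range m).erase j) X w :=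
    (Finset.add_sum_erase _ _ hm).symm
  have h3 : q * farnessOn ((Finset.range m).erase j) X w ≤ q * farness X m (X j) :=
    Nat.mul_le_mul_left _ (by omega)
  omega

/-- A coordinate with c ones and d zeros contributes 2cd on the left. If c ≠ d, removing a center
from the majority leaves a minimum equal to the minority, so the majority alone gives cd. If c = d,
the sum is 2c(c-1), which is at least c² for c ≥ 2; the case c = d = 1 is excluded by `m ≥ 3`. -/
theorem sum_baseOn_ge {n m : ℕ} (hm : 3 ≤ m) (X : ℕ → Fin n → Bool) :
    dispersion X m ≤ 2 * ∑ j ∈ Finset.range m, baseOn ((Finset.range m).erase j) X := by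
  simp only [baseOn, dispersion, farness_eq_farnessOn]
  rw [sum_farnessOn, Finset.sum_comm, Finset.mul_sum]
  refine Finset.sum_le_sum fun i _ => ?_
  have hc := onesOn_le (Finset.range m) X i
  obtain ⟨c, hcdef⟩ : ∃ c, c = onesOn (Finset.range m) X i := ⟨_, rfl⟩
  rw [← hcdef] at hc ⊢
  have h1 : ∀ j ∈ Finset.range m, min (((Finset.range m).erase j).card -
      onesOn ((Finset.range m).erase j) X i) (onesOn ((Finset.range m).erase j) X i) =
      if X j i then min (m - c) (c - 1) else min (m - 1 - c) c := by
    intro j hj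
    rw [Finset.card_erase_of_mem hj, Finset.card_range, onesOn, Finset.filter_erase]
    by_cases hx : X j i = true
    · have hmem : j ∈ (Finset.range m).filter fun j => X j i = true :=
        Finset.mem_filter.2 ⟨hj, hx⟩
      have hpos : 0 < c := hcdef ▸ Finset.card_pos.2 ⟨j, hmem⟩
      rw [Finset.card_erase_of_mem hmem, if_pos hx]
      change min (m - 1 - (onesOn (Finset.range m) X i - 1)) (onesOn (Finset.range m) X i - 1) = _
      rw [← hcdef]
      congr 1
      omega
    · rw [Finset.erase_eq_of_notMem (by simp [hx]), if_neg hx, hcdef]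
      rfl
  rw [Finset.sum_congr rfl h1, sum_ite_bool]
  change _ ≤ 2 * (onesOn (Finset.range m) X i * _ +
    ((Finset.range m).card - onesOn (Finset.range m) X i) * _)
  rw [← hcdef]
  clear h1 hcdef
  rw [Finset.card_range] at hc ⊢
  obtain ⟨d, rfl⟩ : ∃ d, m = c + d := ⟨m - c, by omega⟩
  rw [Nat.add_sub_cancel_left]
  rcases Nat.lt_trichotomy c d with hlt | heq | hgt
  · rw [min_eq_right (show c ≤ c + d - 1 - c by omega)]
    nlinarith [Nat.zero_le (c * min d (c - 1))]
  · subst heq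
    rw [min_eq_right (by omega), min_eq_left (by omega)]
    obtain ⟨e, rfl⟩ : ∃ e, c = e + 2 := ⟨c - 2, by omega⟩
    have e1 : e + 2 - 1 = e + 1 := by omega
    have e2 : e + 2 + (e + 2) - 1 - (e + 2) = e + 1 := by omega
    rw [e1, e2]
    nlinarith
  · rw [min_eq_left (show d ≤ c - 1 by omega)]
    nlinarith [Nat.zero_le (d * min (c + d - 1 - c) c)]

theorem sum_farnessOn_erase {n : ℕ} (X : ℕ → Fin n → Bool) (m : ℕ) (y : Fin n → Bool) :
    ∑ j ∈ Finset.range m, farnessOn ((Finset.range m).erase j) X y + farness X m y =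
      m * farness X m y := by
  have h : ∀ j ∈ Finset.range m, hammingDist y (X j) + farnessOn ((Finset.range m).erase j) X y =
      farness X m y := fun j hj => Finset.add_sum_erase _ (fun j => hammingDist y (X j)) hj
  have h2 := Finset.sum_congr rfl h
  rw [Finset.sum_add_distrib, Finset.sum_const, Finset.card_range, smul_eq_mul] at h2
  rw [← h2, add_comm]
  rfl

/-- Hamming distance is a squared Euclidean distance, so this is nonnegativity of the squared
distance between the two centroids: in each coordinate it is a perfect square. -/
theorem cross_ge {n : ℕ} (O X : ℕ → Fin n → Bool) (s m : ℕ) :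
    s ^ 2 * dispersion X m + m ^ 2 * dispersion O s ≤
      2 * m * s * ∑ l ∈ Finset.range s, farness X m (O l) := by
  simp only [dispersion, farness_eq_farnessOn, sum_farnessOn, Finset.mul_sum, Finset.card_range]
  rw [← Finset.sum_add_distrib]
  refine Finset.sum_le_sum fun i _ => ?_
  have hc := onesOn_le (Finset.range m) X i
  have ho := onesOn_le (Finset.range s) O i
  rw [Finset.card_range] at hc ho
  generalize onesOn (Finset.range m) X i = c at *
  generalize onesOn (Finset.range s) O i = o at *
  obtain ⟨d, rfl⟩ : ∃ d, m = c + d := ⟨m - c, by omega⟩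
  obtain ⟨p, rfl⟩ : ∃ p, s = o + p := ⟨s - o, by omega⟩
  simp only [Nat.add_sub_cancel_left]
  zify
  nlinarith [sq_nonneg ((p : ℤ) * c - d * o)]

/-- Comparison of a local optimum with arbitrary solutions. -/
theorem LocalOpt.dispersion_le {n k q m s : ℕ} {F : CNFFormula n} {W : List (Fin n → Bool)}
    {X O : ℕ → Fin n → Bool} (hX : LocalOpt W X m) (hR : Rich k F {z | z ∈ W}) (hm : 3 ≤ m)
    (hq : q = k - 2 ∨ (q = k ∧ m ≤ 3)) (hq1 : 1 ≤ q) (hO : ∀ l < s, Satisfies F (O l)) :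
    ((q : ℝ) - 1) * (m - 1) * m ^ 2 * dispersion O s ≤
      s ^ 2 * (m * q + q - 1) * dispersion X m := by
  -- Sum the local optimality over all positions `j`: the distances from `O l` to the other centers
  -- add up to m-1 times its farness, and the base terms to at least half the dispersion.
  have h1 : ∀ l ∈ Finset.range s, 2 * ((q : ℝ) - 1) * (m - 1) * farness X m (O l) ≤
      (2 * q - 1) * dispersion X m := by
    intro l hl
    have hsum := Finset.sum_le_sum fun j (hj : j ∈ Finset.range m) =>
      hX.farnessOn_le hR (Finset.mem_range.1 hj) hq (hO l (Finset.mem_range.1 hl))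
    rw [Finset.sum_add_distrib, Finset.sum_add_distrib, ← Finset.mul_sum, ← Finset.mul_sum] at hsum
    have hb := sum_baseOn_ge hm X
    have hf := sum_farnessOn_erase X m (O l)
    change _ ≤ q * dispersion X m + _ at hsum
    generalize ∑ j ∈ Finset.range m, farnessOn ((Finset.range m).erase j) X (O l) = A at *
    generalize ∑ j ∈ Finset.range m, baseOn ((Finset.range m).erase j) X = B at *
    generalize farness X m (O l) = f at *
    generalize dispersion X m = D at *
    have hsum' : (q : ℝ) * A + B ≤ q * D + A := by exact_mod_cast hsum
    have hb' : (D : ℝ) ≤ 2 * B := by exact_mod_cast hb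
    have hf' : (A : ℝ) + f = m * f := by exact_mod_cast hf
    have hA : (A : ℝ) = (m - 1) * f := by linarith
    rw [hA] at hsum'
    linarith
  have h2 := Finset.sum_le_sum h1
  rw [← Finset.mul_sum, Finset.sum_const, Finset.card_range, nsmul_eq_mul] at h2
  have h3 := cross_ge O X s m
  have h3' : (s : ℝ) ^ 2 * dispersion X m + m ^ 2 * dispersion O s ≤
      2 * m * s * ∑ l ∈ Finset.range s, (farness X m (O l) : ℝ) := by exact_mod_cast h3
  generalize ∑ l ∈ Finset.range s, (farness X m (O l) : ℝ) = C at *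
  have hq1' : (0 : ℝ) ≤ q - 1 := by
    have : (1 : ℝ) ≤ q := by exact_mod_cast hq1
    linarith
  have hm1' : (0 : ℝ) ≤ m - 1 := by
    have : (3 : ℝ) ≤ m := by exact_mod_cast hm
    linarith
  have h4 := mul_le_mul_of_nonneg_left h3' (mul_nonneg hq1' hm1')
  have h5 := mul_le_mul_of_nonneg_left h2 (by positivity : (0 : ℝ) ≤ m * s)
  linarith

/-! ### The quality of the output -/

/-- With two centers `sum_baseOn_ge` is not available. Here both optimal solutions are at distance
at most k/(k-1) times d(X 0, X 1) from `X 0`, and the triangle inequality suffices. -/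
theorem LocalOpt.dispersion_le_two {n k : ℕ} {F : CNFFormula n} {W : List (Fin n → Bool)}
    {X O : ℕ → Fin n → Bool} (hX : LocalOpt W X 2) (hR : Rich k F {z | z ∈ W})
    (hO : ∀ l < 2, Satisfies F (O l)) :
    ((k : ℝ) - 1) * dispersion O 2 ≤ 2 * k * dispersion X 2 := by
  have hJ : (Finset.range 2).erase 1 = {0} := by decide
  have hd : ∀ Z : ℕ → Fin n → Bool, dispersion Z 2 = 2 * hammingDist (Z 0) (Z 1) := by
    intro Z
    simp [dispersion, farness, Finset.sum_range_succ, hammingDist_comm (Z 1) (Z 0)]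
    ring
  have h1 : ∀ l < 2, k * hammingDist (O l) (X 0) ≤
      k * hammingDist (X 0) (X 1) + hammingDist (O l) (X 0) := by
    intro l hl
    have := hX.farnessOn_le hR (show 1 < 2 by omega) (Or.inr ⟨rfl, by omega⟩) (hO l hl)
    rw [hJ] at this
    simp only [farnessOn, Finset.sum_singleton, farness, Finset.sum_range_succ, Finset.sum_range_zero,
      hammingDist_self, hammingDist_comm (X 1) (X 0), zero_add, add_zero] at this
    omega
  have h2 := h1 0 (by omega)
  have h3 := h1 1 (by omega)
  have h4 := hammingDist_triangle (O 0) (X 0) (O 1)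
  rw [hammingDist_comm (X 0) (O 1)] at h4
  rw [hd, hd]
  rcases Nat.eq_zero_or_pos k with rfl | hk
  · push_cast
    have : (0 : ℝ) ≤ hammingDist (O 0) (O 1) := by positivity
    linarith
  generalize hammingDist (O 0) (O 1) = d at *
  generalize hammingDist (O 0) (X 0) = d₀ at *
  generalize hammingDist (O 1) (X 0) = d₁ at *
  generalize hammingDist (X 0) (X 1) = x at *
  have h2' : (k : ℝ) * d₀ ≤ k * x + d₀ := by exact_mod_cast h2
  have h3' : (k : ℝ) * d₁ ≤ k * x + d₁ := by exact_mod_cast h3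
  have h4' : (d : ℝ) ≤ d₀ + d₁ := by exact_mod_cast h4
  have hk' : (0 : ℝ) ≤ k - 1 := by
    have : (1 : ℝ) ≤ k := by exact_mod_cast hk
    linarith
  have h5 := mul_le_mul_of_nonneg_left h4' hk'
  push_cast
  linarith

theorem sum_range_three_mul (g : ℕ → ℕ) (b : ℕ) :
    ∑ l ∈ Finset.range (3 * b), g (l % 3) = b * (g 0 + g 1 + g 2) := by
  induction b with
  | zero => simp
  | succ b ih =>
    rw [show 3 * (b + 1) = 3 * b + 1 + 1 + 1 by ring, Finset.sum_range_succ, Finset.sum_range_succ,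
      Finset.sum_range_succ, ih, show 3 * b % 3 = 0 by omega, show (3 * b + 1) % 3 = 1 by omega,
      show (3 * b + 1 + 1) % 3 = 2 by omega]
    ring

/-- The three assignments appear with multiplicities that differ by at most one. For remainder `1`
the first has one copy more, and the pair without it is paid for by the triangle inequality; the
remainders `0` and `2` need no inequality between the distances. -/
theorem dispersion_cyclic {n : ℕ} (Y : ℕ → Fin n → Bool) (s : ℕ) :
    s / 3 * (s - s / 3) * dispersion Y 3 ≤ 2 * dispersion (fun j => Y (j % 3)) s := by
  obtain ⟨b, e, he, rfl⟩ : ∃ b e, e < 3 ∧ s = 3 * b + e :=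
    ⟨s / 3, s % 3, Nat.mod_lt _ (by omega), by omega⟩
  have hb : (3 * b + e) / 3 = b := by omega
  have hs : 3 * b + e - b = 2 * b + e := by omega
  rw [hb, hs]
  simp only [dispersion, farness]
  have htri := hammingDist_triangle (Y 1) (Y 0) (Y 2)
  rw [hammingDist_comm (Y 1) (Y 0)] at htri
  have h0 : 3 * b % 3 = 0 := by omega
  have h1 : (3 * b + 1) % 3 = 1 := by omega
  have key : ∀ g : ℕ → ℕ, ∑ l ∈ Finset.range (3 * b + e), g (l % 3) =
      b * (g 0 + g 1 + g 2) + (if 0 < e then g 0 else 0) + (if 1 < e then g 1 else 0) := by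
    intro g
    interval_cases e
    · simp [sum_range_three_mul]
    · rw [Finset.sum_range_succ, sum_range_three_mul, h0]; simp
    · rw [show 3 * b + 2 = 3 * b + 1 + 1 by ring, Finset.sum_range_succ, Finset.sum_range_succ,
        sum_range_three_mul, h0, h1]
      simp
  rw [key fun j => ∑ l ∈ Finset.range (3 * b + e), hammingDist (Y j) (Y (l % 3))]
  have key' : ∀ j, ∑ l ∈ Finset.range (3 * b + e), hammingDist (Y j) (Y (l % 3)) = _ :=
    fun j => key fun l => hammingDist (Y j) (Y l)
  simp only [key', Finset.sum_range_succ, Finset.sum_range_zero, hammingDist_self,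
    hammingDist_comm (Y 1) (Y 0), hammingDist_comm (Y 2) (Y 0), hammingDist_comm (Y 2) (Y 1)]
  generalize hammingDist (Y 0) (Y 1) = p at *
  generalize hammingDist (Y 0) (Y 2) = q at *
  generalize hammingDist (Y 1) (Y 2) = r at *
  have hbt : b * r ≤ b * (p + q) := Nat.mul_le_mul_left _ htri
  interval_cases e
  · simp; nlinarith
  · simp; nlinarith
  · simp; nlinarith [Nat.zero_le (b * p)]

theorem target_eq {k s : ℝ} (hk : 2 ≤ k) (hs : 1 ≤ s) :
    (k - 1) / (k + 3) * ((1 - 1 / s) / (1 + (k - 1) / (k + 3) * (1 / s))) =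
      (k - 1) * (s - 1) / ((k + 3) * s + (k - 1)) := by
  have h1 : k + 3 ≠ 0 := by linarith
  have h2 : s ≠ 0 := by linarith
  have h3 : (k + 3) * s + (k - 1) ≠ 0 := by nlinarith
  field_simp

/-- The two bounds of the theorem for the dispersions `a` of the output and `o` of an optimum. -/
def QualityBounds (k s : ℕ) (a o : ℝ) : Prop :=
  (s ≤ 3 + ⌊(4 : ℝ) / ((k : ℝ) - 1)⌋₊ → 1 / 2 * (1 - 2 / ((k : ℝ) + 1)) * o ≤ a) ∧
  (3 + ⌈(4 : ℝ) / ((k : ℝ) - 1)⌉₊ ≤ s →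
    ((k : ℝ) - 1) / ((k : ℝ) + 3) *
      ((1 - 1 / (s : ℝ)) / (1 + ((k : ℝ) - 1) / ((k : ℝ) + 3) * (1 / (s : ℝ)))) * o ≤ a)

/-- Both ranges of `s` reduce to comparing (s-3)(k-1) with `4`, which removes the floor and the
ceiling. The second range forces `4 ≤ s`, because the ceiling is positive. -/
theorem qualityBounds_of {k s : ℕ} {a o : ℝ} (hk : 2 ≤ k) (hs : 1 ≤ s)
    (h1 : (s - 3) * (k - 1) ≤ 4 → ((k : ℝ) - 1) * o ≤ 2 * (k + 1) * a)
    (h2 : 4 ≤ s → 4 ≤ (s - 3) * (k - 1) →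
      ((k : ℝ) - 1) * (s - 1) * o ≤ ((k + 3) * s + (k - 1)) * a) : QualityBounds k s a o := by
  have hkR : (2 : ℝ) ≤ k := by exact_mod_cast hk
  have hk1 : (0 : ℝ) < k - 1 := by linarith
  have hk1' : ((k - 1 : ℕ) : ℝ) = k - 1 := by push_cast [Nat.cast_sub (show 1 ≤ k by omega)]; rfl
  have hsR : (1 : ℝ) ≤ s := by exact_mod_cast hs
  refine ⟨fun h => ?_, fun h => ?_⟩
  · have h3 : (s - 3) * (k - 1) ≤ 4 := by
      have h4 : s - 3 ≤ ⌊(4 : ℝ) / ((k : ℝ) - 1)⌋₊ := by omega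
      have h5 : ((s - 3 : ℕ) : ℝ) ≤ 4 / ((k : ℝ) - 1) :=
        (Nat.cast_le.2 h4).trans (Nat.floor_le (by positivity))
      rw [le_div_iff₀ hk1, ← hk1'] at h5
      exact_mod_cast h5
    have h4 := h1 h3
    have h5 : 1 / 2 * (1 - 2 / ((k : ℝ) + 1)) * o = ((k : ℝ) - 1) * o / (2 * (k + 1)) := by
      field_simp
      ring
    rw [h5, div_le_iff₀ (by positivity)]
    linarith
  · have h4 : ⌈(4 : ℝ) / ((k : ℝ) - 1)⌉₊ ≤ s - 3 := by omega
    have h5 : 4 / ((k : ℝ) - 1) ≤ ((s - 3 : ℕ) : ℝ) := (Nat.le_ceil _).trans (Nat.cast_le.2 h4)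
    rw [div_le_iff₀ hk1, ← hk1'] at h5
    have h6 : 4 ≤ (s - 3) * (k - 1) := by exact_mod_cast h5
    have h7 : 4 ≤ s := by
      by_contra hlt
      rw [show s - 3 = 0 by omega] at h6
      omega
    rw [target_eq hkR hsR, div_mul_eq_mul_div, div_le_iff₀ (by nlinarith)]
    linarith [h2 h7 h6]

theorem dispersion_mod_self {n : ℕ} (Y : ℕ → Fin n → Bool) (s : ℕ) :
    dispersion (fun j => Y (j % s)) s = dispersion Y s := by
  simp only [dispersion, farness]
  refine Finset.sum_congr rfl fun j hj => Finset.sum_congr rfl fun l hl => ?_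
  rw [Nat.mod_eq_of_lt (Finset.mem_range.1 hj), Nat.mod_eq_of_lt (Finset.mem_range.1 hl)]

/-- `LocalOpt.dispersion_le` with q = k-2 and m = s gives the ratio (k-3)(s-1) / (s(k-2) + k-3).
After cross-multiplication it beats the second target by s(3k-11), which is positive from k = 4 on.
-/
theorem quality_of_four_le {n k s : ℕ} {F : CNFFormula n} {W : List (Fin n → Bool)}
    {X O : ℕ → Fin n → Bool} {a : ℝ} (hk : 4 ≤ k) (hs : 4 ≤ s) (hX : LocalOpt W X s)
    (hR : Rich k F {z | z ∈ W}) (hO : ∀ l < s, Satisfies F (O l)) (ha : (dispersion X s : ℝ) ≤ a) :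
    QualityBounds k s a (dispersion O s) := by
  have h := hX.dispersion_le hR (q := k - 2) (by omega) (Or.inl rfl) (by omega) hO
  have ho : (0 : ℝ) ≤ dispersion O s := Nat.cast_nonneg _
  have hx : (0 : ℝ) ≤ dispersion X s := Nat.cast_nonneg _
  have hk2 : ((k - 2 : ℕ) : ℝ) = k - 2 := by push_cast [Nat.cast_sub (show 2 ≤ k by omega)]; rfl
  rw [hk2] at h
  generalize (dispersion O s : ℝ) = o at *
  generalize (dispersion X s : ℝ) = x at *
  have hkR : (4 : ℝ) ≤ k := by exact_mod_cast hk
  have hsR : (4 : ℝ) ≤ s := by exact_mod_cast hs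
  have h' : ((k : ℝ) - 3) * (s - 1) * o ≤ (s * (k - 2) + k - 3) * x := by
    have hs2 : (0 : ℝ) < (s : ℝ) ^ 2 := by positivity
    refine le_of_mul_le_mul_left ?_ hs2
    linarith
  refine qualityBounds_of (by omega) (by omega) (fun hc => ?_) fun _ _ => ?_
  -- In the range of the first bound only s = 4 with k = 4 or k = 5 is left.
  · have hs4 : s = 4 := by
      by_contra hne
      have : 2 * 3 ≤ (s - 3) * (k - 1) := Nat.mul_le_mul (by omega) (by omega)
      omega
    subst hs4
    have hk5 : k ≤ 5 := by omega
    interval_cases k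
    · norm_num at h' ⊢; linarith
    · norm_num at h' ⊢; linarith
  · have h3 : (0 : ℝ) < k - 3 := by linarith
    refine le_of_mul_le_mul_left ?_ h3
    have h4 : ((k : ℝ) - 1) * (((k : ℝ) - 3) * (s - 1) * o) ≤
        (k - 1) * ((s * (k - 2) + k - 3) * x) := mul_le_mul_of_nonneg_left h' (by linarith)
    have h5 : ((k : ℝ) - 1) * ((s * (k - 2) + k - 3) * x) ≤
        (k - 3) * (((k + 3) * s + (k - 1)) * x) := by
      have h6 : (0 : ℝ) ≤ s * (3 * k - 11) * x :=
        mul_nonneg (mul_nonneg (by linarith) (by linarith)) hx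
      linarith
    have h7 : ((k : ℝ) - 3) * (((k + 3) * s + (k - 1)) * x) ≤
        (k - 3) * (((k + 3) * s + (k - 1)) * a) := by
      have : (0 : ℝ) ≤ (k + 3) * s + (k - 1) := by nlinarith
      gcongr
    linarith

/-- Three centers and q = k give the ratio 2(k-1)/(4k-1) when 3 divides s, that is 2/7 or 4/11,
against the limits 1/5 and 1/3 of the second target. This slack absorbs the loss for the other
values of s. -/
theorem quality_of_le_three {n k s : ℕ} {F : CNFFormula n} {W : List (Fin n → Bool)}
    {X O Y : ℕ → Fin n → Bool} (hk : 2 ≤ k) (hk3 : k ≤ 3) (hs : 4 ≤ s) (hX : LocalOpt W X 3)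
    (hR : Rich k F {z | z ∈ W}) (hO : ∀ l < s, Satisfies F (O l))
    (hXY : dispersion X 3 ≤ dispersion Y 3) :
    QualityBounds k s (dispersion (fun j => Y (j % 3)) s) (dispersion O s) := by
  have h := hX.dispersion_le hR (q := k) (by omega) (Or.inr ⟨rfl, le_rfl⟩) (by omega) hO
  have hy := dispersion_cyclic Y s
  have hxy : s / 3 * (s - s / 3) * dispersion X 3 ≤ 2 * dispersion (fun j => Y (j % 3)) s :=
    (Nat.mul_le_mul_left _ hXY).trans hy
  clear hy hXY
  obtain ⟨b, e, he, hb, rfl⟩ : ∃ b e, e < 3 ∧ 1 ≤ b ∧ s = 3 * b + e :=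
    ⟨s / 3, s % 3, Nat.mod_lt _ (by omega), by omega, by omega⟩
  have hb' : (3 * b + e) / 3 = b := by omega
  have hs' : 3 * b + e - b = 2 * b + e := by omega
  rw [hb', hs'] at hxy
  have hx : (0 : ℝ) ≤ dispersion X 3 := Nat.cast_nonneg _
  have hxy' : (b : ℝ) * (2 * b + e) * dispersion X 3 ≤
      2 * dispersion (fun j => Y (j % 3)) (3 * b + e) := by exact_mod_cast hxy
  generalize (dispersion (fun j => Y (j % 3)) (3 * b + e) : ℝ) = a at *
  generalize (dispersion O (3 * b + e) : ℝ) = o at *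
  generalize (dispersion X 3 : ℝ) = x at *
  refine qualityBounds_of (by omega) (by omega) (fun hc => ?_) fun _ _ => ?_
  · have hb2 : b ≤ 2 := by
      by_contra hlt
      have : 6 * 1 ≤ (3 * b + e - 3) * (k - 1) := Nat.mul_le_mul (by omega) (by omega)
      omega
    interval_cases k <;> interval_cases b <;> interval_cases e <;>
      first
        | omega
        | (norm_num at h hxy' ⊢; linarith)
  · obtain ⟨c, rfl⟩ : ∃ c, b = c + 1 := ⟨b - 1, by omega⟩
    have hcc : (0 : ℝ) ≤ c := Nat.cast_nonneg _
    have hp1 : (0 : ℝ) ≤ c * x := by positivity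
    have hp2 : (0 : ℝ) ≤ c ^ 2 * x := by positivity
    have hp3 : (0 : ℝ) ≤ c ^ 3 * x := by positivity
    have hs0 : (0 : ℝ) ≤ (3 * (c + 1) + e : ℕ) - 1 := by push_cast; linarith [Nat.cast_nonneg (α := ℝ) e]
    have h1 := mul_le_mul_of_nonneg_left h hs0
    have h2 := mul_le_mul_of_nonneg_left hxy' (show (0 : ℝ) ≤ (k + 3) * (3 * (c + 1) + e : ℕ) + (k - 1) by
      have : (2 : ℝ) ≤ k := by exact_mod_cast hk
      have : (0 : ℝ) ≤ (k + 3) * (3 * (c + 1) + e : ℕ) := by positivity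
      linarith)
    interval_cases k <;> interval_cases e <;> push_cast at * <;> nlinarith

theorem Rich.mono {n k : ℕ} {F : CNFFormula n} {H H' : Set (Fin n → Bool)} (h : Rich k F H)
    (hH : H ⊆ H') : Rich k F H' where
  near y hy P := (h.near y hy P).imp fun _ hw => ⟨hH hw.1, hw.2⟩
  sparse y hy e := (h.sparse y hy e).imp fun _ hw => ⟨hH hw.1, hw.2⟩

theorem QualityBounds.const_mul {k s : ℕ} {a o c : ℝ} (h : QualityBounds k s a o) (hc : 0 ≤ c) :
    QualityBounds k s (c * a) (c * o) := by
  refine ⟨fun hs => ?_, fun hs => ?_⟩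
  · rw [mul_left_comm]
    exact mul_le_mul_of_nonneg_left (h.1 hs) hc
  · rw [mul_left_comm]
    exact mul_le_mul_of_nonneg_left (h.2 hs) hc

/-- For s ≤ 3 there are s centers, the fraction 1/k applies and only the first bound is at stake.
For s = 3 the ratio is 2(k-1)/(4k-1), slightly above the required 2(k-1)/(4k+4). -/
theorem GoodCenters.quality {n k s : ℕ} {F : CNFFormula n} {W : List (Fin n → Bool)}
    {O Y : ℕ → Fin n → Bool} (hk : 2 ≤ k) (hs : 1 ≤ s) (hY : GoodCenters W (centers k s) Y)
    (hR : Rich k F {z | z ∈ W}) (hO : ∀ l < s, Satisfies F (O l)) :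
    QualityBounds k s (dispersion (fun j => Y (j % centers k s)) s) (dispersion O s) := by
  obtain ⟨-, X, -, hX, hXY⟩ := hY
  have hkR : (2 : ℝ) ≤ k := by exact_mod_cast hk
  have hxyR : (dispersion X (centers k s) : ℝ) ≤ dispersion Y (centers k s) := by
    exact_mod_cast hXY
  by_cases hs4 : 4 ≤ s
  · by_cases hk4 : 4 ≤ k
    · have hc : centers k s = s := if_neg (by omega)
      rw [hc] at hX hxyR ⊢
      rw [dispersion_mod_self]
      exact quality_of_four_le hk4 hs4 hX hR hO hxyR
    · have hc : centers k s = 3 := by rw [centers, if_pos (by omega), min_eq_right (by omega)]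
      rw [hc] at hX hXY ⊢
      exact quality_of_le_three hk (by omega) hs4 hX hR hO hXY
  · have hc : centers k s = s := by
      rw [centers]
      split_ifs
      · exact min_eq_left (by omega)
      · rfl
    rw [hc] at hX hxyR ⊢
    rw [dispersion_mod_self]
    have hx : (0 : ℝ) ≤ dispersion X s := Nat.cast_nonneg _
    refine qualityBounds_of hk hs (fun _ => ?_) fun h => absurd h hs4
    have hle : 2 * ((k : ℝ) + 1) * dispersion X s ≤ 2 * (k + 1) * dispersion Y s :=
      mul_le_mul_of_nonneg_left hxyR (by positivity)
    obtain rfl | rfl | rfl : s = 1 ∨ s = 2 ∨ s = 3 := by omega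
    · have h0 : dispersion O 1 = 0 := by simp [dispersion, farness]
      rw [h0, Nat.cast_zero, mul_zero]
      positivity
    · have := hX.dispersion_le_two hR hO
      linarith
    · have := hX.dispersion_le hR (q := k) le_rfl (Or.inr ⟨rfl, le_rfl⟩) (by omega) hO
      push_cast at this
      linarith

/-! ### Multisets of assignments as sequences -/

theorem sumPD_map_fin {n s : ℕ} (O : ℕ → Fin n → Bool) :
    sumPD ((Finset.univ : Finset (Fin s)).val.map fun j : Fin s => O j) = 1 / 2 * dispersion O s := by
  simp only [sumPD, Multiset.map_map, Function.comp_def, dispersion, farness]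
  push_cast
  rw [← Fin.sum_univ_eq_sum_range (fun j => ∑ l ∈ Finset.range s, (hammingDist (O j) (O l) : ℝ))]
  simp only [← Fin.sum_univ_eq_sum_range (fun l => (hammingDist (O _) (O l) : ℝ))]
  rfl

theorem exists_eq_map_fin {α : Type*} {S : Multiset α} {s : ℕ} (hS : S.card = s) [Inhabited α] :
    ∃ O : ℕ → α, S = (Finset.univ : Finset (Fin s)).val.map fun j : Fin s => O j := by
  subst hS
  induction S using Quotient.inductionOn with
  | h l =>
    refine ⟨fun j => l.getD j default, ?_⟩
    rw [Multiset.quot_mk_to_coe, Fin.univ_val_map]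
    refine congrArg _ (List.ext_getElem (by simp) fun i h₁ h₂ => ?_)
    simp

theorem outputMultiset_eq (n s : ℕ) (σ : RamState) :
    outputMultiset n s σ = (Finset.univ : Finset (Fin s)).val.map
      fun j : Fin s => fun i : Fin n => decide (σ.arr 2 ((j : ℕ) * n + i) ≠ 0) := by
  simp only [outputMultiset, Multiset.bind_def, Multiset.pure_def, Multiset.bind_singleton,
    Multiset.map_map, Function.comp_def]

/-! ### The main theorem -/

/-- The conditions on the output, for a satisfiable formula. -/
theorem FinalState.output {n k b T s : ℕ} {F : CNFFormula n}
    {τ : Fin (T * (n * (b + 1))) → Bool} {σ : RamState} (hk : 2 ≤ k) (hs : 1 ≤ s)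
    (hσ : FinalState F b T (centers k s) s (extendTape τ) σ) (hR : Rich k F (hitSolutions F τ))
    (hF : ∃ z, Satisfies F z) :
    (outputMultiset n s σ).card = s ∧ (∀ z ∈ outputMultiset n s σ, Satisfies F z) ∧
      QualityBounds k s (sumPD (outputMultiset n s σ)) (optSum F s) := by
  obtain ⟨W, hW, hout⟩ := hσ
  have hRW : Rich k F {z | z ∈ W} := by
    refine hR.mono ?_
    rintro z ⟨hz, t, ht⟩
    exact hW.complete z hz t t.2 (by simpa [hitSet, roundData] using ht)
  have hne : W ≠ [] := by
    obtain ⟨z, hz⟩ := hF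
    -- Any choice of the set would do here: only the existence of a listed solution is needed.
    obtain ⟨w, hw, -⟩ := hRW.near z hz ∅
    exact List.ne_nil_of_mem hw
  obtain ⟨Y, hY, harr⟩ := hout hne
  have hm := centers_pos k hs
  have hS : outputMultiset n s σ =
      (Finset.univ : Finset (Fin s)).val.map fun j : Fin s => Y (j % centers k s) := by
    rw [outputMultiset_eq]
    refine Multiset.map_congr rfl fun j _ => funext fun i => ?_
    rw [harr j j.2 i]
    cases Y (j % centers k s) i <;> rfl
  refine ⟨by simp [outputMultiset_eq], ?_, ?_⟩
  · intro z hz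
    rw [hS] at hz
    obtain ⟨j, -, rfl⟩ := Multiset.mem_map.1 hz
    exact hW.sat _ (hY.1 _ (Nat.mod_lt _ hm))
  · obtain ⟨S, hSc, hSF, hSo⟩ := (optSum_isGreatest F s hF).1
    obtain ⟨O, rfl⟩ := exists_eq_map_fin hSc
    rw [← hSo, hS, sumPD_map_fin, sumPD_map_fin fun l => Y (l % centers k s)]
    refine (hY.quality hk hs hRW fun l hl => ?_).const_mul (by norm_num)
    exact hSF _ (Multiset.mem_map.2 ⟨⟨l, hl⟩, Finset.mem_univ_val _, rfl⟩)

theorem ofReal_le_toOuterMeasure_map_uniform {α β : Type*} [Fintype α] [Nonempty α]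
    [DecidableEq α] (G : α → β) (A : Set β) (P : α → Prop) [DecidablePred P] (δ : ℝ)
    (hP : ∀ x, P x → G x ∈ A)
    (hδ : ((Finset.univ.filter fun x => ¬ P x).card : ℝ) ≤ Fintype.card α * δ) :
    ENNReal.ofReal (1 - δ) ≤ ((PMF.uniformOfFintype α).map G).toOuterMeasure A := by
  have hN : (0 : ℝ) < Fintype.card α := by exact_mod_cast Fintype.card_pos
  have h1 : ((Finset.univ.filter P).card : ℝ) + (Finset.univ.filter fun x => ¬ P x).card =
      Fintype.card α := by
    exact_mod_cast Finset.card_filter_add_card_filter_not P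
  calc ENNReal.ofReal (1 - δ)
      ≤ ENNReal.ofReal ((Finset.univ.filter P).card / Fintype.card α) := by
        refine ENNReal.ofReal_le_ofReal ?_
        rw [le_div_iff₀ hN]
        linarith
    _ = (Fintype.card {x // P x} : ENNReal) / Fintype.card α := by
        rw [ENNReal.ofReal_div_of_pos hN, ENNReal.ofReal_natCast, ENNReal.ofReal_natCast,
          Fintype.card_subtype]
    _ = (PMF.uniformOfFintype α).toOuterMeasure {x | P x} :=
        (PMF.toOuterMeasure_uniformOfFintype_apply {x | P x}).symm
    _ ≤ (PMF.uniformOfFintype α).toOuterMeasure (G ⁻¹' A) :=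
        (PMF.uniformOfFintype α).toOuterMeasure.mono hP
    _ = _ := (PMF.toOuterMeasure_map_apply G _ A).symm

theorem mainTheorem6 :
    ∃ (c : ℕ) (ε : ℕ → ℝ), Tendsto ε atTop (𝓝 0) ∧
      ∀ k : ℕ, 2 ≤ k → ∃ (A : RamProg) (K : ℝ),
        ∀ (n : ℕ) (F : CNFFormula n), IsKCNF k F → ∀ s : ℕ, 1 ≤ s →
          ∃ μ : PMF RamState, A.HaltsWith (inputState F s) μ ∧
            (∀ σ ∈ μ.support,
              (σ.time : ℝ) ≤ K * (formulaSize F : ℝ) ^ c *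
                ((s : ℝ) ^ 4 * (2 : ℝ) ^ ((n : ℝ) - (n : ℝ) / (k : ℝ)))) ∧
            ((∃ z, Satisfies F z) →
              ENNReal.ofReal (1 - ε n) ≤ μ.toOuterMeasure
                {σ | (outputMultiset n s σ).card = s ∧
                  (∀ z ∈ outputMultiset n s σ, Satisfies F z) ∧
                  (s ≤ 3 + ⌊(4 : ℝ) / ((k : ℝ) - 1)⌋₊ →
                    1 / 2 * (1 - 2 / ((k : ℝ) + 1)) * optSum F s
                      ≤ sumPD (outputMultiset n s σ)) ∧
                  (3 + ⌈(4 : ℝ) / ((k : ℝ) - 1)⌉₊ ≤ s →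
                    ((k : ℝ) - 1) / ((k : ℝ) + 3) *
                        ((1 - 1 / (s : ℝ)) /
                          (1 + ((k : ℝ) - 1) / ((k : ℝ) + 3) * (1 / (s : ℝ)))) * optSum F s
                      ≤ sumPD (outputMultiset n s σ))}) := by
  classical
  -- Five factors of the formula size come from the number of operations and one from the cost of a
  -- single operation; the failure probability is that of `card_not_rich_le`.
  refine ⟨6, fun n => (2 : ℝ)⁻¹ ^ n,
    tendsto_pow_atTop_nhds_zero_of_lt_one (by norm_num) (by norm_num), fun k hk => ?_⟩
  -- The constant is twice that of `mainProg_correct`, since rounding down n/k in the number of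
  -- rounds costs at most a factor 2.
  refine ⟨mainProg k, 80000 * 2 ^ (k + 3) * (k + 100), fun n F hF s hs => ?_⟩
  obtain ⟨b, hnb, -, G, hhalt, hG⟩ := mainProg_correct (k := k) F (by omega) hs
  refine ⟨_, hhalt, fun σ hσ => ?_, fun hsat => ?_⟩
  · obtain ⟨τ, -, rfl⟩ := (PMF.mem_support_map_iff _ _ _).1 hσ
    have h1 : ((G τ).time : ℝ) ≤ 40000 * 2 ^ (k + 3) * (k + 100) * 2 ^ (n - n / k) * s ^ 4 *
        formulaSize F ^ 6 := by exact_mod_cast (hG τ).1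
    calc ((G τ).time : ℝ)
        ≤ 40000 * 2 ^ (k + 3) * (k + 100) * formulaSize F ^ 6 * s ^ 4 * (2 : ℝ) ^ (n - n / k) := by
          linarith
      _ ≤ 40000 * 2 ^ (k + 3) * (k + 100) * formulaSize F ^ 6 * s ^ 4 *
          (2 * (2 : ℝ) ^ ((n : ℝ) - (n : ℝ) / k)) :=
          mul_le_mul_of_nonneg_left (two_pow_sub_div_le k n) (by positivity)
      _ = _ := by ring
  · refine ofReal_le_toOuterMeasure_map_uniform G _ (fun τ => Rich k F (hitSolutions F τ)) _
      (fun τ hτ => (hG τ).2.output hk hs hτ hsat) ?_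
    have := card_not_rich_le hF hnb hk
    simpa using this
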